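/- **Setting.** Let $\kappa$ be a strongly inaccessible cardinal and $\lambda<\kappa$ an infinite regular cardinal. Let $P\subseteq V_\kappa$, and let $\phi$ be a first order sentence in the vocabulary $\{\in,R_0,R_1,R_2,R_3\}$ ($R_0$ unary, $R_1,R_2,R_3$ binary) such that $s\sim t \iff (V_\kappa,\in,P,s,t,r)\models\phi$ for some $r\in{}^\kappa2$ defines an equivalence relation on ${}^\kappa 2$; assume that $(V_\kappa,\in,P,s,t,r)\models\phi\iff(V_\kappa,\in,P,t,s,r)\models\phi$ for all $s,t,r$, and that $s\sim t$ whenever $s(\beth_\alpha)=t(\beth_\alpha)$ for all $\alpha<\kappa$. For a set $X$ of ordinals let $\sup^+X=\sup\{\alpha+1:\alpha\in X\}$. Cardinals are identified with initial ordinals, and ordinal arithmetic is used. **The tree.** Let $T_0=\{\langle\rangle\}$; for $0<\alpha<\kappa$ let $T_\alpha$ be the set of tuples $u=\langle\eta,\nu,\tau,C\rangle$ with $\eta,\nu,\tau\in{}^{\beth_\alpha}2$, $\eta\ne\nu$, and $C$ a closed subset of $\alpha$; write $o(u)=\alpha$, $u_1=\eta$, $u_2=\nu$, $u_3=\tau$,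 $C_u=C$ (and $o(\langle\rangle)=0$, $C_{\langle\rangle}=\emptyset$). Let $T=\bigcup_{\alpha<\kappa}T_\alpha$; $u{\restriction}\beta=\langle u_1{\restriction}\beth_\beta,u_2{\restriction}\beth_\beta,u_3{\restriction}\beth_\beta,C_u\cap\beta\rangle$ for $\beta>0$ and $u{\restriction}0=\langle\rangle$; $u\lhd v$ iff $u=v{\restriction}o(u)$ and $o(u)\in C_v$; $u^{-1}=\langle u_2,u_1,u_3,C_u\rangle$, $\langle\rangle^{-1}=\langle\rangle$. Let $T_<$ be the set of $u\in T\setminus\{\langle\rangle\}$ with $u_1$ lexicographically before $u_2$. For $s,t,r\in{}^\kappa2$ let $C(s,t,r)$ consist of $0$ and of all $\delta<\kappa$ with $(V_\delta,P\cap V_\delta,s{\restriction}\delta,t{\restriction}\delta,r{\restriction}\delta)\prec(V_\kappa,P,s,t,r)\models\phi$. Let $T^H$ be the set of $u\in T$ for which there are $s,t,r$ with $u_1\subseteq s$, $u_2\subseteq t$, $u_3\subseteq r$, $o(u)\in C(s,t,r)$, $C_u=C(s,t,r)\cap o(u)$ (with no inclusion requirement for $u=\langle\rangle$). Let $\Gamma=\{\gamma+2:\gamma<\kappa\}$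 and let $\pi$ be a function from $\{0\}\cup\Gamma$ onto $\{\langle\rangle\}\cup T_<$ such that for every $\alpha$ in its domain either $\alpha=0$ and $\pi(\alpha)=\langle\rangle$, or $o(\pi(\alpha))<\alpha$, and such that each $u\in\{\langle\rangle\}\cup T_<$ equals $\pi(\alpha)$ for unboundedly many $\alpha\in\Gamma$. Let $T^G$ be the smallest subset of $T$ which contains $\langle\rangle$, is closed under $u\mapsto u^{-1}$, and contains every $u\in T_<$ such that one of the following holds: (i) $\sup C_u<o(u)\in\Gamma$, $C_u$ has a maximum $\gamma$, and $\pi(o(u))=u{\restriction}\gamma\in T^H\cup T^G$; (ii) $\sup C_u=o(u)$, $C_u\cap\Gamma\neq\emptyset$, $\mathrm{cf}(o(u))<\lambda$, and $u{\restriction}\beta\in T^H\cup T^G$ for all $\beta\in C_u$. Call a function $\eta$ with domain $\beth_\alpha$ *block-constant* if $\eta(\xi)=0$ for $\xi<\beth_0$ and, for every $\beta<\alpha$, $\eta$ is constant on $[\beth_\beta,\beth_{\beta+1})$. Let $U$ consist of $\langle\rangle$ and of all $u\in T^H\cup T^G$ with $u_1,u_2,u_3$ block-constant. For $u,v\in U$,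 $u$ is a successor of $v$ if $v\lhd u$ and no $w\in U$ satisfies $v\lhd w\lhd u$; if $u\ne\langle\rangle$ is a successor of no $v$, it is a limit. **The functions $p_u$.** Fix well-orderings of the sets $U\cap T_\alpha$; order $U$ by $o(u)$ first and by these well-orderings second. For each $\beta<\kappa$ fix an enumeration $\langle w^\beta_\gamma:\gamma<\theta_\beta\rangle$, $\theta_\beta\le\beth_{\beta+1}$, of $T_\beta$ without repetition. Let $E^\beta_\gamma$ be the function with domain $\beth_\beta$ and $E^\beta_\gamma(\xi)=\beth_\beta\cdot(\gamma+1)+\xi$. For functions $p,e$ let $p\uplus e=p\cup e{\restriction}(\mathrm{dom}\,e\setminus\mathrm{dom}\,p)$. Let $\mathrm{id}_u$ be the identity on $\{\xi<\beth_{o(u)}:u_1{\restriction}(\xi+1)=u_2{\restriction}(\xi+1)\}$. Define $p_u$, $u\in U$, by recursion: $p_{\langle\rangle}=\emptyset$. If $u\in T_<$ is a successor of $v$, let $\beta$ be the predecessor of $o(u)$ if $u\notin T^H$, and $\beta=\beta'_v$ if $u\in T^H$, where $\beta'_w$ ($w\in U$) is the least limit ordinal not in $\mathrm{dom}(\mathrm{id}_u)\cup(o(w)+1)\cup\{\beta'_{w'}:w'\in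 U\text{ before }w\}$; let $\gamma$ be such that $u{\restriction}\beta=w^\beta_\gamma$ (if $u{\restriction}\beta\notin T_\beta$, then $\gamma$ does not affect $p_u$), and put $$p_u=\mathrm{id}_u\uplus(p_v\uplus E^\beta_\gamma)\ \text{ if }\mathrm{ran}\,p_v\text{ is an ordinal},\qquad p_u=\bigl(\mathrm{id}_u\uplus(p_v^{-1}\uplus E^\beta_\gamma)\bigr)^{-1}\ \text{ otherwise.}$$ If $u\in T_<$ is a limit, $p_u=\bigcup\{p_v:v\in U,\ v\lhd u\}$. If $u\in U\setminus(T_<\cup\{\langle\rangle\})$, then $p_u=(p_{u^{-1}})^{-1}$. **The club $D$.** Let $b_u=u_1{\restriction}\sup^+\mathrm{dom}\,p_u$, $e_u=u_2{\restriction}\sup^+\mathrm{ran}\,p_u$, $X=\{\langle p_u,b_u,e_u\rangle:u\in U\}$, $Y=\{\langle u,p_u,b_u,e_u\rangle:u\in U\}$ and $$D=\{\mu<\kappa:\lambda<\mu,\ (V_\mu,\pi\cap V_\mu,X\cap V_\mu,Y\cap V_\mu)\prec(V_\kappa,\pi,X,Y)\}.$$ ($\beth_\mu=\mu$ for all $\mu\in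 D\cup\{\kappa\}$.) **Compositions.** Let $\mathrm{Seq}$ be the set of pairs $(\bar u,W)$ with $\bar u=\langle u_0,\dots,u_{n-1}\rangle$, $1\le n<\omega$, $u_i\in U\setminus\{\langle\rangle\}$, and $W=W_0\ne\emptyset$, such that $W_i\subseteq\mathrm{dom}\,p_{u_i}$, $W_{i+1}=p_{u_i}[W_i]$ for all $i<n$, and $(u_i)_2$ and $(u_{i+1})_1$ have the same restriction to $\sup^+W_{i+1}$ for $i+1<n$. It gives the functions $f_i=p_{u_i}{\restriction}W_i$ and $f=f_{n-1}\circ\dots\circ f_0$; put $\mathrm{Beg}f_i=(u_i)_1{\restriction}\sup^+W_i$, $\mathrm{End}f_i=(u_i)_2{\restriction}\sup^+W_{i+1}$. The sequence $\bar f=\langle f_i\rangle_{i<n}$ is minimal if $W_i\not\subseteq\mathrm{dom}\,p_v$ for all $i<n$ and $v\in U$ with $v\lhd u_i$, and there are no $i\le j<n$ such that $f_j\circ\dots\circ f_i$ is an identity function and $\mathrm{Beg}f_i=\mathrm{End}f_j$. For a cardinal $\mu\in D\cup\{\kappa\}$ and $\eta,\nu\in{}^\mu2$ let $F_\mu(\eta,\nu)$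 be the set of the minimal sequences $\bar f$ with $o(u_i)<\mu$ for all $i$, $\mathrm{Beg}f_0\subseteq\eta$ and $\mathrm{End}f_{n-1}\subseteq\nu$. **The models.** For a cardinal $\mu\in D\cup\{\kappa\}$ and $\eta\in{}^\mu2$, $M_\eta$ is the model with universe $\mu$ and with one relation symbol $R_a$ of arity $\theta$ for each sequence $a$ of length $\theta<\mu$ without repetition of ordinals below $\mu$ such that $\sup^+a<\mu$ (where $\sup^+a$ is $\sup^+$ of the set of values of $a$). It is interpreted as the set of all $b\in{}^\theta\mu$ such that either $b=a$ and $\eta$ is $0$ on $\sup^+a$, or $b=f(a)$ for some $\bar f\in F_\mu(0_\mu,\eta)$ whose domain $W$ is the set of values of $a$; here $0_\mu$ is the constant function $0$ on $\mu$. **Game and language.** In the Ehrenfeucht–Fraïssé game of length $\lambda$ with sets of size $<\mu$ between $M$ and $N$, on round $i<\lambda$ player $\forall$ chooses one of the two models and a subset $A_i$ of it of cardinality $<\mu$, and player $\exists$ replies with a partial isomorphism $p_i$ from $M$ to $N$ which extends all $p_j$, $j<i$, and satisfies $A_i\subseteq\mathrm{dom}\,p_i$ if $M$ was chosen, $A_i\subseteq\mathrm{ran}\,p_i$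 if $N$ was chosen; $\exists$ wins if the play lasts $\lambda$ rounds. $L_{\infty\kappa}$ allows conjunctions of arbitrary sets of formulas and quantification over strings of fewer than $\kappa$ variables. **Statement.** Let $\mu$ be a regular cardinal in $D$, or $\mu=\kappa$. Then for all block-constant $\eta,\nu\in{}^\mu2$, player $\exists$ has a winning strategy in the Ehrenfeucht–Fraïssé game of length $\lambda$ with sets of size $<\mu$ between $M_\eta$ and $M_\nu$. In particular, the models $M_t$, for block-constant $t\in{}^\kappa2$, satisfy the same sentences of $L_{\infty\kappa}$. -/

import Mathlib

universe u a b c w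

open Cardinal Ordinal

noncomputable section

/-! ## Relational structures with relations of arbitrary (possibly infinite) arity,
the Ehrenfeucht–Fraïssé game, and the language `L_{∞κ}` -/

/-- A relational vocabulary: relation symbols, each with an arity (an index type). -/
structure InfVoc where
  Sym : Type a
  arity : Sym → Type b

/-- A model of a relational vocabulary. -/
structure InfModel (V : InfVoc.{a, b}) where
  carrier : Type c
  rel : (R : V.Sym) → (V.arity R → carrier) → Prop

/-- A partial isomorphism from `M` to `N`, given by its graph: a partial function which is
injective and preserves all relations in both directions. -/
structure IsPartialIso {V : InfVoc.{a, b}} (M N : InfModel.{a, b, c} V)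
    (p : Set (M.carrier × N.carrier)) : Prop where
  functional : ∀ x y y', (x, y) ∈ p → (x, y') ∈ p → y = y'
  injective : ∀ x x' y, (x, y) ∈ p → (x', y) ∈ p → x = x'
  rel_iff : ∀ (R : V.Sym) (x : V.arity R → M.carrier) (y : V.arity R → N.carrier),
    (∀ i, (x i, y i) ∈ p) → (M.rel R x ↔ N.rel R y)

/-- A move of player `∀`: one of the two models together with a subset of it. -/
abbrev EFMove {V : InfVoc.{a, b}} (M N : InfModel.{a, b, c} V) : Type c :=
  Set M.carrier ⊕ Set N.carrier

/-- The chosen subset has cardinality `< μ`. -/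
def EFMove.Legal {V : InfVoc.{a, b}} {M N : InfModel.{a, b, c} V} (μ : Cardinal.{w}) :
    EFMove M N → Prop
  | .inl A => Cardinal.lift.{w} #A < Cardinal.lift.{c} μ
  | .inr A => Cardinal.lift.{w} #A < Cardinal.lift.{c} μ

/-- The reply `p` covers the chosen subset. -/
def EFMove.Covers {V : InfVoc.{a, b}} {M N : InfModel.{a, b, c} V}
    (p : Set (M.carrier × N.carrier)) : EFMove M N → Prop
  | .inl A => A ⊆ Prod.fst '' p
  | .inr A => A ⊆ Prod.snd '' p

/-- A strategy of player `∃` in the game of length `lam`: on round `i < lam` the reply is computed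
from the moves made by player `∀` on the rounds `j ≤ i`. -/
abbrev EFStrategy {V : InfVoc.{a, b}} (lam : Cardinal.{w}) (M N : InfModel.{a, b, c} V) :=
  (i : Set.Iio lam.ord) → (Set.Iic i → EFMove M N) → Set (M.carrier × N.carrier)

/-- The strategy is winning in the game with sets of size `< μ`: against all legal moves of
player `∀`, every reply is a correct one, so that the play lasts `lam` rounds. -/
def EFStrategy.Winning {V : InfVoc.{a, b}} {lam : Cardinal.{w}} {M N : InfModel.{a, b, c} V}
    (μ : Cardinal.{w}) (σ : EFStrategy lam M N) : Prop :=
  ∀ m : Set.Iio lam.ord → EFMove M N, (∀ i, (m i).Legal μ) →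
    ∀ i, IsPartialIso M N (σ i fun j => m j) ∧
      (⋃ j : Set.Iio i, σ j.1 fun k => m k) ⊆ (σ i fun j => m j) ∧
      (m i).Covers (σ i fun j => m j)

/-- Player `∃` has a winning strategy in the Ehrenfeucht–Fraïssé game of length `lam` with sets of
size `< μ`. -/
def EFEquiv {V : InfVoc.{a, b}} (μ lam : Cardinal.{w}) (M N : InfModel.{a, b, c} V) : Prop :=
  ∃ σ : EFStrategy lam M N, σ.Winning μ

/-- Formulas of `L_{∞κ}` with free variables indexed by `α`: conjunctions of arbitrary sets of
formulas, and quantification over strings of fewer than `κ` variables. -/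
inductive InfFormula (V : InfVoc.{a, b}) (κ : Cardinal.{u}) : Type u → Type (max a b (u + 1))
  | rel {α : Type u} (R : V.Sym) (x : V.arity R → α) : InfFormula V κ α
  | eq {α : Type u} (x y : α) : InfFormula V κ α
  | neg {α : Type u} (f : InfFormula V κ α) : InfFormula V κ α
  | conj {α ι : Type u} (f : ι → InfFormula V κ α) : InfFormula V κ α
  | ex {α : Type u} (β : Type u) (hβ : #β < κ) (f : InfFormula V κ (α ⊕ β)) : InfFormula V κ α

/-- Satisfaction of a formula of `L_{∞κ}` under an assignment of its free variables. -/
def InfFormula.Realize {V : InfVoc.{a, b}} {κ : Cardinal.{u}} (M : InfModel.{a, b, c} V) :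
    {α : Type u} → InfFormula V κ α → (α → M.carrier) → Prop
  | _, .rel R x, v => M.rel R fun i => v (x i)
  | _, .eq x y, v => v x = v y
  | _, .neg f, v => ¬ f.Realize M v
  | _, .conj f, v => ∀ i, (f i).Realize M v
  | _, .ex _ _ f, v => ∃ y, f.Realize M (Sum.elim v y)

/-- `M` and `N` satisfy the same sentences of `L_{∞κ}`. -/
def LEquiv {V : InfVoc.{a, b}} (κ : Cardinal.{u}) (M N : InfModel.{a, b, c} V) : Prop :=
  ∀ f : InfFormula V κ PEmpty.{u + 1}, f.Realize M PEmpty.elim ↔ f.Realize N PEmpty.elim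

/-! ## The structures on `V_κ` -/

/-- `V_κ`: the sets of rank `< κ`. -/
abbrev VSet (κ : Cardinal.{u}) : Type (u + 1) := {x : ZFSet.{u} // x.rank < κ.ord}

/-- Relation symbols: `∈`, a unary `R₀`, binary `R₁`, `R₂`, `R₃`. -/
inductive SigmaRel : ℕ → Type
  | mem : SigmaRel 2
  | r0 : SigmaRel 1
  | r1 : SigmaRel 2
  | r2 : SigmaRel 2
  | r3 : SigmaRel 2

/-- The vocabulary `{∈, R₀, R₁, R₂, R₃}`. -/
abbrev sigmaLang : FirstOrder.Language.{0, 0} := ⟨fun _ => Empty, SigmaRel⟩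

/-- Relation symbols: `∈`, and symbols for a binary, a ternary and a quaternary relation. -/
inductive ClubRel : ℕ → Type
  | mem : ClubRel 2
  | pi : ClubRel 2
  | x : ClubRel 3
  | y : ClubRel 4

/-- The vocabulary with which the club `D` is defined. -/
abbrev clubLang : FirstOrder.Language.{0, 0} := ⟨fun _ => Empty, ClubRel⟩

/-- The values `0` and `1` as sets. -/
def bit (i : Bool) : ZFSet.{u} := (if i then 1 else 0 : Ordinal.{u}).toZFSet

/-- The set `s`, for a function `s` from ordinals to `2`, as a binary relation between sets. -/
def funRel (s : Ordinal.{u} → Bool) (x y : ZFSet.{u}) : Prop :=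
  ∃ ξ : Ordinal.{u}, x = ξ.toZFSet ∧ y = bit (s ξ)

/-- The structure `(V_κ, ∈, P, s, t, r)`. -/
def sigmaStructure (κ : Cardinal.{u}) (P : Set ZFSet.{u}) (s t r : Ordinal.{u} → Bool) :
    sigmaLang.Structure (VSet κ) where
  funMap := fun f => f.elim
  RelMap := fun R => match R with
    | .mem => fun v => (v 0).1 ∈ (v 1).1
    | .r0 => fun v => (v 0).1 ∈ P
    | .r1 => fun v => funRel s (v 0).1 (v 1).1
    | .r2 => fun v => funRel t (v 0).1 (v 1).1
    | .r3 => fun v => funRel r (v 0).1 (v 1).1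

/-- `V_δ`, with the structure induced from the structure `S` on `V_κ`, is an elementary
substructure of `V_κ`. -/
def ElemInitial {L : FirstOrder.Language.{0, 0}} {κ : Cardinal.{u}} (S : L.Structure (VSet κ))
    (δ : Ordinal.{u}) : Prop :=
  letI := S
  ∃ N : L.ElementarySubstructure (VSet κ), (N : Set (VSet κ)) = {x | x.1.rank < δ}

/-! ## Sets of ordinals, functions into `2`, graphs of partial functions -/

/-- `sup {α + 1 | α ∈ X}`. -/
def pSup (X : Set Ordinal.{u}) : Ordinal.{u} := sSup ((fun α => α + 1) '' X)

/-- The cardinal `ℶ_α` as an ordinal. -/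
def bth (α : Ordinal.{u}) : Ordinal.{u} := (ℶ_ α).ord

/-- The restriction of `η` to `δ`; functions from `δ` to `2` are represented by functions on all
ordinals which vanish outside `δ`. -/
def cutFun (η : Ordinal.{u} → Bool) (δ : Ordinal.{u}) : Ordinal.{u} → Bool :=
  open Classical in fun ξ => if ξ < δ then η ξ else false

/-- `η` and `ν` have the same restriction to `δ`. -/
def AgreeBelow (η ν : Ordinal.{u} → Bool) (δ : Ordinal.{u}) : Prop := ∀ ξ < δ, η ξ = ν ξ

/-- The restriction of `η` to `ℶ_α` is `0` below `ℶ_0` and constant on each interval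
`[ℶ_β, ℶ_{β+1})`, `β < α`. -/
def BlockConst (α : Ordinal.{u}) (η : Ordinal.{u} → Bool) : Prop :=
  (∀ ξ < bth 0, η ξ = false) ∧
    ∀ β < α, ∀ ξ, bth β ≤ ξ → ξ < bth (β + 1) → η ξ = η (bth β)

/-- Relations between ordinals, used as graphs of partial functions. -/
abbrev OrdGraph : Type (u + 1) := Set (Ordinal.{u} × Ordinal.{u})

namespace OrdGraph

def dom (p : OrdGraph.{u}) : Set Ordinal.{u} := Prod.fst '' p

def ran (p : OrdGraph.{u}) : Set Ordinal.{u} := Prod.snd '' p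

/-- The inverse of `p`. -/
def inv (p : OrdGraph.{u}) : OrdGraph.{u} := {x | (x.2, x.1) ∈ p}

/-- The image of the set `W` under `p`. -/
def img (p : OrdGraph.{u}) (W : Set Ordinal.{u}) : Set Ordinal.{u} := {y | ∃ x ∈ W, (x, y) ∈ p}

/-- First `p`, then `q`. -/
def andThen (p q : OrdGraph.{u}) : OrdGraph.{u} := {x | ∃ y, (x.1, y) ∈ p ∧ (y, x.2) ∈ q}

/-- `p` extended by the part of `e` outside the domain of `p`. -/
def extendBy (p e : OrdGraph.{u}) : OrdGraph.{u} := p ∪ {x | x ∈ e ∧ x.1 ∉ p.dom}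

end OrdGraph

/-- The function with domain `ℶ_β` which maps `ξ` to `ℶ_β · (γ + 1) + ξ`. -/
def eGraph (β γ : Ordinal.{u}) : OrdGraph.{u} := {x | x.1 < bth β ∧ x.2 = bth β * (γ + 1) + x.1}

/-! ## The tree `T` -/

/-- A tuple `(η, ν, τ, C)` together with its level. -/
@[ext]
structure TNode where
  ord : Ordinal.{u}
  fst : Ordinal.{u} → Bool
  snd : Ordinal.{u} → Bool
  trd : Ordinal.{u} → Bool
  cub : Set Ordinal.{u}

namespace TNode

/-- The empty tuple. -/
def root : TNode.{u} := ⟨0, fun _ => false, fun _ => false, fun _ => false, ∅⟩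

/-- The tuple with the first two components exchanged. -/
def inv (u : TNode.{u}) : TNode.{u} := ⟨u.ord, u.snd, u.fst, u.trd, u.cub⟩

/-- The restriction of `u` to the level `β`. -/
def cut (u : TNode.{u}) (β : Ordinal.{u}) : TNode.{u} :=
  open Classical in
  if β = 0 then root
  else ⟨β, cutFun u.fst (bth β), cutFun u.snd (bth β), cutFun u.trd (bth β), u.cub ∩ Set.Iio β⟩

/-- The tree order. -/
def Below (u v : TNode.{u}) : Prop := u = v.cut u.ord ∧ u.ord ∈ v.cub

/-- The level `T_α`: it consists of the empty tuple if `α = 0`, and otherwise of all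
`(η, ν, τ, C)` with `η, ν, τ` functions from `ℶ_α` to `2`, `η ≠ ν`, and `C` a closed subset
of `α`. -/
def Level (α : Ordinal.{u}) : Set TNode.{u} :=
  {u | u.ord = α ∧ (α = 0 → u = root) ∧ (α ≠ 0 →
    cutFun u.fst (bth α) = u.fst ∧ cutFun u.snd (bth α) = u.snd ∧ cutFun u.trd (bth α) = u.trd ∧
    u.fst ≠ u.snd ∧ u.cub ⊆ Set.Iio α ∧ ∀ X ⊆ u.cub, X.Nonempty → sSup X < α → sSup X ∈ u.cub)}

/-- The first component lexicographically precedes the second one. -/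
def LexLt (u : TNode.{u}) : Prop :=
  ∃ ξ < bth u.ord, AgreeBelow u.fst u.snd ξ ∧ u.fst ξ = false ∧ u.snd ξ = true

/-- The identity function on the ordinals `ξ < ℶ_{ord u}` such that the first two components of `u`
have the same restriction to `ξ + 1`. -/
def idGraph (u : TNode.{u}) : OrdGraph.{u} :=
  {x | x.1 = x.2 ∧ x.1 < bth u.ord ∧ AgreeBelow u.fst u.snd (x.1 + 1)}

/-- The restriction of `η` to `δ` as a set. -/
def codeFun (η : Ordinal.{u} → Bool) (δ : Ordinal.{u}) : ZFSet.{u} :=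
  ZFSet.pairSep (funRel η) δ.toZFSet (2 : Ordinal.{u}).toZFSet

/-- The tuple as a set. -/
def code (u : TNode.{u}) : ZFSet.{u} :=
  open Classical in
  if u.ord = 0 then ∅
  else ZFSet.pair (codeFun u.fst (bth u.ord)) (ZFSet.pair (codeFun u.snd (bth u.ord))
    (ZFSet.pair (codeFun u.trd (bth u.ord))
      (ZFSet.sep (fun x => ∃ ξ ∈ u.cub, x = ξ.toZFSet) u.ord.toZFSet)))

end TNode

/-- The set of the ordinals `β + 1` with `β` a successor ordinal. -/
def gInds : Set Ordinal.{u} := {α | ∃ γ, α = γ + 1 + 1}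

/-! ## The construction -/

/-- The objects fixed for the construction: the cardinals `κ` and `λ`, the parameter `P` and the
sentence `φ`, the function `π`, well-orderings `wo α` (used only on the level `α` of the tree `U`;
every well-ordering of that level extends to one of all nodes), and enumerations
`γ ↦ enum β γ` of the levels `T_β`. -/
structure Construction where
  κ : Cardinal.{u}
  lam : Cardinal.{u}
  P : Set ZFSet.{u}
  φ : sigmaLang.Sentence
  π : Ordinal.{u} → TNode.{u}
  wo : Ordinal.{u} → TNode.{u} → TNode.{u} → Prop
  wo_isWellOrder : ∀ α, IsWellOrder TNode.{u} (wo α)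
  enum : Ordinal.{u} → Ordinal.{u} → TNode.{u}

namespace Construction

variable (K : Construction.{u})

/-- `(V_κ, ∈, P, s, t, r) ⊨ φ`. -/
def Sat (s t r : Ordinal.{u} → Bool) : Prop :=
  letI := sigmaStructure K.κ K.P s t r
  FirstOrder.Language.Sentence.Realize (VSet K.κ) K.φ

/-- The relation defined by `φ` and `P` on functions from `κ` to `2` (represented by functions on
all ordinals; the values outside `κ` play no role). -/
def Eqv (s t : Ordinal.{u} → Bool) : Prop := ∃ r, K.Sat s t r

/-- The tree `T`. -/
def T : Set TNode.{u} := ⋃ α ∈ Set.Iio K.κ.ord, TNode.Level α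

/-- The elements of `T` whose first component lexicographically precedes the second one. -/
def TLt : Set TNode.{u} := {u | u ∈ K.T ∧ u.LexLt}

/-- `{0}` together with the `δ < κ` such that
`(V_δ, P ∩ V_δ, s↾δ, t↾δ, r↾δ) ≺ (V_κ, P, s, t, r) ⊨ φ`. -/
def cubOf (s t r : Ordinal.{u} → Bool) : Set Ordinal.{u} :=
  {0} ∪ {δ | δ < K.κ.ord ∧ ElemInitial (sigmaStructure K.κ K.P s t r) δ ∧ K.Sat s t r}

/-- The set `T^H`. -/
def TH : Set TNode.{u} :=
  {u | u ∈ K.T ∧ ∃ s t r : Ordinal.{u} → Bool,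
    AgreeBelow u.fst s (bth u.ord) ∧ AgreeBelow u.snd t (bth u.ord) ∧
    AgreeBelow u.trd r (bth u.ord) ∧
    u.ord ∈ K.cubOf s t r ∧ u.cub = K.cubOf s t r ∩ Set.Iio u.ord}

/-- The set `T^G`, as the smallest set with its closure properties. A condition
`v ∈ T^H ∪ T^G` is written as `v ∉ T^H → v ∈ T^G`. -/
inductive TG : TNode.{u} → Prop
  | root : TG TNode.root
  | inv (u : TNode.{u}) : TG u → TG u.inv
  | succ (u : TNode.{u}) (γ : Ordinal.{u}) : u ∈ K.TLt → sSup u.cub < u.ord → u.ord ∈ gInds →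
      IsGreatest u.cub γ → K.π u.ord = u.cut γ → (u.cut γ ∉ K.TH → TG (u.cut γ)) → TG u
  | limit (u : TNode.{u}) : u ∈ K.TLt → sSup u.cub = u.ord → (u.cub ∩ gInds).Nonempty →
      u.ord.cof < K.lam → (∀ β ∈ u.cub, u.cut β ∉ K.TH → TG (u.cut β)) → TG u

/-- The tree `U`. -/
def U : Set TNode.{u} :=
  {u | (u ∈ K.TH ∨ K.TG u) ∧ (u = TNode.root ∨
    (BlockConst u.ord u.fst ∧ BlockConst u.ord u.snd ∧ BlockConst u.ord u.trd))}

/-- `u` is a successor of `v` in `U`. -/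
def IsSuccOf (u v : TNode.{u}) : Prop :=
  v ∈ K.U ∧ v.Below u ∧ ¬ ∃ w ∈ K.U, v.Below w ∧ w.Below u

/-- The order in which nodes are compared by their level first, and then by the well-ordering
of that level. -/
def Prec (u v : TNode.{u}) : Prop := u.ord < v.ord ∨ (u.ord = v.ord ∧ K.wo v.ord u v)

theorem prec_wf : WellFounded K.Prec := by
  have key : ∀ α : Ordinal.{u}, ∀ v : TNode.{u}, v.ord = α → Acc K.Prec v := by
    intro α
    induction α using WellFoundedLT.induction with
    | ind α ih =>
      have := K.wo_isWellOrder α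
      intro v
      induction v using (IsWellFounded.wf (r := K.wo α)).induction with
      | _ v ihv =>
        intro hv
        refine Acc.intro v fun u hu => ?_
        rcases hu with h | ⟨h1, h2⟩
        · exact ih u.ord (hv ▸ h) u rfl
        · exact ihv u (hv ▸ h2) (h1.trans hv)
  exact ⟨fun v => key v.ord v rfl⟩

/-- The ordinals `β'_w`, `w ∈ U`, defined inductively for a fixed `u`: the least limit ordinal which
is not in `dom (id u) ∪ (ord w + 1)` and different from all `β'_{w'}` with `w'` before `w`. -/
def reflH (u : TNode.{u}) : TNode.{u} → Ordinal.{u} :=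
  K.prec_wf.fix fun w ih =>
    sInf {β | Order.IsSuccLimit β ∧ β ∉ u.idGraph.dom ∧ ¬ β < w.ord + 1 ∧
      ∀ w' (h : K.Prec w' w), w' ∈ K.U → β ≠ ih w' h}

/-- The ordinal `β` used for a successor `u` of `v`. -/
def refl (u v : TNode.{u}) : Ordinal.{u} :=
  open Classical in if u ∈ K.TH then K.reflH u v else sInf {β | u.ord = β + 1}

/-- The index of the restriction of `u` to `β` in the enumeration of `T_β`. -/
def idx (u : TNode.{u}) (β : Ordinal.{u}) : Ordinal.{u} :=
  sInf {γ | γ < bth (β + 1) ∧ K.enum β γ = u.cut β}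

/-- The function `p_u` for a successor `u` of `v`, from `q = p_v`: if the range of `q` is an ordinal
the domain of `q` is extended to `ℶ_β` by means of `eGraph β γ`, and otherwise the range of `q`
is extended to `ℶ_β` by means of the inverse of `eGraph β γ`. -/
def step (u v : TNode.{u}) (q : OrdGraph.{u}) : OrdGraph.{u} :=
  open Classical in
  let e := eGraph (K.refl u v) (K.idx u (K.refl u v))
  if ∃ o, q.ran = Set.Iio o then u.idGraph.extendBy (q.extendBy e)
  else (u.idGraph.extendBy (q.inv.extendBy e)).inv

/-- The functions `p_u` for `u` whose first component lexicographically precedes the second one,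
by recursion on the tree order. -/
def pLt (u : TNode.{u}) : OrdGraph.{u} :=
  {x | (∃ v, ∃ _ : v.ord < u.ord, K.IsSuccOf u v ∧ x ∈ K.step u v (pLt v)) ∨
    ((¬ ∃ v, K.IsSuccOf u v) ∧ ∃ v, ∃ _ : v.ord < u.ord, v ∈ K.U ∧ v.Below u ∧ x ∈ pLt v)}
termination_by u.ord

/-- The functions `p_u`. -/
def p (u : TNode.{u}) : OrdGraph.{u} :=
  open Classical in
  if u = TNode.root then ∅ else if u ∈ K.TLt then K.pLt u else (K.pLt u.inv).inv

/-! ## The club `D` -/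

/-- A subset of `κ × κ` as a set. -/
def codeGraph (p : OrdGraph.{u}) : ZFSet.{u} :=
  ZFSet.pairSep (fun x y => ∃ z ∈ p, x = z.1.toZFSet ∧ y = z.2.toZFSet)
    K.κ.ord.toZFSet K.κ.ord.toZFSet

/-- The beginning of `p_u` (the restriction of the first component of `u`), as a set. -/
def codeBeg (u : TNode.{u}) : ZFSet.{u} := TNode.codeFun u.fst (pSup (K.p u).dom)

/-- The end of `p_u` (the restriction of the second component of `u`), as a set. -/
def codeEnd (u : TNode.{u}) : ZFSet.{u} := TNode.codeFun u.snd (pSup (K.p u).ran)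

/-- The structure `(V_κ, ∈, π, X, Y)`, where `X` is the set of all triples
`(p_u, beginning of p_u, end of p_u)`, and `Y` is the set of all tuples
`(u, p_u, beginning of p_u, end of p_u)`, `u ∈ U`. -/
def clubStructure : clubLang.Structure (VSet K.κ) where
  funMap := fun f => f.elim
  RelMap := fun R => match R with
    | .mem => fun v => (v 0).1 ∈ (v 1).1
    | .pi => fun v => ∃ α, (α = 0 ∨ α ∈ gInds) ∧ α < K.κ.ord ∧
        (v 0).1 = α.toZFSet ∧ (v 1).1 = (K.π α).code
    | .x => fun v => ∃ u ∈ K.U, (v 0).1 = K.codeGraph (K.p u) ∧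
        (v 1).1 = K.codeBeg u ∧ (v 2).1 = K.codeEnd u
    | .y => fun v => ∃ u ∈ K.U, (v 0).1 = u.code ∧ (v 1).1 = K.codeGraph (K.p u) ∧
        (v 2).1 = K.codeBeg u ∧ (v 3).1 = K.codeEnd u

/-- The club `D`. -/
def D : Set Ordinal.{u} :=
  {μ | μ < K.κ.ord ∧ K.lam.ord < μ ∧ ElemInitial K.clubStructure μ}

/-! ## Compositions of the functions `p_u`, and the models -/

/-- The composition of the functions `p_u`, `u` in the list `us` (the first one is applied first). -/
def comp : List TNode.{u} → OrdGraph.{u}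
  | [] => {x | x.1 = x.2}
  | u :: us => (K.p u).andThen (comp us)

/-- `W_i`: the image of `W` under the composition of the first `i` functions. -/
def stage (us : List TNode.{u}) (W : Set Ordinal.{u}) (i : ℕ) : Set Ordinal.{u} :=
  (K.comp (us.take i)).img W

/-- The pair `(us, W)` belongs to `Seq`; the `i`-th function of the sequence is the restriction
of `p_{u_i}` to `W_i`. -/
structure IsSeq (us : List TNode.{u}) (W : Set Ordinal.{u}) : Prop where
  nonempty : W.Nonempty
  ne_nil : us ≠ []
  mem : ∀ u ∈ us, u ∈ K.U ∧ u ≠ TNode.root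
  dom : ∀ i (hi : i < us.length), K.stage us W i ⊆ (K.p us[i]).dom
  agree : ∀ i (hi : i + 1 < us.length),
    AgreeBelow us[i].snd us[i + 1].fst (pSup (K.stage us W (i + 1)))

/-- The sequence of functions given by `(us, W)` is minimal. -/
structure IsMinimal (us : List TNode.{u}) (W : Set Ordinal.{u}) : Prop where
  dom : ∀ i (hi : i < us.length), ∀ v ∈ K.U, v.Below us[i] →
    ¬ K.stage us W i ⊆ (K.p v).dom
  min : ¬ ∃ i j, ∃ (hij : i ≤ j) (hj : j < us.length),
    (∀ ξ ∈ K.stage us W i, ∀ ζ, (ξ, ζ) ∈ K.comp ((us.drop i).take (j + 1 - i)) → ξ = ζ) ∧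
    pSup (K.stage us W i) = pSup (K.stage us W (j + 1)) ∧
    AgreeBelow (us[i]'(hij.trans_lt hj)).fst us[j].snd (pSup (K.stage us W i))

/-- The sequence of functions given by `(us, W)` is minimal, all its indices are of level `< μ`, and
its beginning and end are restrictions of `η` and `ν` respectively. -/
structure IsFComp (μ : Cardinal.{u}) (η ν : Ordinal.{u} → Bool) (us : List TNode.{u})
    (W : Set Ordinal.{u}) : Prop where
  isSeq : K.IsSeq us W
  isMinimal : K.IsMinimal us W
  ord_lt : ∀ u ∈ us, u.ord < μ.ord
  beg : ∀ u, us.head? = some u → AgreeBelow u.fst η (pSup W)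
  fin : ∀ u, us.getLast? = some u → AgreeBelow u.snd ν (pSup (K.stage us W us.length))

end Construction

/-- The sequences without repetition of ordinals below `μ` which have length `< μ` and are bounded
in `μ`. -/
structure BSeq (μ : Cardinal.{u}) where
  len : Ordinal.{u}
  len_lt : len < μ.ord
  val : Set.Iio len → Ordinal.{u}
  val_lt : ∀ i, val i < μ.ord
  injective : Function.Injective val
  bounded : pSup (Set.range val) < μ.ord

/-- The vocabulary with one relation symbol `R_a` for every such sequence `a`; the arity of `R_a` is
the length of `a`. -/
def modelVoc (μ : Cardinal.{u}) : InfVoc.{u + 1, u + 1} where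
  Sym := BSeq μ
  arity := fun a => Set.Iio a.len

/-- The model `M_η` with universe `μ`, for a function `η` from `μ` to `2` (represented by a function
on all ordinals; the values outside `μ` play no role). The sequence `b` is in the relation `R_a` if
either `b = a` and `η` is `0` below `pSup a`, or `b = f(a)` for some minimal sequence of functions
with domain (the set of values of) `a`, whose beginning is a restriction of the constant function
`0` and whose end is a restriction of `η`. -/
def Construction.model (K : Construction.{u}) (μ : Cardinal.{u}) (η : Ordinal.{u} → Bool) :
    InfModel.{u + 1, u + 1, u + 1} (modelVoc μ) where
  carrier := Set.Iio μ.ord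
  rel := fun (a : BSeq μ) (b : Set.Iio a.len → Set.Iio μ.ord) =>
    ((∀ i, (b i : Ordinal.{u}) = a.val i) ∧ AgreeBelow (fun _ => false) η (pSup (Set.range a.val))) ∨
    ∃ us : List TNode.{u}, K.IsFComp μ (fun _ => false) η us (Set.range a.val) ∧
      ∀ i, (a.val i, (b i : Ordinal.{u})) ∈ K.comp us

/-- The standing assumptions on the objects fixed for the construction. -/
structure Construction.Admissible (K : Construction.{u}) : Prop where
  inaccessible : K.κ.IsInaccessible
  lam_regular : K.lam.IsRegular
  lam_lt : K.lam < K.κ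
  equivalence : Equivalence K.Eqv
  symmetric : ∀ s t r, K.Sat s t r ↔ K.Sat t s r
  constant : ∀ s t : Ordinal.{u} → Bool, (∀ α < K.κ.ord, s (bth α) = t (bth α)) → K.Eqv s t
  π_surj : K.π '' {α | α < K.κ.ord ∧ (α = 0 ∨ α ∈ gInds)} = {TNode.root} ∪ K.TLt
  π_lt : ∀ α < K.κ.ord, (α = 0 ∨ α ∈ gInds) →
    (α = 0 ∧ K.π α = TNode.root) ∨ (K.π α).ord < α
  π_unbounded : ∀ u ∈ {TNode.root} ∪ K.TLt, ∀ β < K.κ.ord,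
    ∃ α ∈ gInds, β < α ∧ α < K.κ.ord ∧ K.π α = u
  enum_bij : ∀ β < K.κ.ord, ∃ θ ≤ bth (β + 1), Set.BijOn (K.enum β) (Set.Iio θ) (TNode.Level β)

end

/-!
Player `∃` answers with the functions `p_u`, where `u` runs through the nodes of `U` on the branch
given by `η` and `ν`. If `η = ν` the identity function does. Otherwise the two functions have a
first difference, and by symmetry (`p_u` is inverted when `u` is) `η` may be taken to be smaller
there.

*The functions `p_u` are partial isomorphisms* (`isPartialIso_nodeGraph`). By recursion on the tree,
`p_u` is injective, bounded by `ℶ` of the level of `u`, and increasing in `u` (`pLt_good`). The only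
subtle point is a successor `u ∈ T^H` of `v`, where the ordinal `β'_v` has to lie between the levels
of `v` and `u` (`reflH_bounds`): the level of `u` is the height of an elementary initial segment of
`V_κ`, so it is closed under `ℶ` (`ElemInitial.bth_lt`), while there are fewer than `ℶ_{α+2}` nodes
before a node of level `α`. Now if a tuple is in a relation of `M_η`, it arises from a minimal
sequence of functions from `0` to `η` (or from no functions at all), and its image under `p_u`
arises by appending `p_u` to this sequence. The new sequence need not be minimal, but every
sequence reduces to a minimal or empty one with the same composition (`Path.exists_minimal`): a
violation of minimality allows either replacing a node by one of a smaller level or omitting a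
segment, and both decrease the multiset of levels in the well-founded Dershowitz–Manna order. So the
image is in the same relation of `M_ν`.

*The nodes on the branch extend each other as the game requires* (`IsBranch.exists_extension`). The
bookkeeping function `π` takes the value `v` at unboundedly many `γ + 2 < μ`, by the standing
assumption if `μ = κ`, and by elementarity if `μ ∈ D` (`isReflecting_of_mem_D`). At each such level
clause (i) of the definition of `T^G` puts a successor of `v` on the branch, and two successor steps
cover a given bounded set by the domain and by the range (`p_succ_cover`, `IsBranch.exists_cover`).
At limit rounds, of which the cofinality is `< λ`, clause (ii) puts the limit of the nodes played
so far into `T^G` (`IsBranch.exists_limit`). As `μ` is regular, sets of size `< μ` are bounded, so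
these functions answer all moves; this is a winning strategy (`IsChainSystem.efEquiv`). The
equivalence in `L_{∞κ}` is the usual back-and-forth induction on formulas
(`IsChainSystem.lEquiv`).
-/

noncomputable section

/-! ### Elementary initial segments of `V_κ` -/

section Elementarity

open FirstOrder FirstOrder.Language

variable {L : FirstOrder.Language.{0, 0}} {κ : Cardinal.{u}} {S : L.Structure (VSet κ)}
  {δ : Ordinal.{u}}

/-- Witnesses for existential statements about parameters in `V_δ ≺ V_κ` can be found in `V_δ`. -/
theorem ElemInitial.exists_witness (h : ElemInitial S δ) {α : Type} {n : ℕ}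
    (φ : L.BoundedFormula α (n + 1)) (v : α → VSet κ) (hv : ∀ i, (v i).1.rank < δ)
    (w : Fin n → VSet κ) (hw : ∀ i, (w i).1.rank < δ)
    (x : VSet κ) (hx : letI := S; φ.Realize v (Fin.snoc w x)) :
    ∃ y : VSet κ, y.1.rank < δ ∧ (letI := S; φ.Realize v (Fin.snoc w y)) := by
  let := S
  obtain ⟨N, hN⟩ := h
  have hmem : ∀ y : VSet κ, y ∈ N ↔ y.1.rank < δ := fun y => by
    rw [← SetLike.mem_coe, hN]; rfl
  let v' : α → N := fun i => ⟨v i, (hmem _).2 (hv i)⟩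
  let w' : Fin n → N := fun i => ⟨w i, (hmem _).2 (hw i)⟩
  have h1 : φ.ex.Realize (N.subtype ∘ v') (N.subtype ∘ w') := by
    rw [BoundedFormula.realize_ex]
    exact ⟨x, hx⟩
  rw [ElementaryEmbedding.map_boundedFormula, BoundedFormula.realize_ex] at h1
  obtain ⟨y, hy⟩ := h1
  rw [← N.subtype.map_boundedFormula, Fin.comp_snoc] at hy
  exact ⟨y.1, (hmem _).1 y.2, hy⟩

theorem ElemInitial.exists_witness_one (h : ElemInitial S δ) {α : Type}
    (φ : L.BoundedFormula α 1) (v : α → VSet κ) (hv : ∀ i, (v i).1.rank < δ)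
    (x : VSet κ) (hx : letI := S; φ.Realize v (fun _ => x)) :
    ∃ y : VSet κ, y.1.rank < δ ∧ (letI := S; φ.Realize v (fun _ => y)) := by
  have e : ∀ x : VSet κ, Fin.snoc (Fin.elim0 : Fin 0 → VSet κ) x = fun _ : Fin 1 => x := by
    intro x
    funext i
    rw [Subsingleton.elim (α := Fin 1) i (Fin.last 0), Fin.snoc_last]
  have := h.exists_witness φ v hv Fin.elim0 (fun i => i.elim0) x
  simp only [e] at this
  exact this hx

/-- The Tarski–Vaught test for `V_δ ≺ V_κ`, in a language without function symbols. -/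
theorem ElemInitial.of_exists_witness [∀ n, IsEmpty (L.Functions n)]
    (h : ∀ (n : ℕ) (φ : L.BoundedFormula Empty (n + 1)) (w : Fin n → VSet κ)
      (_ : ∀ i, (w i).1.rank < δ) (x : VSet κ) (_ : letI := S; φ.Realize default (Fin.snoc w x)),
      ∃ y : VSet κ, y.1.rank < δ ∧ (letI := S; φ.Realize default (Fin.snoc w y))) :
    ElemInitial S δ := by
  let := S
  let N : L.Substructure (VSet κ) :=
    ⟨{x | x.1.rank < δ}, fun {n} f => isEmptyElim f⟩
  refine ⟨⟨N, N.isElementary_of_exists ?_⟩, rfl⟩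
  intro n φ x a ha
  obtain ⟨y, hy, hy'⟩ := h n φ (fun i => (x i).1) (fun i => (x i).2) a ha
  exact ⟨⟨y, hy⟩, hy'⟩

/-- The map of the vocabulary which exchanges `R₁` and `R₂`. -/
def swapHom : sigmaLang →ᴸ sigmaLang where
  onFunction := fun _ f => f
  onRelation := fun _ R => match R with
    | .mem => .mem
    | .r0 => .r0
    | .r1 => .r2
    | .r2 => .r1
    | .r3 => .r3

theorem ElemInitial.swap {P : Set ZFSet.{u}} {s t r : Ordinal.{u} → Bool}
    (h : ElemInitial (sigmaStructure κ P s t r) δ) :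
    ElemInitial (sigmaStructure κ P t s r) δ := by
  have key : ∀ (n : ℕ) (φ : sigmaLang.BoundedFormula Empty n) (w : Fin n → VSet κ),
      (letI := sigmaStructure κ P s t r; (swapHom.onBoundedFormula φ).Realize default w) ↔
        (letI := sigmaStructure κ P t s r; φ.Realize default w) := by
    intro n φ w
    have : @LHom.IsExpansionOn _ _ swapHom (VSet κ) (sigmaStructure κ P t s r)
        (sigmaStructure κ P s t r) :=
      @LHom.IsExpansionOn.mk _ _ swapHom (VSet κ) (sigmaStructure κ P t s r)
        (sigmaStructure κ P s t r) (fun f _ => f.elim)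
        (fun R x => by cases R <;> rfl)
    exact @LHom.realize_onBoundedFormula _ _ (VSet κ) (sigmaStructure κ P t s r) Empty
      (sigmaStructure κ P s t r) swapHom this n φ default w
  have : ∀ n, IsEmpty (sigmaLang.Functions n) := fun n => inferInstanceAs (IsEmpty Empty)
  refine ElemInitial.of_exists_witness fun n φ w hw x hx => ?_
  obtain ⟨y, hy, hy'⟩ := h.exists_witness (swapHom.onBoundedFormula φ) default
    (fun i => i.elim) w hw x ((key _ _ _).2 hx)
  exact ⟨y, hy, (key _ _ _).1 hy'⟩

/-- The formula `x ∈ y`, with `x` a parameter. -/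
def memFormula (R : L.Relations 2) : L.BoundedFormula (Fin 1) 1 :=
  R.boundedFormula₂ (Term.var (Sum.inl 0)) (&0)

/-- `y` is nonempty and has no `∈`-maximal element. -/
def infFormula (R : L.Relations 2) : L.BoundedFormula (Fin 0) 1 :=
  (∃' R.boundedFormula₂ (&1) (&0)) ⊓
    ∀' (R.boundedFormula₂ (&1) (&0) ⟹
      ∃' (R.boundedFormula₂ (&2) (&0) ⊓ R.boundedFormula₂ (&1) (&2)))

/-- `f` codes an injection of the parameter `x` into the ordinals; the pair of `a` and its value `b`
is coded by a set `z ∈ f` containing `a` and `b`. -/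
def injFormula (R : L.Relations 2) : L.BoundedFormula (Fin 1) 1 :=
  ∀' (R.boundedFormula₂ (&1) (Term.var (Sum.inl 0)) ⟹
    ∃' (((∀' (R.boundedFormula₂ (&3) (&2) ⟹
            ∀' (R.boundedFormula₂ (&4) (&3) ⟹ R.boundedFormula₂ (&4) (&2)))) ⊓
          (∀' (R.boundedFormula₂ (&3) (&2) ⟹ ∀' (R.boundedFormula₂ (&4) (&3) ⟹
            ∀' (R.boundedFormula₂ (&5) (&4) ⟹ R.boundedFormula₂ (&5) (&3)))))) ⊓
        ((∃' (R.boundedFormula₂ (&3) (&0) ⊓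
            (R.boundedFormula₂ (&1) (&3) ⊓ R.boundedFormula₂ (&2) (&3)))) ⊓
          ∀' ∀' (R.boundedFormula₂ (&3) (Term.var (Sum.inl 0)) ⟹ R.boundedFormula₂ (&4) (&0) ⟹
            R.boundedFormula₂ (&3) (&4) ⟹ R.boundedFormula₂ (&2) (&4) ⟹ (&3) =' (&1)))))

section Realize

variable {R : L.Relations 2} (hR : ∀ v : Fin 2 → VSet κ, S.RelMap R v ↔ (v 0).1 ∈ (v 1).1)

include hR

theorem realize_memFormula (x y : VSet κ) :
    (letI := S; (memFormula R).Realize (fun _ => x) (fun _ => y)) ↔ x.1 ∈ y.1 := by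
  let := S
  simp only [memFormula, BoundedFormula.realize_rel₂]
  exact hR _

theorem realize_infFormula (y : VSet κ) (v : Fin 0 → VSet κ) :
    (letI := S; (infFormula R).Realize v (fun _ => y)) ↔
      (∃ z : VSet κ, z.1 ∈ y.1) ∧
        ∀ z : VSet κ, z.1 ∈ y.1 → ∃ w : VSet κ, w.1 ∈ y.1 ∧ z.1 ∈ w.1 := by
  let := S
  have hR' : ∀ v : Fin 2 → VSet κ, Structure.RelMap R v ↔ (v 0).1 ∈ (v 1).1 := hR
  simp only [infFormula, BoundedFormula.realize_inf, BoundedFormula.realize_ex,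
    BoundedFormula.realize_all, BoundedFormula.realize_imp, BoundedFormula.realize_rel₂, hR']
  exact Iff.rfl

theorem realize_injFormula (x f : VSet κ) :
    (letI := S; (injFormula R).Realize (fun _ => x) (fun _ => f)) ↔
      ∀ a : VSet κ, a.1 ∈ x.1 → ∃ b : VSet κ,
        ((∀ y : VSet κ, y.1 ∈ b.1 → ∀ z : VSet κ, z.1 ∈ y.1 → z.1 ∈ b.1) ∧
          (∀ y : VSet κ, y.1 ∈ b.1 → ∀ z : VSet κ, z.1 ∈ y.1 → ∀ w : VSet κ, w.1 ∈ z.1 →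
            w.1 ∈ y.1)) ∧
        (∃ z : VSet κ, z.1 ∈ f.1 ∧ a.1 ∈ z.1 ∧ b.1 ∈ z.1) ∧
        ∀ a' z : VSet κ, a'.1 ∈ x.1 → z.1 ∈ f.1 → a'.1 ∈ z.1 → b.1 ∈ z.1 → a' = a := by
  let := S
  have hR' : ∀ v : Fin 2 → VSet κ, Structure.RelMap R v ↔ (v 0).1 ∈ (v 1).1 := hR
  simp only [injFormula, BoundedFormula.realize_inf, BoundedFormula.realize_ex,
    BoundedFormula.realize_all, BoundedFormula.realize_imp, BoundedFormula.realize_rel₂, hR',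
    BoundedFormula.realize_bdEqual]
  exact Iff.rfl

end Realize

theorem ZFSet.card_lt_of_rank_lt (hκ : κ.IsInaccessible) {x : ZFSet.{u}} (hx : x.rank < κ.ord) :
    x.card < κ := by
  calc x.card ≤ (ZFSet.vonNeumann x.rank).card := ZFSet.card_mono x.subset_vonNeumann_self
    _ = preBeth x.rank := ZFSet.card_vonNeumann _
    _ < preBeth κ.ord := preBeth_strictMono hx
    _ = κ := hκ.preBeth_ord

theorem isSuccLimit_ord_of_isInaccessible (hκ : κ.IsInaccessible) :
    Order.IsSuccLimit κ.ord :=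
  Cardinal.isSuccLimit_ord hκ.isRegular.aleph0_le

/-- The sets of `V_κ` inject into the ordinals, as witnessed by a set of `V_κ`. -/
theorem exists_injection_code (hκ : κ.IsInaccessible) (x : ZFSet.{u}) (hx : x.rank < κ.ord) :
    ∃ f : ZFSet.{u}, f.rank < κ.ord ∧ ∀ a ∈ x, ∃ b : ZFSet.{u}, b.IsOrdinal ∧
      (∃ z ∈ f, a ∈ z ∧ b ∈ z) ∧ ∀ a' ∈ x, ∀ z ∈ f, a' ∈ z → b ∈ z → a' = a := by
  obtain ⟨r, hwo, hr⟩ := Cardinal.exists_ord_eq (Shrink.{u} x)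
  have hlim := isSuccLimit_ord_of_isInaccessible hκ
  let g : x → Ordinal.{u} := fun a => x.rank + typein r (equivShrink x a)
  have hg : Function.Injective g := by
    intro a b hab
    exact (equivShrink x).injective (typein_injective r (add_left_cancel hab))
  have hgx : ∀ a a' : x, (g a).toZFSet ≠ a'.1 := by
    intro a a' h
    have h1 := ZFSet.rank_lt_of_mem a'.2
    rw [← h, rank_toZFSet] at h1
    exact absurd h1 (not_lt.2 le_self_add)
  have hgκ : ∀ a : x, g a < x.rank + x.card.ord := by
    intro a
    have := typein_lt_type r (equivShrink x a)
    rw [← hr] at this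
    exact (add_lt_add_iff_left _).2 this
  have hsum : x.rank + x.card.ord < κ.ord := by
    apply (isPrincipal_add_ord hκ.isRegular.aleph0_le) hx
    exact ord_lt_ord.2 (ZFSet.card_lt_of_rank_lt hκ hx)
  refine ⟨ZFSet.range fun a : x => ({a.1, (g a).toZFSet} : ZFSet), ?_, ?_⟩
  · refine lt_of_le_of_lt (b := x.rank + x.card.ord + 1 + 1) (ZFSet.rank_le_iff.2 ?_) ?_
    · intro y hy
      obtain ⟨a, rfl⟩ := ZFSet.mem_range.1 hy
      have h1 : a.1.rank < x.rank + x.card.ord := (ZFSet.rank_lt_of_mem a.2).trans_le le_self_add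
      rw [ZFSet.rank_pair, rank_toZFSet]
      refine max_lt ?_ ?_
      · rw [← Order.succ_eq_add_one (x.rank + x.card.ord + 1)]
        exact Order.succ_lt_succ (h1.trans_le le_self_add)
      · rw [← Order.succ_eq_add_one (x.rank + x.card.ord + 1)]
        exact Order.succ_lt_succ ((hgκ a).trans_le le_self_add)
    · exact hlim.add_one_lt (hlim.add_one_lt hsum)
  · intro a ha
    refine ⟨(g ⟨a, ha⟩).toZFSet, ZFSet.isOrdinal_toZFSet _, ⟨_, ZFSet.mem_range.2 ⟨⟨a, ha⟩, rfl⟩,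
      by simp, by simp⟩, ?_⟩
    intro a' ha' z hz haz hbz
    obtain ⟨c, rfl⟩ := ZFSet.mem_range.1 hz
    rw [ZFSet.mem_pair] at haz hbz
    have h1 : a' = c.1 := haz.resolve_right fun h => hgx c ⟨a', ha'⟩ h.symm
    have h2 : (g ⟨a, ha⟩).toZFSet = (g c).toZFSet := hbz.resolve_left (hgx _ _)
    have h3 := hg (toZFSet_injective h2)
    rw [h1, ← h3]

variable {R : L.Relations 2} (hR : ∀ v : Fin 2 → VSet κ, S.RelMap R v ↔ (v 0).1 ∈ (v 1).1)
  (hκ : κ.IsInaccessible)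

include hR hκ

/-- Like `V_κ`, `V_δ` contains a nonempty set without `∈`-maximal element, and the rank of such a
set is at least `ω`. -/
theorem ElemInitial.omega0_lt (h : ElemInitial S δ) : ω < δ := by
  have hω : ω < κ.ord := by
    rw [← ord_aleph0]; exact ord_lt_ord.2 hκ.1
  have hlim := isSuccLimit_ord_of_isInaccessible hκ
  obtain ⟨y, hy, hy'⟩ := h.exists_witness_one (infFormula R) Fin.elim0 (fun i => i.elim0)
    ⟨(ω : Ordinal.{u}).toZFSet, by rwa [rank_toZFSet]⟩ <| by
      rw [realize_infFormula hR]
      refine ⟨⟨⟨(0 : Ordinal.{u}).toZFSet, by rw [rank_toZFSet]; exact hω.pos⟩,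
        toZFSet_mem_toZFSet_iff.2 omega0_pos⟩, ?_⟩
      rintro ⟨z, hz⟩ hzω
      obtain ⟨o, ho, rfl⟩ := mem_toZFSet_iff.1 hzω
      have h1 := isSuccLimit_omega0.add_one_lt ho
      exact ⟨⟨(o + 1).toZFSet, by rw [rank_toZFSet]; exact h1.trans hω⟩,
        toZFSet_mem_toZFSet_iff.2 h1, toZFSet_mem_toZFSet_iff.2 (Order.lt_add_one_iff.2 le_rfl)⟩
  rw [realize_infFormula hR] at hy'
  refine lt_of_le_of_lt ?_ hy
  have key : ∀ n : ℕ, ∃ z : VSet κ, z.1 ∈ y.1 ∧ (n : Ordinal) ≤ z.1.rank := by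
    intro n
    induction n with
    | zero => obtain ⟨z, hz⟩ := hy'.1; exact ⟨z, hz, by simp⟩
    | succ n ih =>
      obtain ⟨z, hz, hn⟩ := ih
      obtain ⟨w, hw, hzw⟩ := hy'.2 z hz
      refine ⟨w, hw, ?_⟩
      push_cast
      exact Order.add_one_le_of_lt (hn.trans_lt (ZFSet.rank_lt_of_mem hzw))
  rw [omega0_le]
  intro n
  obtain ⟨z, hz, hn⟩ := key n
  exact hn.trans (ZFSet.rank_lt_of_mem hz).le

theorem ElemInitial.add_one_lt (h : ElemInitial S δ) (hδ : δ ≤ κ.ord) {o : Ordinal.{u}}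
    (ho : o < δ) : o + 1 < δ := by
  have hlim := isSuccLimit_ord_of_isInaccessible hκ
  obtain ⟨y, hy, hy'⟩ := h.exists_witness_one (memFormula R)
    (fun _ => ⟨o.toZFSet, by rw [rank_toZFSet]; exact ho.trans_le hδ⟩)
    (fun i => by rwa [rank_toZFSet])
    ⟨(o + 1).toZFSet, by rw [rank_toZFSet]; exact hlim.add_one_lt (ho.trans_le hδ)⟩ <| by
      rw [realize_memFormula hR]
      exact toZFSet_mem_toZFSet_iff.2 (Order.lt_add_one_iff.2 le_rfl)
  rw [realize_memFormula hR] at hy'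
  have := ZFSet.rank_lt_of_mem hy'
  rw [rank_toZFSet] at this
  exact (Order.add_one_le_of_lt this).trans_lt hy

/-- The injection of `x` into the ordinals found in `V_δ` embeds `x` into the height of the set
which codes it. -/
theorem ElemInitial.card_ord_lt (h : ElemInitial S δ) (hδ : δ ≤ κ.ord) {x : ZFSet.{u}}
    (hx : x.rank < δ) : x.card.ord < δ := by
  have hxκ := hx.trans_le hδ
  obtain ⟨f, hf, hfx⟩ := exists_injection_code hκ x hxκ
  obtain ⟨y, hy, hy'⟩ := h.exists_witness_one (injFormula R) (fun _ => ⟨x, hxκ⟩) (fun i => hx)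
    ⟨f, hf⟩ <| by
      rw [realize_injFormula hR]
      rintro ⟨a, ha⟩ hax
      obtain ⟨b, hb, ⟨z, hz, haz, hbz⟩, h3⟩ := hfx a hax
      have hzκ := (ZFSet.rank_lt_of_mem hz).trans hf
      refine ⟨⟨b, (ZFSet.rank_lt_of_mem hbz).trans hzκ⟩, ⟨?_, ?_⟩, ?_, ?_⟩
      · intro y hy z hz
        exact hb.mem_trans hz hy
      · intro y hy z hz w hw
        exact (hb.mem hy).mem_trans hw hz
      · exact ⟨⟨z, hzκ⟩, hz, haz, hbz⟩
      · intro a' z' h4 h5 h6 h7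
        exact Subtype.ext (h3 _ h4 _ h5 h6 h7)
  rw [realize_injFormula hR] at hy'
  have hsub : ∀ {s t : ZFSet.{u}}, t.rank < κ.ord → s ∈ t → s.rank < κ.ord :=
    fun ht hst => (ZFSet.rank_lt_of_mem hst).trans ht
  choose! F hF using hy'
  have hcard : x.card ≤ y.1.rank.card := by
    have h1 : Function.Injective (fun a : x =>
        (⟨(F ⟨a.1, hsub hxκ a.2⟩).1.rank, by
          obtain ⟨-, ⟨z, hz, -, hbz⟩, -⟩ := hF ⟨a.1, hsub hxκ a.2⟩ a.2
          exact (ZFSet.rank_lt_of_mem hbz).trans (ZFSet.rank_lt_of_mem hz)⟩ :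
            Set.Iio y.1.rank)) := by
      intro a a' haa
      have haa : (F ⟨a.1, hsub hxκ a.2⟩).1.rank = (F ⟨a'.1, hsub hxκ a'.2⟩).1.rank :=
        congrArg Subtype.val haa
      have hord : ∀ a : VSet κ, a.1 ∈ x → (F a).1.IsOrdinal := by
        intro a ha
        obtain ⟨⟨h1, h2⟩, -, -⟩ := hF a ha
        rw [ZFSet.isOrdinal_iff_forall_mem_isTransitive]
        have hFκ := (F a).2
        refine ⟨fun s hs t ht => ?_, fun s hs t ht r hr => ?_⟩
        · exact h1 ⟨s, hsub hFκ hs⟩ hs ⟨t, hsub (hsub hFκ hs) ht⟩ ht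
        · exact h2 ⟨s, hsub hFκ hs⟩ hs ⟨t, hsub (hsub hFκ hs) ht⟩ ht
            ⟨r, hsub (hsub (hsub hFκ hs) ht) hr⟩ hr
      have h2 := ((hord _ a.2).rank_inj (hord _ a'.2)).1 haa
      obtain ⟨-, -, h3⟩ := hF ⟨a.1, hsub hxκ a.2⟩ a.2
      obtain ⟨-, ⟨z, hz, haz, hbz⟩, -⟩ := hF ⟨a'.1, hsub hxκ a'.2⟩ a'.2
      have := h3 ⟨a'.1, hsub hxκ a'.2⟩ z a'.2 hz haz (h2 ▸ hbz)
      exact Subtype.ext (congrArg Subtype.val this).symm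
    have h2 := Cardinal.mk_le_of_injective h1
    rw [ZFSet.cardinalMk_coe_sort, Cardinal.mk_Iio_ordinal] at h2
    exact Cardinal.lift_le.1 h2
  exact (ord_le_ord.2 hcard).trans_lt ((ord_card_le _).trans_lt hy)

/-- The ordinals `δ` with `V_δ ≺ V_κ` are closed under the function `ℶ`. -/
theorem ElemInitial.bth_lt (h : ElemInitial S δ) (hδ : δ ≤ κ.ord) {o : Ordinal.{u}}
    (ho : o < δ) : bth o < δ := by
  have hω := h.omega0_lt hR hκ
  have hmax : max ω o + 1 < δ := h.add_one_lt hR hκ hδ (max_lt hω ho)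
  have h1 : (ZFSet.vonNeumann (max ω o + 1)).card.ord < δ :=
    h.card_ord_lt hR hκ hδ (by rwa [ZFSet.rank_vonNeumann])
  have h2 : ω + o < δ := by
    refine lt_trans ?_ h1
    rw [lt_ord, ZFSet.vonNeumann_add_one, ZFSet.card_powerset, Ordinal.card_add]
    have h3 : Cardinal.aleph0 ≤ (max ω o).card := by
      rw [← card_omega0]; exact card_le_card (le_max_left _ _)
    refine lt_of_le_of_lt (Cardinal.add_le_of_le h3 (card_le_card (le_max_left _ _))
      (card_le_card (le_max_right _ _))) ?_
    exact (Ordinal.card_le_card_vonNeumann _).trans_lt (Cardinal.cantor _)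
  have h4 := h.card_ord_lt hR hκ hδ (x := ZFSet.vonNeumann (ω + o)) (by rwa [ZFSet.rank_vonNeumann])
  rwa [ZFSet.card_vonNeumann, ← beth_eq_preBeth] at h4

end Elementarity

/-! ### The cardinals `ℶ_α` as ordinals, restrictions of functions -/

theorem bth_strictMono : StrictMono bth.{u} := fun _ _ h => ord_lt_ord.2 (beth_strictMono h)

theorem bth_lt_bth {α β : Ordinal.{u}} : bth α < bth β ↔ α < β := bth_strictMono.lt_iff_lt

theorem bth_le_bth {α β : Ordinal.{u}} : bth α ≤ bth β ↔ α ≤ β := bth_strictMono.le_iff_le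

theorem le_bth (α : Ordinal.{u}) : α ≤ bth α := bth_strictMono.le_apply

theorem omega0_le_bth (α : Ordinal.{u}) : ω ≤ bth α := by
  rw [← ord_aleph0]; exact ord_le_ord.2 (aleph0_le_beth α)

theorem bth_pos (α : Ordinal.{u}) : 0 < bth α := omega0_pos.trans_le (omega0_le_bth α)

theorem bth_add_lt {α a b : Ordinal.{u}} (ha : a < bth α) (hb : b < bth α) : a + b < bth α :=
  isPrincipal_add_ord (aleph0_le_beth α) ha hb

theorem bth_mul_lt {α a b : Ordinal.{u}} (ha : a < bth α) (hb : b < bth α) : a * b < bth α :=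
  isPrincipal_mul_ord (aleph0_le_beth α) ha hb

theorem bth_add_one_lt {α a : Ordinal.{u}} (ha : a < bth α) : a + 1 < bth α :=
  bth_add_lt ha (one_lt_omega0.trans_le (omega0_le_bth α))

theorem pSup_le {X : Set Ordinal.{u}} {b : Ordinal.{u}} (hb : ∀ x ∈ X, x < b) : pSup X ≤ b := by
  refine csSup_le' ?_
  rintro _ ⟨x, hx, rfl⟩
  exact Order.add_one_le_of_lt (hb x hx)

theorem pSup_empty : pSup (∅ : Set Ordinal.{u}) = 0 := by simp [pSup]

theorem cutFun_of_lt {η : Ordinal.{u} → Bool} {δ ξ : Ordinal.{u}} (h : ξ < δ) :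
    cutFun η δ ξ = η ξ := by simp [cutFun, h]

theorem cutFun_of_le {η : Ordinal.{u} → Bool} {δ ξ : Ordinal.{u}} (h : δ ≤ ξ) :
    cutFun η δ ξ = false := by simp [cutFun, h.not_gt]

theorem cutFun_cutFun (η : Ordinal.{u} → Bool) {δ ε : Ordinal.{u}} (h : ε ≤ δ) :
    cutFun (cutFun η δ) ε = cutFun η ε := by
  funext ξ
  rcases lt_or_ge ξ ε with h1 | h1
  · rw [cutFun_of_lt h1, cutFun_of_lt h1, cutFun_of_lt (h1.trans_le h)]
  · rw [cutFun_of_le h1, cutFun_of_le h1]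

theorem agreeBelow_cutFun (η : Ordinal.{u} → Bool) (δ : Ordinal.{u}) :
    AgreeBelow (cutFun η δ) η δ := fun _ h => cutFun_of_lt h

namespace AgreeBelow

variable {η ν τ : Ordinal.{u} → Bool} {δ ε : Ordinal.{u}}

theorem refl (η : Ordinal.{u} → Bool) (δ : Ordinal.{u}) : AgreeBelow η η δ := fun _ _ => rfl

theorem symm (h : AgreeBelow η ν δ) : AgreeBelow ν η δ := fun ξ hξ => (h ξ hξ).symm

theorem trans (h : AgreeBelow η ν δ) (h' : AgreeBelow ν τ δ) : AgreeBelow η τ δ :=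
  fun ξ hξ => (h ξ hξ).trans (h' ξ hξ)

theorem mono (h : AgreeBelow η ν δ) (hε : ε ≤ δ) : AgreeBelow η ν ε :=
  fun ξ hξ => h ξ (hξ.trans_le hε)

end AgreeBelow

theorem BlockConst.cutFun {α β : Ordinal.{u}} {η : Ordinal.{u} → Bool} (h : BlockConst α η)
    (hβ : β ≤ α) : BlockConst β (cutFun η (bth β)) := by
  refine ⟨fun ξ hξ => ?_, fun γ hγ ξ h1 h2 => ?_⟩
  · rw [cutFun_of_lt (hξ.trans_le (bth_le_bth.2 bot_le)), h.1 ξ hξ]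
  · have h3 : bth (γ + 1) ≤ bth β := bth_le_bth.2 (Order.add_one_le_of_lt hγ)
    rw [cutFun_of_lt (h2.trans_le h3), cutFun_of_lt (bth_lt_bth.2 hγ),
      h.2 γ (hγ.trans_le hβ) ξ h1 h2]

/-- The least ordinal at which two functions differ. -/
theorem exists_least_ne {η ν : Ordinal.{u} → Bool} {δ : Ordinal.{u}}
    (h : ¬ AgreeBelow η ν δ) : ∃ ξ < δ, AgreeBelow η ν ξ ∧ η ξ ≠ ν ξ := by
  simp only [AgreeBelow, not_forall] at h
  obtain ⟨ξ, hξ, hne⟩ := h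
  obtain ⟨ζ, hζ, hmin⟩ := WellFounded.has_min (wellFounded_lt (α := Ordinal.{u}))
    {ξ | η ξ ≠ ν ξ} ⟨ξ, hne⟩
  refine ⟨ζ, (not_lt.1 (hmin ξ hne)).trans_lt hξ, fun x hx => ?_, hζ⟩
  by_contra hcon
  exact hmin x hcon hx

/-! ### The tree order -/

namespace TNode

variable {u v w : TNode.{u}} {β γ : Ordinal.{u}}

@[simp] theorem inv_inv (u : TNode.{u}) : u.inv.inv = u := rfl

@[simp] theorem inv_root : root.inv = root.{u} := rfl

@[simp] theorem inv_ord (u : TNode.{u}) : u.inv.ord = u.ord := rfl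

theorem inv_eq_root : u.inv = root ↔ u = root :=
  ⟨fun h => by rw [← inv_inv u, h, inv_root], fun h => by rw [h, inv_root]⟩

@[simp] theorem cut_zero (u : TNode.{u}) : u.cut 0 = root := by simp [cut]

theorem cut_of_ne (u : TNode.{u}) (h : β ≠ 0) : u.cut β =
    ⟨β, cutFun u.fst (bth β), cutFun u.snd (bth β), cutFun u.trd (bth β), u.cub ∩ Set.Iio β⟩ := by
  simp [cut, h]

@[simp] theorem cut_ord (u : TNode.{u}) (β : Ordinal.{u}) : (u.cut β).ord = β := by
  by_cases h : β = 0
  · subst h; simp [root]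
  · rw [cut_of_ne _ h]

theorem cut_cub (u : TNode.{u}) (β : Ordinal.{u}) : (u.cut β).cub = u.cub ∩ Set.Iio β := by
  by_cases h : β = 0
  · subst h
    rw [cut_zero]
    ext x
    simp [root]
  · rw [cut_of_ne _ h]

theorem cut_fst (u : TNode.{u}) (h : β ≠ 0) : (u.cut β).fst = cutFun u.fst (bth β) := by
  rw [cut_of_ne _ h]

theorem cut_snd (u : TNode.{u}) (h : β ≠ 0) : (u.cut β).snd = cutFun u.snd (bth β) := by
  rw [cut_of_ne _ h]

theorem inv_cut (u : TNode.{u}) (β : Ordinal.{u}) : (u.cut β).inv = u.inv.cut β := by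
  by_cases h : β = 0
  · subst h; simp
  · rw [cut_of_ne _ h, cut_of_ne _ h]; rfl

theorem cut_cut (u : TNode.{u}) (h : γ ≤ β) : (u.cut β).cut γ = u.cut γ := by
  by_cases hγ : γ = 0
  · subst hγ; simp
  · have hβ : β ≠ 0 := fun h' => hγ (by rw [h'] at h; exact le_bot_iff.1 h)
    rw [cut_of_ne _ hγ, cut_of_ne _ hγ, cut_of_ne _ hβ]
    have hb := bth_le_bth.2 h
    simp only [cutFun_cutFun _ hb, Set.inter_assoc]
    congr 2
    exact Set.inter_eq_right.2 fun x hx => lt_of_lt_of_le hx h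

theorem Below.inv (h : v.Below u) : v.inv.Below u.inv :=
  ⟨by rw [inv_ord, ← inv_cut, ← h.1], h.2⟩

theorem below_cut (hβ : β ∈ u.cub) : (u.cut β).Below u := ⟨by rw [cut_ord], by rwa [cut_ord]⟩

theorem Below.trans (h : v.Below w) (h' : w.Below u) : v.Below u := by
  have h1 : v.ord ∈ u.cub ∩ Set.Iio w.ord := by
    have := h.2
    rwa [h'.1, cut_cub] at this
  refine ⟨?_, h1.1⟩
  have := h.1
  rwa [h'.1, cut_cut _ h1.2.le] at this

theorem Below.of_lt (h : v.Below u) (h' : w.Below u) (hlt : v.ord < w.ord) : v.Below w := by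
  refine ⟨?_, ?_⟩
  · rw [h'.1, cut_cut _ hlt.le]; exact h.1
  · rw [h'.1, cut_cub]; exact ⟨h.2, hlt⟩

theorem Below.eq_of_eq (h : v.Below u) (h' : w.Below u) (heq : v.ord = w.ord) : v = w := by
  rw [h.1, h'.1, heq]

theorem level_inv {α : Ordinal.{u}} (h : u ∈ Level α) : u.inv ∈ Level α := by
  obtain ⟨h1, h2, h3⟩ := h
  refine ⟨h1, fun h => by rw [h2 h, inv_root], fun h => ?_⟩
  obtain ⟨a, b, c, d, e, f⟩ := h3 h
  exact ⟨b, a, c, d.symm, e, f⟩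

theorem level_cub_subset (h : u ∈ Level u.ord) : u.cub ⊆ Set.Iio u.ord := by
  by_cases h0 : u.ord = 0
  · rw [h.2.1 h0]; exact Set.empty_subset _
  · exact (h.2.2 h0).2.2.2.2.1

theorem root_mem_level : root ∈ Level 0 := ⟨rfl, fun _ => rfl, fun h => (h rfl).elim⟩

theorem LexLt.ne {u : TNode.{u}} (h : u.LexLt) : u.fst ≠ u.snd := by
  obtain ⟨ξ, -, -, h1, h2⟩ := h
  intro h'
  rw [h', h2] at h1
  exact Bool.noConfusion h1

theorem LexLt.inv_not {u : TNode.{u}} (h : u.LexLt) : ¬ u.inv.LexLt := by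
  obtain ⟨ξ, hξ, h1, h2, h3⟩ := h
  rintro ⟨ζ, hζ, h4, h5, h6⟩
  simp only [inv] at h4 h5 h6
  rcases lt_trichotomy ξ ζ with h | h | h
  · have := h4 ξ h; rw [h2, h3] at this; exact Bool.noConfusion this
  · subst h; rw [h2] at h6; exact Bool.noConfusion h6
  · have := h1 ζ h; rw [h5, h6] at this; exact Bool.noConfusion this

theorem level_not_agree (h : u ∈ Level u.ord) (h0 : u ≠ root) :
    ¬ AgreeBelow u.fst u.snd (bth u.ord) := by
  intro hag
  have hu0 : u.ord ≠ 0 := fun h' => h0 (h.2.1 h')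
  obtain ⟨a, b, c, d, e, f⟩ := h.2.2 hu0
  apply d
  funext ξ
  rcases lt_or_ge ξ (bth u.ord) with h1 | h1
  · exact hag ξ h1
  · rw [← a, ← b, cutFun_of_le h1, cutFun_of_le h1]

theorem level_lexLt_or (h : u ∈ Level u.ord) (h0 : u ≠ root) : u.LexLt ∨ u.inv.LexLt := by
  obtain ⟨ξ, hξ, h1, h2⟩ := exists_least_ne (level_not_agree h h0)
  cases h3 : u.fst ξ <;> cases h4 : u.snd ξ
  · rw [h3, h4] at h2; exact (h2 rfl).elim
  · exact Or.inl ⟨ξ, hξ, h1, h3, h4⟩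
  · exact Or.inr ⟨ξ, hξ, h1.symm, h4, h3⟩
  · rw [h3, h4] at h2; exact (h2 rfl).elim

theorem not_lexLt_root : ¬ root.{u}.LexLt := fun h => h.ne rfl

/-- The first difference between the components of a restriction of `u` is the one of `u`. -/
theorem LexLt.cut (h : u.LexLt) (h0 : β ≠ 0)
    (hag : ¬ AgreeBelow (u.cut β).fst (u.cut β).snd (bth β)) : (u.cut β).LexLt := by
  obtain ⟨ξ, hξ, h1, h2⟩ := exists_least_ne hag
  rw [cut_fst _ h0, cut_snd _ h0] at h1 h2
  rw [cutFun_of_lt hξ, cutFun_of_lt hξ] at h2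
  have h1' : AgreeBelow u.fst u.snd ξ := fun x hx => by
    have := h1 x hx
    rwa [cutFun_of_lt (hx.trans hξ), cutFun_of_lt (hx.trans hξ)] at this
  obtain ⟨ζ, hζ, h3, h4, h5⟩ := h
  have : ξ = ζ := by
    rcases lt_trichotomy ξ ζ with h | h | h
    · exact (h2 (h3 ξ h)).elim
    · exact h
    · have := h1' ζ h
      rw [h4, h5] at this
      exact Bool.noConfusion this
  subst this
  refine ⟨ξ, by rwa [cut_ord], ?_, ?_, ?_⟩
  · rw [cut_fst _ h0, cut_snd _ h0]; exact h1
  · rw [cut_fst _ h0, cutFun_of_lt hξ, h4]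
  · rw [cut_snd _ h0, cutFun_of_lt hξ, h5]

end TNode

/-! ### The tree `U` -/

namespace Construction

variable {K : Construction.{u}} {u v w : TNode.{u}}

theorem mem_T_iff : u ∈ K.T ↔ u.ord < K.κ.ord ∧ u ∈ TNode.Level u.ord := by
  simp only [T, Set.mem_iUnion, Set.mem_Iio, exists_prop]
  constructor
  · rintro ⟨α, hα, hu⟩
    have := hu.1
    subst this
    exact ⟨hα, hu⟩
  · rintro ⟨h1, h2⟩
    exact ⟨_, h1, h2⟩

theorem mem_T_inv (h : u ∈ K.T) : u.inv ∈ K.T := by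
  rw [mem_T_iff] at h ⊢
  exact ⟨h.1, TNode.level_inv h.2⟩

theorem ord_ne_zero (h : u ∈ K.T) (h0 : u ≠ TNode.root) : u.ord ≠ 0 :=
  fun h' => h0 ((mem_T_iff.1 h).2.2.1 h')

theorem Admissible.ord_pos (hK : K.Admissible) : 0 < K.κ.ord :=
  (isSuccLimit_ord_of_isInaccessible hK.inaccessible).bot_lt

theorem Admissible.root_mem_T (hK : K.Admissible) : TNode.root ∈ K.T :=
  mem_T_iff.2 ⟨hK.ord_pos, TNode.root_mem_level⟩

theorem Below.ord_lt (hu : u ∈ K.T) (h : v.Below u) : v.ord < u.ord :=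
  TNode.level_cub_subset (mem_T_iff.1 hu).2 h.2

theorem mem_TLt_ne_root (h : u ∈ K.TLt) : u ≠ TNode.root := fun h' =>
  TNode.not_lexLt_root (h' ▸ h.2)

theorem TG.mem_T (hK : K.Admissible) (h : K.TG u) : u ∈ K.T := by
  induction h with
  | root => exact hK.root_mem_T
  | inv u _ ih => exact mem_T_inv ih
  | succ u _ h => exact h.1
  | limit u h => exact h.1

/-- The symmetry of `φ` makes `T^H` closed under inversion. -/
theorem cubOf_swap_le (hK : K.Admissible) (s t r : Ordinal.{u} → Bool) :
    K.cubOf s t r ⊆ K.cubOf t s r := by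
  rintro δ (h | ⟨h1, h2, h3⟩)
  · exact Or.inl h
  · exact Or.inr ⟨h1, h2.swap, (hK.symmetric _ _ _).1 h3⟩

theorem cubOf_swap (hK : K.Admissible) (s t r : Ordinal.{u} → Bool) :
    K.cubOf s t r = K.cubOf t s r :=
  (cubOf_swap_le hK s t r).antisymm (cubOf_swap_le hK t s r)

theorem TH.inv (hK : K.Admissible) (h : u ∈ K.TH) : u.inv ∈ K.TH := by
  obtain ⟨h1, s, t, r, h2, h3, h4, h5, h6⟩ := h
  refine ⟨mem_T_inv h1, t, s, r, h3, h2, h4, ?_, ?_⟩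
  · rw [← cubOf_swap hK]; exact h5
  · rw [← cubOf_swap hK]; exact h6

theorem TH.zero_mem_cub (h : u ∈ K.TH) (h0 : u ≠ TNode.root) : (0 : Ordinal.{u}) ∈ u.cub := by
  have hu := ord_ne_zero h.1 h0
  obtain ⟨h1, s, t, r, h2, h3, h4, h5, h6⟩ := h
  rw [h6]
  exact ⟨Or.inl rfl, pos_iff_ne_zero.2 hu⟩

theorem TH.exists_elemInitial (h : u ∈ K.TH) (h0 : u ≠ TNode.root) :
    ∃ s t r, ElemInitial (sigmaStructure K.κ K.P s t r) u.ord := by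
  have hu := ord_ne_zero h.1 h0
  obtain ⟨h1, s, t, r, h2, h3, h4, h5, h6⟩ := h
  rcases h5 with h5 | h5
  · exact (hu h5).elim
  · exact ⟨s, t, r, h5.2.1⟩

theorem gInds_ne_zero {α : Ordinal.{u}} (h : α ∈ gInds) : α ≠ 0 := by
  obtain ⟨γ, rfl⟩ := h
  exact (pos_iff_ne_zero.1 (Order.lt_add_one_iff.2 bot_le))

theorem TG.zero_mem_cub (h : K.TG u) (h0 : u ≠ TNode.root) : (0 : Ordinal.{u}) ∈ u.cub := by
  have aux : ∀ (u : TNode.{u}) (γ : Ordinal.{u}), γ ≠ 0 →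
      (u.cut γ ∉ K.TH → u.cut γ ≠ TNode.root → (0 : Ordinal.{u}) ∈ (u.cut γ).cub) →
      (0 : Ordinal.{u}) ∈ u.cub := by
    intro u γ hγ h
    have hne : u.cut γ ≠ TNode.root := fun h' => hγ (by
      have := congrArg TNode.ord h'
      rwa [TNode.cut_ord] at this)
    have : (0 : Ordinal.{u}) ∈ (u.cut γ).cub := by
      by_cases hH : u.cut γ ∈ K.TH
      · exact TH.zero_mem_cub hH hne
      · exact h hH hne
    rw [TNode.cut_cub] at this
    exact this.1
  induction h with
  | root => exact (h0 rfl).elim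
  | inv u _ ih => exact ih fun h => h0 (by rw [h, TNode.inv_root])
  | succ u γ h1 h2 h3 h4 h5 _ ih =>
    by_cases hγ : γ = 0
    · rw [← hγ]; exact h4.1
    · exact aux u γ hγ ih
  | limit u h1 h2 h3 h4 _ ih =>
    obtain ⟨γ, hγ1, hγ2⟩ := h3
    exact aux u γ (gInds_ne_zero hγ2) (ih γ hγ1)

/-- The shape of the nodes of `T^G`. -/
theorem TG.cases_ord (hK : K.Admissible) (h : K.TG u) :
    u = TNode.root ∨ u.ord ∈ gInds ∨
      (sSup u.cub = u.ord ∧ ∀ β ∈ u.cub, u.cut β ∈ K.TH ∨ K.TG (u.cut β)) := by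
  induction h with
  | root => exact Or.inl rfl
  | inv u _ ih =>
    rcases ih with h | h | ⟨h, h'⟩
    · exact Or.inl (TNode.inv_eq_root.2 h)
    · exact Or.inr (Or.inl h)
    · refine Or.inr (Or.inr ⟨h, fun β hβ => ?_⟩)
      rw [← TNode.inv_cut]
      exact (h' β hβ).imp (TH.inv hK) (TG.inv _)
  | succ u γ h1 h2 h3 => exact Or.inr (Or.inl h3)
  | limit u h1 h2 h3 h4 h5 _ =>
    refine Or.inr (Or.inr ⟨h2, fun β hβ => ?_⟩)
    by_cases hH : u.cut β ∈ K.TH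
    · exact Or.inl hH
    · exact Or.inr (h5 β hβ hH)

theorem mem_T_of_mem_U (hK : K.Admissible) (h : u ∈ K.U) : u ∈ K.T :=
  h.1.elim (fun h => h.1) fun h => h.mem_T hK

theorem level_of_mem_U (hK : K.Admissible) (h : u ∈ K.U) : u ∈ TNode.Level u.ord :=
  (mem_T_iff.1 (mem_T_of_mem_U hK h)).2

theorem root_mem_U : TNode.root ∈ K.U := ⟨Or.inr TG.root, Or.inl rfl⟩

theorem mem_U_inv (hK : K.Admissible) (h : u ∈ K.U) : u.inv ∈ K.U := by
  refine ⟨h.1.imp (TH.inv hK) (TG.inv _), h.2.imp TNode.inv_eq_root.2 ?_⟩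
  rintro ⟨a, b, c⟩
  exact ⟨b, a, c⟩

theorem ord_ne_zero_of_mem_U (hK : K.Admissible) (h : u ∈ K.U) (h0 : u ≠ TNode.root) : u.ord ≠ 0 :=
  ord_ne_zero (mem_T_of_mem_U hK h) h0

theorem ord_lt_of_below (hK : K.Admissible) (h : u ∈ K.U) (hv : v.Below u) : v.ord < u.ord :=
  Below.ord_lt (mem_T_of_mem_U hK h) hv

theorem root_below (h : u ∈ K.U) (h0 : u ≠ TNode.root) :
    TNode.root.Below u :=
  ⟨(TNode.cut_zero u).symm, h.1.elim (fun h => TH.zero_mem_cub h h0) fun h => h.zero_mem_cub h0⟩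

theorem cut_mem_U (h : u ∈ K.U) (h0 : u ≠ TNode.root) {β : Ordinal.{u}}
    (hβ : β ≤ u.ord) (hu : u.cut β ∈ K.TH ∨ K.TG (u.cut β)) : u.cut β ∈ K.U := by
  refine ⟨hu, ?_⟩
  by_cases hβ0 : β = 0
  · left; rw [hβ0, TNode.cut_zero]
  · right
    obtain ⟨a, b, c⟩ := h.2.resolve_left h0
    rw [TNode.cut_of_ne _ hβ0]
    exact ⟨a.cutFun hβ, b.cutFun hβ, c.cutFun hβ⟩

/-- The nodes below an element of `T_<` are the root or belong to `T_<`. -/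
theorem mem_TLt_of_below (hK : K.Admissible) (hu : u ∈ K.TLt) (hv : v ∈ K.U) (h : v.Below u)
    (h0 : v ≠ TNode.root) : v ∈ K.TLt := by
  have hvT := mem_T_of_mem_U hK hv
  refine ⟨hvT, ?_⟩
  have hag := TNode.level_not_agree (level_of_mem_U hK hv) h0
  have hv0 := ord_ne_zero hvT h0
  rw [h.1]
  refine hu.2.cut hv0 ?_
  rw [← h.1]
  exact hag

theorem IsSuccOf.unique (h : K.IsSuccOf u v) (h' : K.IsSuccOf u w) : v = w := by
  rcases lt_trichotomy v.ord w.ord with hlt | heq | hlt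
  · exact (h.2.2 ⟨w, h'.1, h.2.1.of_lt h'.2.1 hlt, h'.2.1⟩).elim
  · exact h.2.1.eq_of_eq h'.2.1 heq
  · exact (h'.2.2 ⟨v, h.1, h'.2.1.of_lt h.2.1 hlt, h.2.1⟩).elim

/-- A node that has no immediate predecessor has further nodes above each node below it. -/
theorem exists_between (h : ¬ ∃ v, K.IsSuccOf u v) (hv : v ∈ K.U) (hvu : v.Below u) :
    ∃ w ∈ K.U, v.Below w ∧ w.Below u := by
  by_contra hcon
  exact h ⟨v, hv, hvu, hcon⟩

/-- A successor in `U` which is not in `T^H` is on a level of the form `γ + 2`. -/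
theorem IsSuccOf.ord_mem_gInds (hK : K.Admissible) (hu : u ∈ K.U) (h : K.IsSuccOf u v)
    (hH : u ∉ K.TH) : u.ord ∈ gInds := by
  have hvu := ord_lt_of_below hK hu h.2.1
  have h0 : u ≠ TNode.root := by
    rintro rfl
    exact absurd hvu not_lt_bot
  rcases (hu.1.resolve_left hH).cases_ord hK with h1 | h1 | ⟨h1, h2⟩
  · exact (h0 h1).elim
  · exact h1
  · exfalso
    rw [← h1] at hvu
    obtain ⟨β, hβ, hvβ⟩ := exists_lt_of_lt_csSup ⟨_, h.2.1.2⟩ hvu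
    have hβu : β < u.ord := TNode.level_cub_subset (level_of_mem_U hK hu) hβ
    refine h.2.2 ⟨u.cut β, cut_mem_U hu h0 hβu.le (h2 β hβ), ?_, TNode.below_cut hβ⟩
    exact h.2.1.of_lt (TNode.below_cut hβ) (by rwa [TNode.cut_ord])

end Construction

/-! ### One step of the construction of the functions `p_u` -/

namespace OrdGraph

/-- `q` is the graph of an injective partial function. -/
structure IsInj (q : OrdGraph.{u}) : Prop where
  functional : ∀ x y y', (x, y) ∈ q → (x, y') ∈ q → y = y'
  injective : ∀ x x' y, (x, y) ∈ q → (x', y) ∈ q → x = x'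

/-- The domain and the range of `q` are bounded by `b`. -/
def BddBy (q : OrdGraph.{u}) (b : Ordinal.{u}) : Prop := ∀ x y, (x, y) ∈ q → x < b ∧ y < b

/-- `I` is the identity function on an ordinal. -/
structure IsIdSeg (I : OrdGraph.{u}) : Prop where
  eq : ∀ x y, (x, y) ∈ I → x = y
  down : ∀ x y, (x, x) ∈ I → y ≤ x → (y, y) ∈ I

variable {p q r I e : OrdGraph.{u}} {x y b c β γ : Ordinal.{u}}

@[simp] theorem mem_inv : (x, y) ∈ q.inv ↔ (y, x) ∈ q := Iff.rfl

@[simp] theorem inv_inv (q : OrdGraph.{u}) : q.inv.inv = q := rfl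

theorem mem_dom : x ∈ q.dom ↔ ∃ y, (x, y) ∈ q := by simp [dom]

theorem mem_ran : y ∈ q.ran ↔ ∃ x, (x, y) ∈ q := by simp [ran]

theorem dom_inv (q : OrdGraph.{u}) : q.inv.dom = q.ran := by
  ext x; rw [mem_dom, mem_ran]; rfl

theorem ran_inv (q : OrdGraph.{u}) : q.inv.ran = q.dom := by
  ext x; rw [mem_dom, mem_ran]; rfl

theorem dom_mono (h : p ⊆ q) : p.dom ⊆ q.dom := Set.image_mono h

theorem ran_mono (h : p ⊆ q) : p.ran ⊆ q.ran := Set.image_mono h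

theorem inv_subset_inv (h : p ⊆ q) : p.inv ⊆ q.inv := fun _ hx => h hx

theorem IsInj.inv (h : q.IsInj) : q.inv.IsInj :=
  ⟨fun x y y' h1 h2 => h.2 y y' x h1 h2, fun x x' y h1 h2 => h.1 y x x' h1 h2⟩

theorem BddBy.inv (h : q.BddBy b) : q.inv.BddBy b := fun x y hxy => (h y x hxy).symm

theorem BddBy.mono (h : q.BddBy b) (hb : b ≤ c) : q.BddBy c :=
  fun x y hxy => ⟨(h x y hxy).1.trans_le hb, (h x y hxy).2.trans_le hb⟩

theorem IsIdSeg.inv_eq (h : I.IsIdSeg) : I.inv = I := by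
  ext ⟨x, y⟩
  rw [mem_inv]
  constructor <;> intro h'
  · have := h.eq _ _ h'; subst this; exact h'
  · have := h.eq _ _ h'; subst this; exact h'

theorem isInj_empty : (∅ : OrdGraph.{u}).IsInj :=
  ⟨fun _ _ _ h => h.elim, fun _ _ _ h => h.elim⟩

theorem inv_empty : (∅ : OrdGraph.{u}).inv = ∅ := rfl

theorem mem_eGraph : (x, y) ∈ eGraph β γ ↔ x < bth β ∧ y = bth β * (γ + 1) + x := Iff.rfl

theorem eGraph_le (h : (x, y) ∈ eGraph β γ) : bth β ≤ y ∧ x ≤ y := by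
  rw [mem_eGraph] at h
  rw [h.2]
  refine ⟨le_trans ?_ le_self_add, le_add_self⟩
  exact le_mul_of_one_le_right bot_le (by simp)

theorem eGraph_lt (h : (x, y) ∈ eGraph β γ) (hγ : γ < bth (β + 1)) : y < bth (β + 1) := by
  rw [mem_eGraph] at h
  have hβ : bth β < bth (β + 1) := bth_lt_bth.2 (Order.lt_add_one_iff.2 le_rfl)
  rw [h.2]
  exact bth_add_lt (bth_mul_lt hβ (bth_add_one_lt hγ)) (h.1.trans hβ)

theorem mem_extendBy : (x, y) ∈ q.extendBy e ↔ (x, y) ∈ q ∨ ((x, y) ∈ e ∧ x ∉ q.dom) := Iff.rfl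

/-- The extension of an identity segment `I` by `q` and then by `e`, if `q` extends `I` or is empty,
is the extension of `I ∪ q` by `e`. -/
theorem extendBy_extendBy (hq : q.IsInj) (hIq : I ⊆ q ∨ q = ∅) :
    I.extendBy (q.extendBy e) = (I ∪ q).extendBy e := by
  rcases hIq with h | rfl
  · rw [Set.union_eq_self_of_subset_left h]
    ext ⟨x, y⟩
    rw [mem_extendBy, mem_extendBy]
    constructor
    · rintro (h1 | ⟨h1, -⟩)
      · exact Or.inl (h h1)
      · exact h1
    · intro h1
      by_cases hx : x ∈ I.dom
      · rcases h1 with h1 | ⟨-, h1⟩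
        · obtain ⟨z, hz⟩ := mem_dom.1 hx
          have := hq.1 _ _ _ h1 (h hz)
          subst this
          exact Or.inl hz
        · exact (h1 (dom_mono h hx)).elim
      · exact Or.inr ⟨h1, hx⟩
  · rw [Set.union_empty]
    congr 1
    ext ⟨x, y⟩
    rw [mem_extendBy]
    simp [dom]

theorem dom_extendBy (q e : OrdGraph.{u}) : (q.extendBy e).dom = q.dom ∪ e.dom := by
  ext x
  simp only [mem_dom, Set.mem_union, mem_extendBy]
  constructor
  · rintro ⟨y, h | h⟩
    · exact Or.inl ⟨y, h⟩
    · exact Or.inr ⟨y, h.1⟩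
  · rintro (⟨y, h⟩ | ⟨y, h⟩)
    · exact ⟨y, Or.inl h⟩
    · by_cases hx : ∃ y, (x, y) ∈ q
      · obtain ⟨z, hz⟩ := hx
        exact ⟨z, Or.inl hz⟩
      · exact ⟨y, Or.inr ⟨h, hx⟩⟩

theorem dom_eGraph : (eGraph β γ).dom = Set.Iio (bth β) := by
  ext x
  simp only [mem_dom, mem_eGraph, exists_and_left, exists_eq, and_true]
  rfl

theorem isInj_extendBy (hI : I.IsIdSeg) (hq : q.IsInj) (hIq : I ⊆ q ∨ q = ∅)
    (hb : q.BddBy (bth β)) : ((I ∪ q).extendBy (eGraph β γ)).IsInj := by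
  have hU : (I ∪ q).IsInj := by
    rcases hIq with h | rfl
    · rwa [Set.union_eq_self_of_subset_left h]
    · rw [Set.union_empty]
      refine ⟨fun x y y' h1 h2 => ?_, fun x x' y h1 h2 => ?_⟩
      · rw [← hI.eq _ _ h1, hI.eq _ _ h2]
      · rw [hI.eq _ _ h1, ← hI.eq _ _ h2]
  -- The values of `e` differ from those of `q`, which are smaller than `ℶ_β`, and from those of
  -- `I`, since `e` maps no argument to a smaller value.
  have hdisj : ∀ x x' y, (x, y) ∈ I ∪ q → (x', y) ∈ eGraph β γ → x' ∉ (I ∪ q).dom → False := by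
    intro x x' y h1 h2 h3
    obtain ⟨h4, h5⟩ := eGraph_le h2
    rcases h1 with h1 | h1
    · have := hI.eq _ _ h1
      subst this
      exact h3 (mem_dom.2 ⟨x', Or.inl (hI.down _ _ h1 h5)⟩)
    · exact absurd (hb _ _ h1).2 h4.not_gt
  refine ⟨fun x y y' h1 h2 => ?_, fun x x' y h1 h2 => ?_⟩
  · rcases h1 with h1 | ⟨h1, h1'⟩ <;> rcases h2 with h2 | ⟨h2, h2'⟩
    · exact hU.1 _ _ _ h1 h2
    · exact (h2' (mem_dom.2 ⟨_, h1⟩)).elim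
    · exact (h1' (mem_dom.2 ⟨_, h2⟩)).elim
    · rw [(mem_eGraph.1 h1).2, (mem_eGraph.1 h2).2]
  · rcases h1 with h1 | ⟨h1, h1'⟩ <;> rcases h2 with h2 | ⟨h2, h2'⟩
    · exact hU.2 _ _ _ h1 h2
    · exact (hdisj _ _ _ h1 h2 h2').elim
    · exact (hdisj _ _ _ h2 h1 h1').elim
    · have h3 := (mem_eGraph.1 h1).2
      rw [(mem_eGraph.1 h2).2] at h3
      exact (add_left_cancel h3).symm

theorem bddBy_extendBy (hI : I.BddBy b) (hq : q.BddBy b) (hβ : bth (β + 1) ≤ b)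
    (hγ : γ < bth (β + 1)) : ((I ∪ q).extendBy (eGraph β γ)).BddBy b := by
  rintro x y ((h | h) | ⟨h, -⟩)
  · exact hI _ _ h
  · exact hq _ _ h
  · have hβ' : bth β < bth (β + 1) := bth_lt_bth.2 (Order.lt_add_one_iff.2 le_rfl)
    exact ⟨((mem_eGraph.1 h).1.trans hβ').trans_le hβ, (eGraph_lt h hγ).trans_le hβ⟩

theorem subset_extendBy (q e : OrdGraph.{u}) : q ⊆ q.extendBy e := Set.subset_union_left

/-- If an ordinal below `ℶ_β` belongs neither to the domain nor to the range of `q`, then the range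
of the extension of `q` by `e` has a gap. -/
theorem ran_extendBy_ne_Iio (hx : x < bth β) (h1 : x ∉ q.dom) (h2 : x ∉ q.ran) :
    ¬ ∃ o, (q.extendBy (eGraph β γ)).ran = Set.Iio o := by
  rintro ⟨o, ho⟩
  have h3 : (x, bth β * (γ + 1) + x) ∈ eGraph β γ := ⟨hx, rfl⟩
  have h4 : bth β * (γ + 1) + x ∈ (q.extendBy (eGraph β γ)).ran :=
    mem_ran.2 ⟨x, Or.inr ⟨h3, h1⟩⟩
  rw [ho] at h4
  have h5 : x ∈ (q.extendBy (eGraph β γ)).ran := by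
    rw [ho]; exact lt_of_le_of_lt (eGraph_le h3).2 h4
  obtain ⟨z, hz | hz⟩ := mem_ran.1 h5
  · exact h2 (mem_ran.2 ⟨z, hz⟩)
  · exact absurd hx (eGraph_le hz.1).1.not_gt

end OrdGraph

namespace TNode

variable {u v : TNode.{u}}

theorem isIdSeg_idGraph (u : TNode.{u}) : u.idGraph.IsIdSeg := by
  refine ⟨fun x y h => h.1, fun x y h hy => ⟨rfl, hy.trans_lt h.2.1, h.2.2.mono ?_⟩⟩
  exact add_le_add_left hy 1

theorem idGraph_inv (u : TNode.{u}) : u.inv.idGraph = u.idGraph := by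
  ext ⟨x, y⟩
  exact ⟨fun h => ⟨h.1, h.2.1, h.2.2.symm⟩, fun h => ⟨h.1, h.2.1, h.2.2.symm⟩⟩

theorem bddBy_idGraph (u : TNode.{u}) : u.idGraph.BddBy (bth u.ord) := by
  rintro x y ⟨h1, h2, -⟩
  exact ⟨h2, (show x = y from h1) ▸ h2⟩

/-- The identity part does not grow along the tree, since nodes other than the root are above the
first difference of the two branches. -/
theorem idGraph_subset_of_below (hv : v ∈ Level v.ord) (hv0 : v ≠ root) (h : v.Below u) :
    u.idGraph ⊆ v.idGraph := by
  rintro ⟨x, y⟩ ⟨h1, h2, h3⟩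
  have hord : v.ord ≠ 0 := fun h' => hv0 (hv.2.1 h')
  have hf : ∀ ξ < bth v.ord, v.fst ξ = u.fst ξ ∧ v.snd ξ = u.snd ξ := by
    intro ξ hξ
    rw [h.1, cut_fst _ hord, cut_snd _ hord, cutFun_of_lt hξ, cutFun_of_lt hξ]
    exact ⟨rfl, rfl⟩
  have hx : x < bth v.ord := by
    by_contra hcon
    refine level_not_agree hv hv0 fun ξ hξ => ?_
    rw [(hf ξ hξ).1, (hf ξ hξ).2]
    exact h3 ξ ((hξ.trans_le (not_lt.1 hcon)).trans (Order.lt_add_one_iff.2 le_rfl))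
  refine ⟨h1, hx, fun ξ hξ => ?_⟩
  have : ξ < bth v.ord := (Order.lt_add_one_iff.1 hξ).trans_lt hx
  rw [(hf ξ this).1, (hf ξ this).2]
  exact h3 ξ hξ

end TNode

/-! ### The ordinals `β'_w` -/

theorem exists_lt_bth {δ ξ : Ordinal.{u}} (hδ : Order.IsSuccLimit δ) (h : ξ < bth δ) :
    ∃ o < δ, ξ < bth o := by
  rw [bth, lt_ord, beth_limit hδ] at h
  obtain ⟨⟨o, ho⟩, h'⟩ := exists_lt_of_lt_ciSup' h
  exact ⟨o, ho, lt_ord.2 h'⟩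

namespace Construction

variable {K : Construction.{u}} {u v w : TNode.{u}}

/-- The candidates for `β'_w`. -/
def reflSet (K : Construction.{u}) (u w : TNode.{u}) : Set Ordinal.{u} :=
  {β | Order.IsSuccLimit β ∧ β ∉ u.idGraph.dom ∧ ¬ β < w.ord + 1 ∧
    ∀ w', K.Prec w' w → w' ∈ K.U → β ≠ K.reflH u w'}

theorem reflH_eq (u w : TNode.{u}) : K.reflH u w = sInf (K.reflSet u w) := by
  rw [reflH, WellFounded.fix_eq]
  rfl

/-- There are fewer than `ℶ_{α+2}` nodes of `U` before a node of level `α`. -/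
theorem mk_prec_lt (hK : K.Admissible) (hv : v.ord + 1 < K.κ.ord) :
    #{w : TNode.{u} | K.Prec w v ∧ w ∈ K.U} < Cardinal.lift.{u + 1} (ℶ_ (v.ord + 1 + 1)) := by
  let f : Set.Iio (v.ord + 1) × Set.Iio (bth (v.ord + 1)) → TNode.{u} := fun x => K.enum x.1 x.2
  have hsub : {w : TNode.{u} | K.Prec w v ∧ w ∈ K.U} ⊆ Set.range f := by
    rintro w ⟨h1, h2⟩
    have hle : w.ord ≤ v.ord := h1.elim le_of_lt fun h => h.1.le
    have hlt : w.ord < v.ord + 1 := Order.lt_add_one_iff.2 hle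
    obtain ⟨θ, hθ, hbij⟩ := hK.enum_bij w.ord (hlt.trans hv)
    obtain ⟨γ, hγ, hw⟩ := hbij.surjOn (level_of_mem_U hK h2)
    have hγ' : γ < bth (v.ord + 1) :=
      (show γ < θ from hγ).trans_le (hθ.trans (bth_le_bth.2 (add_le_add_left hle 1)))
    exact ⟨(⟨w.ord, hlt⟩, ⟨γ, hγ'⟩), hw⟩
  refine (Cardinal.mk_le_mk_of_subset hsub).trans_lt (Cardinal.mk_range_le.trans_lt ?_)
  rw [Cardinal.mk_prod, Cardinal.mk_Iio_ordinal, Cardinal.mk_Iio_ordinal, Cardinal.lift_lift,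
    Cardinal.lift_lift, ← Cardinal.lift_mul, bth, Cardinal.card_ord]
  refine Cardinal.lift_lt.2 ?_
  rw [beth_add_one (v.ord + 1)]
  refine lt_of_le_of_lt ?_ (Cardinal.cantor _)
  refine Cardinal.mul_le_of_le (aleph0_le_beth _) ?_ le_rfl
  exact card_le_beth _

/-- The ordinals `β'_v` are between the levels of `v` and `u`: the level of `u ∈ T^H` is closed
under `ℶ`, so that it leaves room for more limit ordinals than there are nodes before `v`. -/
theorem reflH_bounds (hK : K.Admissible) (hu : u ∈ K.TH) (h0 : u ≠ TNode.root)
    (hvu : v.ord < u.ord) : v.ord < K.reflH u v ∧ K.reflH u v < u.ord := by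
  obtain ⟨s, t, r, hE⟩ := TH.exists_elemInitial hu h0
  obtain ⟨hord, hlev⟩ := mem_T_iff.1 hu.1
  have hR : ∀ v : Fin 2 → VSet K.κ, (sigmaStructure K.κ K.P s t r).RelMap SigmaRel.mem v ↔
      (v 0).1 ∈ (v 1).1 := fun v => Iff.rfl
  have hb : ∀ {o}, o < u.ord → bth o < u.ord := fun h => hE.bth_lt hR hK.inaccessible hord.le h
  have h1 : ∀ {o}, o < u.ord → o + 1 < u.ord := fun h => hE.add_one_lt hR hK.inaccessible hord.le h
  have hω := hE.omega0_lt hR hK.inaccessible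
  have hlim : Order.IsSuccLimit u.ord := by
    refine ⟨fun h => ?_, ?_⟩
    · exact (not_lt_bot (h.eq_bot ▸ hω))
    · exact Order.isSuccPrelimit_of_succ_lt fun o ho => by
        rw [Order.succ_eq_add_one]; exact h1 ho
  obtain ⟨ξ₀, hξ₀, -, hne⟩ := exists_least_ne (TNode.level_not_agree hlev h0)
  obtain ⟨ρ, hρ, hξρ⟩ := exists_lt_bth hlim hξ₀
  have hid : ∀ β, ξ₀ ≤ β → β ∉ u.idGraph.dom := by
    intro β hβ hmem
    obtain ⟨y, -, -, h⟩ := OrdGraph.mem_dom.1 hmem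
    exact hne (h ξ₀ (Order.lt_add_one_iff.2 hβ))
  have hlt1 := h1 (h1 hvu)
  set m := max ξ₀ (v.ord + 1) with hm
  set f : Ordinal.{u} → Ordinal.{u} := fun ζ => m + ω * (ζ + 1) with hf
  have hfinj : Function.Injective f := by
    intro a b hab
    have h2 : ω * (a + 1) = ω * (b + 1) := add_left_cancel hab
    have h3 : a + 1 = b + 1 := by
      rcases lt_trichotomy (a + 1) (b + 1) with h | h | h
      · exact absurd h2 (mul_lt_mul_of_pos_left h omega0_pos).ne
      · exact h
      · exact absurd h2 (mul_lt_mul_of_pos_left h omega0_pos).ne'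
    rw [← Order.succ_eq_add_one, ← Order.succ_eq_add_one] at h3
    exact Order.succ_injective h3
  have hex : ∃ ζ < bth (v.ord + 1 + 1), f ζ ∈ K.reflSet u v := by
    by_contra! hcon
    have hcon' : ∀ ζ : Set.Iio (bth (v.ord + 1 + 1)),
        ∃ w : {w : TNode.{u} | K.Prec w v ∧ w ∈ K.U}, f ζ = K.reflH u w := by
      rintro ⟨ζ, hζ⟩
      by_contra! hc
      refine hcon ζ hζ ⟨?_, ?_, ?_, ?_⟩
      · refine isSuccLimit_add m ?_
        exact isSuccLimit_mul_left isSuccLimit_omega0 (by simp)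
      · exact hid _ ((le_max_left _ _).trans le_self_add)
      · exact not_lt.2 ((le_max_right _ _).trans le_self_add)
      · intro w' h2 h3
        exact hc ⟨w', h2, h3⟩
    choose g hg using hcon'
    have hginj : Function.Injective g := by
      intro a b hab
      refine Subtype.ext (hfinj ?_)
      rw [hg a, hg b, hab]
    have h2 := Cardinal.mk_le_of_injective hginj
    rw [Cardinal.mk_Iio_ordinal, bth, Cardinal.card_ord] at h2
    exact absurd (mk_prec_lt hK ((h1 hvu).trans hord)) h2.not_gt
  obtain ⟨ζ, hζ, hmem⟩ := hex
  rw [reflH_eq]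
  refine ⟨?_, lt_of_le_of_lt (csInf_le' hmem) ?_⟩
  · exact Order.add_one_le_iff.1 (not_lt.1 (csInf_mem ⟨_, hmem⟩).2.2.1)
  · have h2 : max ρ (v.ord + 1 + 1) < u.ord := max_lt hρ hlt1
    have h3 := bth_le_bth.2 (le_max_left ρ (v.ord + 1 + 1))
    have h4 := bth_le_bth.2 (le_max_right ρ (v.ord + 1 + 1))
    have h5 : v.ord + 1 < v.ord + 1 + 1 := Order.lt_add_one_iff.2 le_rfl
    have h6 : f ζ < bth (max ρ (v.ord + 1 + 1) + 1) := by
      have h7 : bth (max ρ (v.ord + 1 + 1)) < bth (max ρ (v.ord + 1 + 1) + 1) :=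
        bth_lt_bth.2 (Order.lt_add_one_iff.2 le_rfl)
      refine bth_add_lt (max_lt ((hξρ.trans_le h3).trans h7)
        ((h5.trans_le ((le_bth _).trans h4)).trans h7)) (bth_mul_lt ?_ (bth_add_one_lt ?_))
      · exact (omega0_le_bth _).trans_lt h7
      · exact (hζ.trans_le h4).trans h7
    exact h6.trans (hb (h1 h2))

/-- If there is no suitable index, `idx` is the infimum of the empty set, which is `0`. -/
theorem idx_lt (u : TNode.{u}) (β : Ordinal.{u}) : K.idx u β < bth (β + 1) := by
  rw [idx]
  by_cases h : {γ | γ < bth (β + 1) ∧ K.enum β γ = u.cut β}.Nonempty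
  · exact (csInf_mem h).1
  · rw [Set.not_nonempty_iff_eq_empty.1 h, Ordinal.sInf_empty]
    exact bth_pos _

theorem refl_add_one_of_gInds (hH : u ∉ K.TH) (hu : u.ord ∈ gInds) :
    K.refl u v + 1 = u.ord := by
  obtain ⟨γ, hγ⟩ := hu
  have : K.refl u v = sInf {β | u.ord = β + 1} := by simp [refl, hH]
  rw [this]
  exact (csInf_mem (s := {β | u.ord = β + 1}) ⟨_, hγ⟩).symm

theorem refl_bounds (hK : K.Admissible) (hu : u ∈ K.U) (h : K.IsSuccOf u v) :
    v.ord ≤ K.refl u v ∧ K.refl u v + 1 ≤ u.ord := by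
  have hvu := ord_lt_of_below hK hu h.2.1
  by_cases hH : u ∈ K.TH
  · have h0 : u ≠ TNode.root := by
      rintro rfl
      exact absurd hvu not_lt_bot
    have : K.refl u v = K.reflH u v := by simp [refl, hH]
    rw [this]
    obtain ⟨h1, h2⟩ := reflH_bounds hK hH h0 hvu
    exact ⟨h1.le, Order.add_one_le_of_lt h2⟩
  · have h1 := refl_add_one_of_gInds (v := v) hH (h.ord_mem_gInds hK hu hH)
    refine ⟨?_, h1.le⟩
    rw [← h1] at hvu
    exact Order.lt_add_one_iff.1 hvu

end Construction

/-! ### The functions `p_u` -/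

namespace Construction

open OrdGraph

variable {K : Construction.{u}} {u v w : TNode.{u}}

theorem pLt_eq_step (h : K.IsSuccOf u v) (hlt : v.ord < u.ord) :
    K.pLt u = K.step u v (K.pLt v) := by
  rw [pLt]
  ext x
  constructor
  · rintro (⟨v', _, h', hx⟩ | ⟨h', -⟩)
    · rwa [h.unique h']
    · exact (h' ⟨v, h⟩).elim
  · intro hx
    exact Or.inl ⟨v, hlt, h, hx⟩

theorem pLt_eq_iUnion (h : ¬ ∃ v, K.IsSuccOf u v) :
    K.pLt u = {x | ∃ v, v.ord < u.ord ∧ v ∈ K.U ∧ v.Below u ∧ x ∈ K.pLt v} := by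
  rw [pLt]
  ext x
  constructor
  · rintro (⟨v', _, h', -⟩ | ⟨-, v, hv, h⟩)
    · exact (h ⟨v', h'⟩).elim
    · exact ⟨v, hv, h⟩
  · rintro ⟨v, hv, hx⟩
    exact Or.inr ⟨h, v, hv, hx⟩

theorem pLt_root : K.pLt TNode.root = ∅ := by
  rw [pLt]
  ext x
  simp only [Set.mem_ofPred_eq, Set.mem_empty_iff_false, iff_false]
  rintro (⟨v, hv, -⟩ | ⟨-, v, hv, -⟩) <;> exact absurd hv not_lt_bot

/-- The functions `p_u` are injective, bounded by `ℶ` of the level of `u`, and extend `id_u`. -/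
structure IsGood (u : TNode.{u}) (q : OrdGraph.{u}) : Prop where
  isInj : q.IsInj
  bddBy : q.BddBy (bth u.ord)
  id_subset : u ≠ TNode.root → u.idGraph ⊆ q

theorem IsGood.inv {q : OrdGraph.{u}} (h : IsGood u q) : IsGood u.inv q.inv := by
  refine ⟨h.isInj.inv, h.bddBy.inv, fun h0 => ?_⟩
  rw [TNode.idGraph_inv, ← (TNode.isIdSeg_idGraph u).inv_eq]
  exact inv_subset_inv (h.id_subset fun h' => h0 (TNode.inv_eq_root.2 h'))

/-- At a successor step, the identity part of the new function is contained in the old one unless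
the old function is empty. -/
theorem idGraph_subset_or (hK : K.Admissible) (hv : v ∈ K.U) (hvu : v.Below u)
    (hg : IsGood v (K.pLt v)) : u.idGraph ⊆ K.pLt v ∨ K.pLt v = ∅ := by
  by_cases h0 : v = TNode.root
  · right; rw [h0, pLt_root]
  · left
    exact (TNode.idGraph_subset_of_below (level_of_mem_U hK hv) h0 hvu).trans (hg.id_subset h0)

open Classical in
/-- The identity part of a successor step can be adjoined to the old function first. -/
theorem step_eq (u v : TNode.{u}) {q : OrdGraph.{u}} (hq : q.IsInj)
    (hIq : u.idGraph ⊆ q ∨ q = ∅) :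
    K.step u v q = if ∃ o, q.ran = Set.Iio o then
        (u.idGraph ∪ q).extendBy (eGraph (K.refl u v) (K.idx u (K.refl u v)))
      else ((u.idGraph ∪ q.inv).extendBy (eGraph (K.refl u v) (K.idx u (K.refl u v)))).inv := by
  rw [step]
  rw [extendBy_extendBy hq hIq, extendBy_extendBy hq.inv]
  refine hIq.imp (fun h => ?_) fun h => by rw [h, inv_empty]
  rw [← (TNode.isIdSeg_idGraph u).inv_eq]
  exact inv_subset_inv h

theorem step_good (hK : K.Admissible) (hu : u ∈ K.U) (h : K.IsSuccOf u v)
    (hg : IsGood v (K.pLt v)) :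
    IsGood u (K.step u v (K.pLt v)) ∧ K.pLt v ⊆ K.step u v (K.pLt v) := by
  have hIq := idGraph_subset_or hK h.1 h.2.1 hg
  obtain ⟨h1, h2⟩ := refl_bounds hK hu h
  have hI := TNode.isIdSeg_idGraph u
  have hIq' : u.idGraph ⊆ (K.pLt v).inv ∨ (K.pLt v).inv = ∅ := by
    refine hIq.imp (fun h => ?_) fun h => by rw [h, inv_empty]
    rw [← hI.inv_eq]
    exact inv_subset_inv h
  have h2' := bth_le_bth.2 h2
  have hvu := (ord_lt_of_below hK hu h.2.1).le
  have hidx := idx_lt (K := K) u (K.refl u v)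
  rw [step_eq u v hg.isInj hIq]
  split_ifs with hran
  · refine ⟨⟨?_, ?_, fun _ => ?_⟩, ?_⟩
    · exact isInj_extendBy hI hg.isInj hIq (hg.bddBy.mono (bth_le_bth.2 h1))
    · exact bddBy_extendBy (TNode.bddBy_idGraph u) (hg.bddBy.mono (bth_le_bth.2 hvu)) h2' hidx
    · exact Set.subset_union_left.trans (subset_extendBy _ _)
    · exact Set.subset_union_right.trans (subset_extendBy _ _)
  · refine ⟨⟨?_, ?_, fun _ => ?_⟩, ?_⟩
    · exact (isInj_extendBy hI hg.isInj.inv hIq' (hg.bddBy.inv.mono (bth_le_bth.2 h1))).inv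
    · exact (bddBy_extendBy (TNode.bddBy_idGraph u) (hg.bddBy.inv.mono (bth_le_bth.2 hvu)) h2'
        hidx).inv
    · have := inv_subset_inv (Set.subset_union_left.trans (subset_extendBy
        (u.idGraph ∪ (K.pLt v).inv) (eGraph (K.refl u v) (K.idx u (K.refl u v)))))
      rwa [hI.inv_eq] at this
    · rw [← inv_inv (K.pLt v)]
      exact inv_subset_inv (Set.subset_union_right.trans (subset_extendBy _ _))

/-- The functions `p_u`, `u ∈ T_<`, are good and increase along the tree. -/
theorem pLt_good (hK : K.Admissible) (hu : u ∈ K.U) (hu' : u = TNode.root ∨ u ∈ K.TLt) :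
    IsGood u (K.pLt u) ∧ ∀ v ∈ K.U, v.Below u → K.pLt v ⊆ K.pLt u := by
  induction h : u.ord using WellFoundedLT.induction generalizing u with
  | ind α ih =>
    subst h
    rcases hu' with rfl | huT
    · rw [pLt_root]
      refine ⟨⟨isInj_empty, fun _ _ h => h.elim, fun h => (h rfl).elim⟩, fun v _ h => ?_⟩
      exact (h.2 : v.ord ∈ (∅ : Set Ordinal)).elim
    have hbelow : ∀ v ∈ K.U, v.Below u →
        v.ord < u.ord ∧ IsGood v (K.pLt v) ∧ ∀ w ∈ K.U, w.Below v → K.pLt w ⊆ K.pLt v := by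
      intro v hv hvu
      have hlt := ord_lt_of_below hK hu hvu
      refine ⟨hlt, ih v.ord hlt hv ?_ rfl⟩
      by_cases h0 : v = TNode.root
      · exact Or.inl h0
      · exact Or.inr (mem_TLt_of_below hK huT hv hvu h0)
    by_cases hs : ∃ v, K.IsSuccOf u v
    · obtain ⟨v, hs⟩ := hs
      obtain ⟨hlt, hg, hmono⟩ := hbelow v hs.1 hs.2.1
      rw [pLt_eq_step hs hlt]
      obtain ⟨h1, h2⟩ := step_good hK hu hs hg
      refine ⟨h1, fun w hw hwu => ?_⟩
      rcases lt_trichotomy w.ord v.ord with h | h | h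
      · exact (hmono w hw (hwu.of_lt hs.2.1 h)).trans h2
      · rw [hwu.eq_of_eq hs.2.1 h]; exact h2
      · exact (hs.2.2 ⟨w, hw, hs.2.1.of_lt hwu h, hwu⟩).elim
    · rw [pLt_eq_iUnion hs]
      refine ⟨⟨?_, ?_, fun h0 => ?_⟩, fun v hv hvu x hx =>
        ⟨v, ord_lt_of_below hK hu hvu, hv, hvu, hx⟩⟩
      · have key : ∀ x y : Ordinal.{u} × Ordinal.{u},
            (∃ v, v.ord < u.ord ∧ v ∈ K.U ∧ v.Below u ∧ x ∈ K.pLt v) →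
            (∃ v, v.ord < u.ord ∧ v ∈ K.U ∧ v.Below u ∧ y ∈ K.pLt v) →
            ∃ q : OrdGraph.{u}, q.IsInj ∧ x ∈ q ∧ y ∈ q := by
          rintro x y ⟨v, hv1, hv2, hv3, hv4⟩ ⟨w, hw1, hw2, hw3, hw4⟩
          rcases lt_trichotomy v.ord w.ord with h | h | h
          · exact ⟨_, (hbelow w hw2 hw3).2.1.isInj,
              (hbelow w hw2 hw3).2.2 v hv2 (hv3.of_lt hw3 h) hv4, hw4⟩
          · have := hv3.eq_of_eq hw3 h
            subst this
            exact ⟨_, (hbelow v hv2 hv3).2.1.isInj, hv4, hw4⟩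
          · exact ⟨_, (hbelow v hv2 hv3).2.1.isInj, hv4,
              (hbelow v hv2 hv3).2.2 w hw2 (hw3.of_lt hv3 h) hw4⟩
        refine ⟨fun x y y' h1 h2 => ?_, fun x x' y h1 h2 => ?_⟩
        · obtain ⟨q, hq, h3, h4⟩ := key _ _ h1 h2
          exact hq.1 _ _ _ h3 h4
        · obtain ⟨q, hq, h3, h4⟩ := key _ _ h1 h2
          exact hq.2 _ _ _ h3 h4
      · rintro x y ⟨v, hv1, hv2, hv3, hv4⟩
        exact (hbelow v hv2 hv3).2.1.bddBy.mono (bth_le_bth.2 hv1.le) x y hv4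
      · obtain ⟨w, hw, hrw, hwu⟩ := exists_between hs root_mem_U (root_below hu h0)
        have hw0 : w ≠ TNode.root := by
          rintro rfl
          exact (hrw.2 : (0 : Ordinal.{u}) ∈ (∅ : Set Ordinal)).elim
        intro x hx
        have := TNode.idGraph_subset_of_below (level_of_mem_U hK hw) hw0 hwu hx
        exact ⟨w, ord_lt_of_below hK hu hwu, hw, hwu, (hbelow w hw hwu).2.1.id_subset hw0 this⟩

theorem p_root : K.p TNode.root = ∅ := by simp [p]

theorem p_of_mem_TLt (hu : u ∈ K.TLt) : K.p u = K.pLt u := by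
  simp [p, mem_TLt_ne_root hu, hu]

theorem p_inv_of_mem_TLt (hu : u ∈ K.TLt) : K.p u.inv = (K.pLt u).inv := by
  have h0 : u.inv ≠ TNode.root := fun h => mem_TLt_ne_root hu (TNode.inv_eq_root.1 h)
  have h1 : u.inv ∉ K.TLt := fun h => hu.2.inv_not h.2
  simp [p, h0, h1]

theorem mem_TLt_or (hK : K.Admissible) (hu : u ∈ K.U) (h0 : u ≠ TNode.root) :
    u ∈ K.TLt ∨ u.inv ∈ K.TLt := by
  have hT := mem_T_of_mem_U hK hu
  exact (TNode.level_lexLt_or (mem_T_iff.1 hT).2 h0).imp (fun h => ⟨hT, h⟩)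
    fun h => ⟨mem_T_inv hT, h⟩

theorem p_inv (hK : K.Admissible) (hu : u ∈ K.U) : K.p u.inv = (K.p u).inv := by
  by_cases h0 : u = TNode.root
  · rw [h0, TNode.inv_root, p_root, inv_empty]
  rcases mem_TLt_or hK hu h0 with h | h
  · rw [p_inv_of_mem_TLt h, p_of_mem_TLt h]
  · have := p_inv_of_mem_TLt h
    rw [TNode.inv_inv] at this
    rw [p_of_mem_TLt h, this, inv_inv]

theorem p_good (hK : K.Admissible) (hu : u ∈ K.U) : IsGood u (K.p u) := by
  by_cases h0 : u = TNode.root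
  · have := (pLt_good hK hu (Or.inl h0)).1
    rw [h0, pLt_root] at this
    rwa [h0, p_root]
  rcases mem_TLt_or hK hu h0 with h | h
  · rw [p_of_mem_TLt h]
    exact (pLt_good hK hu (Or.inr h)).1
  · have h1 := (pLt_good hK (mem_U_inv hK hu) (Or.inr h)).1
    have h2 := p_inv_of_mem_TLt h
    rw [TNode.inv_inv] at h2
    rw [h2]
    exact h1.inv

theorem p_mono (hK : K.Admissible) (hu : u ∈ K.U) (hv : v ∈ K.U) (h : v.Below u) :
    K.p v ⊆ K.p u := by
  by_cases hv0 : v = TNode.root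
  · rw [hv0, p_root]; exact Set.empty_subset _
  have hlt := ord_lt_of_below hK hu h
  have hu0 : u ≠ TNode.root := by
    rintro rfl
    exact absurd hlt not_lt_bot
  have key : ∀ {u v : TNode.{u}}, u ∈ K.U → v ∈ K.U → v.Below u → v ≠ TNode.root → u ∈ K.TLt →
      K.p v ⊆ K.p u := by
    intro u v hu hv h hv0 hT
    rw [p_of_mem_TLt hT, p_of_mem_TLt (mem_TLt_of_below hK hT hv h hv0)]
    exact (pLt_good hK hu (Or.inr hT)).2 v hv h
  rcases mem_TLt_or hK hu hu0 with hT | hT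
  · exact key hu hv h hv0 hT
  · have := key (mem_U_inv hK hu) (mem_U_inv hK hv) h.inv
      (fun h => hv0 (TNode.inv_eq_root.1 h)) hT
    rw [p_inv hK hu, p_inv hK hv] at this
    exact inv_subset_inv this

/-- A successor step on a level `β + 1` which is not made by a node of `T^H` covers `ℶ_β`,
alternately by the domain and by the range. -/
theorem p_succ_cover (hK : K.Admissible) (hu : u ∈ K.U) (huT : u ∈ K.TLt) (hH : u ∉ K.TH)
    (h : K.IsSuccOf u v) {β : Ordinal.{u}} (hβ : u.ord = β + 1) :
    ((∃ o, (K.p v).ran = Set.Iio o) → Set.Iio (bth β) ⊆ (K.p u).dom ∧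
      (v.ord < β → ¬ AgreeBelow u.fst u.snd (bth β) → ¬ ∃ o, (K.p u).ran = Set.Iio o)) ∧
    ((¬ ∃ o, (K.p v).ran = Set.Iio o) → Set.Iio (bth β) ⊆ (K.p u).ran ∧
      ∃ o, (K.p u).ran = Set.Iio o) := by
  have hvT : K.p v = K.pLt v := by
    by_cases h0 : v = TNode.root
    · rw [h0, p_root, pLt_root]
    · exact p_of_mem_TLt (mem_TLt_of_below hK huT h.1 h.2.1 h0)
  have hg : IsGood v (K.pLt v) := hvT ▸ p_good hK h.1
  have hIq := idGraph_subset_or hK h.1 h.2.1 hg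
  have hI := TNode.isIdSeg_idGraph u
  have hvu := ord_lt_of_below hK hu h.2.1
  have hrefl : K.refl u v = β := by
    have := refl_add_one_of_gInds (v := v) hH (h.ord_mem_gInds hK hu hH)
    rw [hβ, ← Order.succ_eq_add_one, ← Order.succ_eq_add_one] at this
    exact Order.succ_injective this
  rw [hvT, p_of_mem_TLt huT, pLt_eq_step h hvu, step_eq u v hg.isInj hIq, hrefl]
  refine ⟨fun hran => ?_, fun hran => ?_⟩
  · rw [if_pos hran]
    refine ⟨?_, fun hlt hag => ?_⟩
    · rw [dom_extendBy, dom_eGraph]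
      exact Set.subset_union_right
    · by_cases h0 : v = TNode.root
      · -- The first difference of the two branches is missing from the range.
        obtain ⟨ξ, hξ, -, hne⟩ := exists_least_ne hag
        have hξI : (ξ, ξ) ∉ u.idGraph := fun h' => hne (h'.2.2 ξ (Order.lt_add_one_iff.2 le_rfl))
        rw [h0, pLt_root, Set.union_empty]
        refine ran_extendBy_ne_Iio hξ ?_ ?_
        · rw [mem_dom]
          rintro ⟨y, hy⟩
          have := hI.eq _ _ hy
          subst this
          exact hξI hy
        · rw [mem_ran]
          rintro ⟨y, hy⟩
          have := hI.eq _ _ hy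
          subst this
          exact hξI hy
      · -- The bound of the previous function is missing from the range.
        have hIv : u.idGraph ∪ K.pLt v = K.pLt v := Set.union_eq_self_of_subset_left
          ((TNode.idGraph_subset_of_below (level_of_mem_U hK h.1) h0 h.2.1).trans
            (hg.id_subset h0))
        rw [hIv]
        refine ran_extendBy_ne_Iio (bth_lt_bth.2 hlt) ?_ ?_
        · rw [mem_dom]
          rintro ⟨y, hy⟩
          exact (hg.bddBy _ _ hy).1.false
        · rw [mem_ran]
          rintro ⟨y, hy⟩
          exact (hg.bddBy _ _ hy).2.false
  · rw [if_neg hran]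
    have h0 : v ≠ TNode.root := by
      rintro rfl
      refine hran ⟨0, ?_⟩
      rw [pLt_root]
      ext x
      simp [ran]
    have hIv : u.idGraph ⊆ K.pLt v :=
      (TNode.idGraph_subset_of_below (level_of_mem_U hK h.1) h0 h.2.1).trans (hg.id_subset h0)
    have hdom : ((u.idGraph ∪ (K.pLt v).inv).extendBy (eGraph β (K.idx u β))).dom =
        Set.Iio (bth β) := by
      have : u.idGraph ∪ (K.pLt v).inv = (K.pLt v).inv := by
        refine Set.union_eq_self_of_subset_left ?_
        rw [← hI.inv_eq]
        exact inv_subset_inv hIv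
      rw [this, dom_extendBy, dom_eGraph, dom_inv]
      refine Set.union_eq_self_of_subset_left fun y hy => ?_
      obtain ⟨x, hx⟩ := mem_ran.1 hy
      refine (hg.bddBy _ _ hx).2.trans_le (bth_le_bth.2 ?_)
      rw [hβ] at hvu
      exact Order.lt_add_one_iff.1 hvu
    rw [ran_inv, hdom]
    exact ⟨subset_rfl, _, rfl⟩

end Construction

/-! ### Compositions and their reduction to minimal ones -/

namespace OrdGraph

variable {p q : OrdGraph.{u}} {W : Set Ordinal.{u}} {x y b : Ordinal.{u}}

theorem mem_img : y ∈ p.img W ↔ ∃ x ∈ W, (x, y) ∈ p := Iff.rfl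

theorem mem_andThen : (x, y) ∈ p.andThen q ↔ ∃ z, (x, z) ∈ p ∧ (z, y) ∈ q := Iff.rfl

theorem img_andThen : (p.andThen q).img W = q.img (p.img W) := by
  ext y
  simp only [mem_img, mem_andThen]
  constructor
  · rintro ⟨x, hx, z, h1, h2⟩
    exact ⟨z, ⟨x, hx, h1⟩, h2⟩
  · rintro ⟨z, ⟨x, hx, h1⟩, h2⟩
    exact ⟨x, hx, z, h1, h2⟩

end OrdGraph

namespace Construction

open OrdGraph

variable {K : Construction.{u}} {u v : TNode.{u}} {us vs : List TNode.{u}}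
  {W : Set Ordinal.{u}} {η ν θ : Ordinal.{u} → Bool} {x y z : Ordinal.{u}}

/-- The composition of the functions `p_u`, `u` in the list, is defined on `W`, and the branches of
consecutive nodes fit together, starting from `η` and ending with `ν`. -/
def Path (K : Construction.{u}) : List TNode.{u} → Set Ordinal.{u} → (Ordinal.{u} → Bool) →
    (Ordinal.{u} → Bool) → Prop
  | [], W, η, ν => AgreeBelow η ν (pSup W)
  | u :: us, W, η, ν => (u ∈ K.U ∧ u ≠ TNode.root) ∧ AgreeBelow η u.fst (pSup W) ∧
      W ⊆ (K.p u).dom ∧ Path K us ((K.p u).img W) u.snd ν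

@[simp] theorem mem_comp_nil : (x, y) ∈ K.comp [] ↔ x = y := Iff.rfl

theorem comp_cons : K.comp (u :: us) = (K.p u).andThen (K.comp us) := rfl

theorem mem_comp_append :
    (x, y) ∈ K.comp (us ++ vs) ↔ ∃ z, (x, z) ∈ K.comp us ∧ (z, y) ∈ K.comp vs := by
  induction us generalizing x with
  | nil => simp
  | cons u us ih =>
    simp only [List.cons_append, comp_cons, mem_andThen, ih]
    constructor
    · rintro ⟨z, h1, z', h2, h3⟩
      exact ⟨z', ⟨z, h1, h2⟩, h3⟩
    · rintro ⟨z', ⟨z, h1, h2⟩, h3⟩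
      exact ⟨z, h1, z', h2, h3⟩

theorem img_comp_nil : (K.comp []).img W = W := by
  ext y; simp [mem_img]

theorem img_comp_append : (K.comp (us ++ vs)).img W = (K.comp vs).img ((K.comp us).img W) := by
  rw [← img_andThen]
  congr 1
  ext ⟨x, y⟩
  rw [mem_comp_append, mem_andThen]

theorem img_comp_singleton : (K.comp [u]).img W = (K.p u).img W := by
  rw [comp_cons, img_andThen, img_comp_nil]

theorem mem_comp_singleton : (x, y) ∈ K.comp [u] ↔ (x, y) ∈ K.p u := by
  simp [comp_cons, mem_andThen]

theorem stage_succ {i : ℕ} (hi : i < us.length) :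
    K.stage us W (i + 1) = (K.p us[i]).img (K.stage us W i) := by
  rw [stage, stage, List.take_succ_eq_append_getElem hi, img_comp_append, img_comp_singleton]

theorem comp_functional (hK : K.Admissible) (hus : ∀ u ∈ us, u ∈ K.U)
    (h : (x, y) ∈ K.comp us) (h' : (x, z) ∈ K.comp us) : y = z := by
  induction us generalizing x with
  | nil => exact (mem_comp_nil.1 h).symm.trans (mem_comp_nil.1 h')
  | cons u us ih =>
    obtain ⟨s, h1, h2⟩ := h
    obtain ⟨t, h3, h4⟩ := h'
    have := (p_good hK (hus u (by simp))).isInj.1 _ _ _ h1 h3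
    subst this
    exact ih (fun u hu => hus u (by simp [hu])) h2 h4

theorem Path.total (h : K.Path us W η ν) (hx : x ∈ W) : ∃ y, (x, y) ∈ K.comp us := by
  induction us generalizing x W η with
  | nil => exact ⟨x, rfl⟩
  | cons u us ih =>
    obtain ⟨-, -, h1, h2⟩ := h
    obtain ⟨z, hz⟩ := mem_dom.1 (h1 hx)
    obtain ⟨y, hy⟩ := ih h2 (x := z) ⟨x, hx, hz⟩
    exact ⟨y, z, hz, hy⟩

theorem Path.mem_U (h : K.Path us W η ν) : ∀ u ∈ us, u ∈ K.U ∧ u ≠ TNode.root := by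
  induction us generalizing W η with
  | nil => simp
  | cons u us ih =>
    obtain ⟨h0, -, -, h2⟩ := h
    intro v hv
    rcases List.mem_cons.1 hv with rfl | hv
    · exact h0
    · exact ih h2 v hv

theorem Path.congr_left (h : K.Path us W η ν) (hag : AgreeBelow θ η (pSup W)) :
    K.Path us W θ ν := by
  cases us with
  | nil => exact hag.trans h
  | cons u us => exact ⟨h.1, hag.trans h.2.1, h.2.2⟩

theorem path_append :
    K.Path (us ++ vs) W η ν ↔ ∃ θ, K.Path us W η θ ∧ K.Path vs ((K.comp us).img W) θ ν := by
  induction us generalizing W η with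
  | nil =>
    rw [List.nil_append, img_comp_nil]
    exact ⟨fun h => ⟨η, AgreeBelow.refl _ _, h⟩, fun ⟨θ, h1, h2⟩ => h2.congr_left h1⟩
  | cons u us ih =>
    rw [List.cons_append, comp_cons, img_andThen]
    simp only [Path, ih]
    constructor
    · rintro ⟨h0, h1, h2, θ, h3, h4⟩
      exact ⟨θ, ⟨h0, h1, h2, h3⟩, h4⟩
    · rintro ⟨θ, ⟨h0, h1, h2, h3⟩, h4⟩
      exact ⟨h0, h1, h2, θ, h3, h4⟩

theorem Path.last (h : K.Path (us ++ [u]) W η ν) :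
    AgreeBelow u.snd ν (pSup ((K.comp (us ++ [u])).img W)) := by
  obtain ⟨θ, -, h2⟩ := path_append.1 h
  rw [img_comp_append, img_comp_singleton]
  exact h2.2.2.2

theorem path_drop (h : K.Path us W η ν) (i : ℕ) :
    ∃ θ, K.Path (us.take i) W η θ ∧ K.Path (us.drop i) (K.stage us W i) θ ν := by
  rw [← List.take_append_drop i us] at h
  exact path_append.1 h

theorem path_getElem (h : K.Path us W η ν) {i : ℕ} (hi : i < us.length) :
    ∃ θ, K.Path (us.take i) W η θ ∧ K.Path (us[i] :: us.drop (i + 1)) (K.stage us W i) θ ν := by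
  rw [← List.drop_eq_getElem_cons hi]
  exact path_drop h i

theorem Path.isSeq (h : K.Path us W η ν) (hW : W.Nonempty) (hus : us ≠ []) : K.IsSeq us W where
  nonempty := hW
  ne_nil := hus
  mem := h.mem_U
  dom := fun i hi => by
    obtain ⟨θ, -, h2⟩ := path_getElem h hi
    exact h2.2.2.1
  agree := fun i hi => by
    obtain ⟨θ, -, h2⟩ := path_getElem h ((Nat.lt_succ_self i).trans hi)
    rw [stage_succ]
    have h3 := h2.2.2.2
    rw [List.drop_eq_getElem_cons hi] at h3
    exact h3.2.1

/-- The data of a sequence in `Seq` with prescribed beginning and end, in recursive form. -/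
theorem path_of_seq (hus : us ≠ []) (hmem : ∀ u ∈ us, u ∈ K.U ∧ u ≠ TNode.root)
    (hdom : ∀ i (hi : i < us.length), K.stage us W i ⊆ (K.p us[i]).dom)
    (hag : ∀ i (hi : i + 1 < us.length),
      AgreeBelow us[i].snd us[i + 1].fst (pSup (K.stage us W (i + 1))))
    (hbeg : ∀ u, us.head? = some u → AgreeBelow u.fst η (pSup W))
    (hfin : ∀ u, us.getLast? = some u → AgreeBelow u.snd ν (pSup (K.stage us W us.length))) :
    K.Path us W η ν := by
  induction us generalizing W η with
  | nil => exact (hus rfl).elim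
  | cons u us ih =>
    have hstage : ∀ i, K.stage (u :: us) W (i + 1) = K.stage us ((K.p u).img W) i := by
      intro i
      rw [stage, List.take_succ_cons, comp_cons, img_andThen]
      rfl
    have h0 : K.stage (u :: us) W 0 = W := img_comp_nil
    have hd := hdom 0 (by simp)
    rw [h0] at hd
    refine ⟨hmem u (by simp), (hbeg u rfl).symm, hd, ?_⟩
    cases us with
    | nil =>
      have := hfin u rfl
      rwa [List.length_singleton, hstage, stage, List.take_nil, img_comp_nil] at this
    | cons v us =>
      refine ih (by simp) (fun w hw => hmem w (by simp only [List.mem_cons] at hw ⊢; tauto)) ?_ ?_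
        ?_ ?_
      · intro i hi
        have := hdom (i + 1) (by simpa using hi)
        rwa [hstage] at this
      · intro i hi
        have := hag (i + 1) (by simpa using hi)
        rwa [hstage] at this
      · intro w hw
        have hw : v = w := by simpa using hw
        subst hw
        have := (hag 0 (by simp)).symm
        rwa [hstage, stage, List.take_zero, img_comp_nil] at this
      · intro w hw
        have := hfin w (by rw [List.getLast?_cons_cons]; exact hw)
        rwa [List.length_cons, hstage] at this

/-- A node of a path can be replaced by a node below it whose function is defined on the respective
stage. -/
theorem Path.replace (hK : K.Admissible) (h : K.Path (us ++ u :: vs) W η ν) (hv : v ∈ K.U)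
    (hvu : v.Below u) (hdom : (K.comp us).img W ⊆ (K.p v).dom) (hW : W.Nonempty) :
    K.Path (us ++ v :: vs) W η ν ∧ ∀ x ∈ W, ∀ y, (x, y) ∈ K.comp (us ++ u :: vs) →
      (x, y) ∈ K.comp (us ++ v :: vs) := by
  obtain ⟨θ, h1, ⟨hu, hu0⟩, h2, h3, h4⟩ := path_append.1 h
  have hsub := p_mono hK hu hv hvu
  have hfun := (p_good hK hu).isInj.1
  have hval : ∀ s ∈ (K.comp us).img W, ∀ t, (s, t) ∈ K.p u → (s, t) ∈ K.p v := by
    intro s hs t hst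
    obtain ⟨t', ht'⟩ := mem_dom.1 (hdom hs)
    rw [hfun _ _ _ hst (hsub ht')]
    exact ht'
  have himg : (K.p v).img ((K.comp us).img W) = (K.p u).img ((K.comp us).img W) := by
    ext t
    constructor
    · rintro ⟨s, hs, hst⟩
      exact ⟨s, hs, hsub hst⟩
    · rintro ⟨s, hs, hst⟩
      exact ⟨s, hs, hval s hs t hst⟩
  have hv0 : v ≠ TNode.root := by
    rintro rfl
    obtain ⟨x, hx⟩ := hW
    obtain ⟨y, hy⟩ := h1.total hx
    obtain ⟨t, ht⟩ := mem_dom.1 (hdom ⟨x, hx, hy⟩)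
    rw [p_root] at ht
    exact ht
  have hvo := ord_ne_zero_of_mem_U hK hv hv0
  have hb := (p_good hK hv).bddBy
  have hb1 : pSup ((K.comp us).img W) ≤ bth v.ord := by
    refine pSup_le fun s hs => ?_
    obtain ⟨t, ht⟩ := mem_dom.1 (hdom hs)
    exact (hb _ _ ht).1
  have hb2 : pSup ((K.p u).img ((K.comp us).img W)) ≤ bth v.ord := by
    rw [← himg]
    refine pSup_le fun t ht => ?_
    obtain ⟨s, -, hst⟩ := ht
    exact (hb _ _ hst).2
  refine ⟨path_append.2 ⟨θ, h1, ⟨hv, hv0⟩, ?_, hdom, ?_⟩, ?_⟩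
  · refine h2.trans ?_
    rw [hvu.1, TNode.cut_fst _ hvo]
    exact (agreeBelow_cutFun _ _).symm.mono hb1
  · rw [himg]
    refine h4.congr_left ?_
    rw [hvu.1, TNode.cut_snd _ hvo]
    exact (agreeBelow_cutFun _ _).mono hb2
  · intro x hx y hxy
    obtain ⟨s, hs, t, hst, hty⟩ := mem_comp_append.1 hxy
    exact mem_comp_append.2 ⟨s, hs, t, hval s ⟨x, hx, hs⟩ t hst, hty⟩

/-- A segment of a path which composes to an identity function with equal ends can be omitted. -/
theorem Path.remove {ws : List TNode.{u}} (h : K.Path (us ++ (ws ++ vs)) W η ν)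
    (hid : ∀ ξ ∈ (K.comp us).img W, ∀ ζ, (ξ, ζ) ∈ K.comp ws → ξ = ζ)
    (hends : ∀ θ₁ θ₂, K.Path ws ((K.comp us).img W) θ₁ θ₂ →
      (K.comp ws).img ((K.comp us).img W) = (K.comp us).img W →
      AgreeBelow θ₁ θ₂ (pSup ((K.comp us).img W))) :
    K.Path (us ++ vs) W η ν ∧ ∀ x ∈ W, ∀ y, (x, y) ∈ K.comp (us ++ (ws ++ vs)) →
      (x, y) ∈ K.comp (us ++ vs) := by
  obtain ⟨θ₁, h1, h2⟩ := path_append.1 h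
  obtain ⟨θ₂, h3, h4⟩ := path_append.1 h2
  have himg : (K.comp ws).img ((K.comp us).img W) = (K.comp us).img W := by
    ext t
    constructor
    · rintro ⟨s, hs, hst⟩
      rw [← hid s hs t hst]
      exact hs
    · intro ht
      obtain ⟨s, hs⟩ := h3.total ht
      have := hid t ht s hs
      subst this
      exact ⟨t, ht, hs⟩
  rw [himg] at h4
  refine ⟨path_append.2 ⟨θ₁, h1, h4.congr_left (hends _ _ h3 himg)⟩, ?_⟩
  intro x hx y hxy
  obtain ⟨s, hs, hsy⟩ := mem_comp_append.1 hxy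
  obtain ⟨t, ht, hty⟩ := mem_comp_append.1 hsy
  have := hid s ⟨x, hx, hs⟩ t ht
  subst this
  exact mem_comp_append.2 ⟨s, hs, hty⟩

/-- The levels of the nodes of a list; paths are reduced by induction on this multiset in the
Dershowitz–Manna order. -/
def ords (us : List TNode.{u}) : Multiset Ordinal.{u} := (us.map TNode.ord : List Ordinal.{u})

theorem ords_append (us vs : List TNode.{u}) : ords (us ++ vs) = ords us + ords vs := by
  simp [ords]

/-- Every path can be reduced to the empty one or to a minimal one, without changing the composition
on `W`. -/
theorem Path.exists_minimal (hK : K.Admissible) {μ : Cardinal.{u}} (h : K.Path us W η ν)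
    (hμ : ∀ u ∈ us, u.ord < μ.ord) (hW : W.Nonempty) :
    ∃ vs, (∀ x ∈ W, ∀ y, (x, y) ∈ K.comp us → (x, y) ∈ K.comp vs) ∧
      ((vs = [] ∧ AgreeBelow η ν (pSup W)) ∨ K.IsFComp μ η ν vs W) := by
  let S : Set (List TNode.{u}) := {vs | K.Path vs W η ν ∧ (∀ u ∈ vs, u.ord < μ.ord) ∧
    ∀ x ∈ W, ∀ y, (x, y) ∈ K.comp us → (x, y) ∈ K.comp vs}
  obtain ⟨vs, ⟨h1, h2, h3⟩, hmin⟩ := WellFounded.has_min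
    (InvImage.wf ords (Multiset.wellFounded_isDershowitzMannaLT (α := Ordinal.{u}))) S
    ⟨us, h, hμ, fun _ _ _ h => h⟩
  refine ⟨vs, h3, ?_⟩
  by_cases hvs : vs = []
  · subst hvs
    exact Or.inl ⟨rfl, h1⟩
  have hseq := h1.isSeq hW hvs
  refine Or.inr ⟨hseq, ⟨?_, ?_⟩, h2, ?_, ?_⟩
  · -- If a node `v` below the `i`-th one suffices, it replaces that node at a smaller level.
    intro i hi v hv hvu hdom
    have hsplit : vs = vs.take i ++ vs[i] :: vs.drop (i + 1) := by
      rw [← List.drop_eq_getElem_cons hi, List.take_append_drop]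
    have h1' := h1
    rw [hsplit] at h1'
    obtain ⟨h4, h5⟩ := h1'.replace hK hv hvu hdom hW
    rw [← hsplit] at h5
    have hlt := ord_lt_of_below hK (hseq.mem vs[i] (List.getElem_mem hi)).1 hvu
    refine hmin (vs.take i ++ v :: vs.drop (i + 1)) ⟨h4, ?_, fun x hx y hxy =>
      h5 x hx y (h3 x hx y hxy)⟩ ?_
    · intro w hw
      rcases List.mem_append.1 hw with hw | hw
      · exact h2 w (List.mem_of_mem_take hw)
      · rcases List.mem_cons.1 hw with rfl | hw
        · exact hlt.trans (h2 _ (List.getElem_mem hi))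
        · exact h2 w (List.mem_of_mem_drop hw)
    · refine ⟨ords (vs.take i) + ords (vs.drop (i + 1)), {v.ord}, {vs[i].ord}, by simp, ?_, ?_,
        by simpa using hlt⟩
      · rw [ords_append, add_assoc, add_comm (ords (vs.drop (i + 1)))]
        rfl
      · conv_lhs => rw [hsplit]
        rw [ords_append, add_assoc, add_comm (ords (vs.drop (i + 1)))]
        rfl
  · -- A segment which composes to an identity function with equal ends is omitted.
    rintro ⟨i, j, hij, hj, hid, -, hag⟩
    obtain ⟨k, rfl⟩ := Nat.exists_eq_add_of_le hij
    have hlen : k < (vs.drop i).length := by rw [List.length_drop]; omega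
    have hB : (vs.drop i).take (i + k + 1 - i) = (vs.drop i).take k ++ [vs[i + k]] := by
      rw [show i + k + 1 - i = k + 1 by omega, List.take_succ_eq_append_getElem hlen,
        List.getElem_drop]
    have hi : i < vs.length := by omega
    have hB' : (vs.drop i).take (i + k + 1 - i) = vs[i] :: (vs.drop (i + 1)).take k := by
      rw [show i + k + 1 - i = k + 1 by omega, List.drop_eq_getElem_cons hi, List.take_succ_cons]
    have hsplit : vs = vs.take i ++ ((vs.drop i).take (i + k + 1 - i) ++ vs.drop (i + k + 1)) := by
      conv_lhs => rw [← List.take_append_drop i vs]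
      conv_lhs => rw [← List.take_append_drop (i + k + 1 - i) (vs.drop i), List.drop_drop,
        show i + (i + k + 1 - i) = i + k + 1 by omega]
    have h1' := h1
    rw [hsplit] at h1'
    obtain ⟨h4, h5⟩ := h1'.remove hid fun θ₁ θ₂ hp himg => by
      have h6 : AgreeBelow θ₁ vs[i].fst (pSup ((K.comp (vs.take i)).img W)) := by
        rw [hB'] at hp
        exact hp.2.1
      have h7 : AgreeBelow vs[i + k].snd θ₂ (pSup ((K.comp (vs.take i)).img W)) := by
        rw [hB] at hp himg
        have := hp.last
        rwa [himg] at this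
      exact (h6.trans hag).trans h7
    rw [← hsplit] at h5
    refine hmin _ ⟨h4, ?_, fun x hx y hxy => h5 x hx y (h3 x hx y hxy)⟩ ?_
    · intro w hw
      rcases List.mem_append.1 hw with hw | hw
      · exact h2 w (List.mem_of_mem_take hw)
      · exact h2 w (List.mem_of_mem_drop hw)
    · refine ⟨ords (vs.take i ++ vs.drop (i + k + 1)), 0,
        ords ((vs.drop i).take (i + k + 1 - i)), ?_, (add_zero _).symm, ?_, by simp⟩
      · rw [hB']
        simp [ords]
      · conv_lhs => rw [hsplit]
        rw [ords_append, ords_append, ords_append,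
          add_comm (ords (List.take (i + k + 1 - i) (List.drop i vs)))]
        exact (add_assoc _ _ _).symm
  · intro u hu
    obtain ⟨u', us', rfl⟩ := List.exists_cons_of_ne_nil hvs
    have : u' = u := by simpa using hu
    subst this
    exact h1.2.1.symm
  · intro u hu
    obtain ⟨us', rfl⟩ := List.getLast?_eq_some_iff.1 hu
    rw [stage, List.take_length]
    exact h1.last

/-! ### The functions `p_u` are partial isomorphisms -/

/-- The function `p_u` as a relation between the universes of the models. -/
def nodeGraph (K : Construction.{u}) (μ : Cardinal.{u}) (u : TNode.{u}) :
    Set (Set.Iio μ.ord × Set.Iio μ.ord) :=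
  {x | ((x.1 : Ordinal.{u}), (x.2 : Ordinal.{u})) ∈ K.p u}

/-- Appending `p_u` to the sequence which witnesses a relation, and reducing the result to a minimal
sequence, shows that `p_u` preserves the relation. -/
theorem model_rel_of_rel (hK : K.Admissible) {μ : Cardinal.{u}} (hu : u ∈ K.U)
    (hμ : u.ord < μ.ord) (h1 : AgreeBelow u.fst η (bth u.ord)) (h2 : AgreeBelow u.snd ν (bth u.ord))
    (a : BSeq μ) (x y : Set.Iio a.len → Set.Iio μ.ord)
    (hxy : ∀ i, ((x i : Ordinal.{u}), (y i : Ordinal.{u})) ∈ K.p u)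
    (h : (K.model μ η).rel a x) : (K.model μ ν).rel a y := by
  rcases (Set.range a.val).eq_empty_or_nonempty with hW | hW
  · left
    refine ⟨fun i => ?_, ?_⟩
    · exact ((Set.eq_empty_iff_forall_notMem.1 hW) _ ⟨i, rfl⟩).elim
    · rw [hW, pSup_empty]
      exact fun ξ hξ => (not_lt_bot hξ).elim
  obtain ⟨us, hpath, hus, hcomp⟩ : ∃ us : List TNode.{u},
      K.Path us (Set.range a.val) (fun _ => false) η ∧ (∀ u ∈ us, u.ord < μ.ord) ∧
      ∀ i, (a.val i, (x i : Ordinal.{u})) ∈ K.comp us := by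
    rcases h with ⟨h3, h4⟩ | ⟨us, h3, h4⟩
    · exact ⟨[], h4, by simp, fun i => (h3 i).symm⟩
    · exact ⟨us, path_of_seq h3.isSeq.ne_nil h3.isSeq.mem h3.isSeq.dom h3.isSeq.agree h3.beg h3.fin,
        h3.ord_lt, h4⟩
  have hsub : (K.comp us).img (Set.range a.val) ⊆ (K.p u).dom := by
    rintro _ ⟨_, ⟨i, rfl⟩, h5⟩
    rw [comp_functional hK (fun u hu => (hpath.mem_U u hu).1) h5 (hcomp i)]
    exact mem_dom.2 ⟨_, hxy i⟩
  have h0 : u ≠ TNode.root := by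
    rintro rfl
    obtain ⟨_, ⟨i, rfl⟩⟩ := hW
    have := hxy i
    rw [p_root] at this
    exact this
  have hb := (p_good hK hu).bddBy
  have hpath' : K.Path (us ++ [u]) (Set.range a.val) (fun _ => false) ν := by
    refine path_append.2 ⟨η, hpath, ⟨hu, h0⟩, h1.symm.mono (pSup_le fun s hs => ?_), hsub,
      h2.mono (pSup_le fun t ht => ?_)⟩
    · obtain ⟨t, ht⟩ := mem_dom.1 (hsub hs)
      exact (hb _ _ ht).1
    · obtain ⟨s, -, hst⟩ := ht
      exact (hb _ _ hst).2
  obtain ⟨vs, h5, h6⟩ := hpath'.exists_minimal hK (μ := μ) (fun w hw => by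
    rcases List.mem_append.1 hw with hw | hw
    · exact hus w hw
    · rw [List.mem_singleton.1 hw]; exact hμ) hW
  have h7 : ∀ i, (a.val i, (y i : Ordinal.{u})) ∈ K.comp vs := fun i =>
    h5 _ ⟨i, rfl⟩ _ (mem_comp_append.2 ⟨_, hcomp i, mem_comp_singleton.2 (hxy i)⟩)
  rcases h6 with ⟨rfl, h6⟩ | h6
  · exact Or.inl ⟨fun i => (mem_comp_nil.1 (h7 i)).symm, h6⟩
  · exact Or.inr ⟨vs, h6, h7⟩

theorem isPartialIso_nodeGraph (hK : K.Admissible) {μ : Cardinal.{u}} (hu : u ∈ K.U)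
    (hμ : u.ord < μ.ord) (h1 : AgreeBelow u.fst η (bth u.ord))
    (h2 : AgreeBelow u.snd ν (bth u.ord)) :
    IsPartialIso (K.model μ η) (K.model μ ν) (K.nodeGraph μ u) where
  functional := fun _ _ _ h h' => Subtype.ext ((p_good hK hu).isInj.1 _ _ _ h h')
  injective := fun _ _ _ h h' => Subtype.ext ((p_good hK hu).isInj.2 _ _ _ h h')
  rel_iff := fun a x y hxy => by
    refine ⟨model_rel_of_rel hK hu hμ h1 h2 a x y hxy, ?_⟩
    refine model_rel_of_rel hK (mem_U_inv hK hu) hμ h2 h1 a y x fun i => ?_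
    rw [p_inv hK hu]
    exact hxy i

end Construction

/-! ### Nodes as sets, and reflection of the bookkeeping function -/

theorem bit_injective : Function.Injective bit.{u} := by
  intro i j h
  have h' := toZFSet_injective h
  cases i <;> cases j <;> simp at h' ⊢

theorem bit_mem_two (i : Bool) : bit.{u} i ∈ (2 : Ordinal.{u}).toZFSet := by
  rw [bit, toZFSet_mem_toZFSet_iff]
  cases i <;> simp

theorem rank_bit_lt (i : Bool) {δ : Ordinal.{u}} (hδ : ω ≤ δ) : (bit.{u} i).rank < δ := by
  rw [bit, rank_toZFSet]
  refine lt_of_lt_of_le ?_ hδ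
  cases i
  · simp
  · simp

theorem rank_zfset_pair_lt {δ : Ordinal.{u}} (hδ : Order.IsSuccLimit δ) {x y : ZFSet.{u}}
    (hx : x.rank < δ) (hy : y.rank < δ) : (ZFSet.pair x y).rank < δ := by
  simp only [ZFSet.pair, ZFSet.rank_pair, ZFSet.rank_singleton]
  have := hδ.succ_lt hx
  have := hδ.succ_lt hy
  exact max_lt (hδ.succ_lt ‹_›) (hδ.succ_lt (max_lt ‹_› ‹_›))

theorem isSuccLimit_bth (α : Ordinal.{u}) : Order.IsSuccLimit (bth α) :=
  Cardinal.isSuccLimit_ord (aleph0_le_beth α)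

namespace TNode

variable {u v : TNode.{u}} {η ν : Ordinal.{u} → Bool} {δ ε : Ordinal.{u}}

theorem mem_codeFun {z : ZFSet.{u}} :
    z ∈ codeFun η δ ↔ ∃ ξ < δ, z = ZFSet.pair ξ.toZFSet (bit (η ξ)) := by
  rw [codeFun, ZFSet.mem_pairSep]
  constructor
  · rintro ⟨a, ha, b, hb, rfl, ξ, rfl, rfl⟩
    exact ⟨ξ, toZFSet_mem_toZFSet_iff.1 ha, rfl⟩
  · rintro ⟨ξ, hξ, rfl⟩
    exact ⟨_, toZFSet_mem_toZFSet_iff.2 hξ, _, bit_mem_two _, rfl, ξ, rfl, rfl⟩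

theorem codeFun_inj (h : codeFun η δ = codeFun ν ε) : δ = ε ∧ AgreeBelow η ν δ := by
  have key : ∀ {η ν : Ordinal.{u} → Bool} {δ ε : Ordinal.{u}}, codeFun η δ = codeFun ν ε →
      ∀ ξ < δ, ξ < ε ∧ η ξ = ν ξ := by
    intro η ν δ ε h ξ hξ
    have h1 : ZFSet.pair ξ.toZFSet (bit (η ξ)) ∈ codeFun ν ε := by
      rw [← h]; exact mem_codeFun.2 ⟨ξ, hξ, rfl⟩
    obtain ⟨ζ, hζ, h2⟩ := mem_codeFun.1 h1
    obtain ⟨h3, h4⟩ := ZFSet.pair_inj.1 h2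
    have := toZFSet_injective h3
    subst this
    exact ⟨hζ, bit_injective h4⟩
  refine ⟨le_antisymm ?_ ?_, fun ξ hξ => (key h ξ hξ).2⟩
  · exact le_of_forall_lt fun ξ hξ => (key h ξ hξ).1
  · exact le_of_forall_lt fun ξ hξ => (key h.symm ξ hξ).1

theorem rank_codeFun_le (η : Ordinal.{u} → Bool) (α : Ordinal.{u}) :
    (codeFun η (bth α)).rank ≤ bth α := by
  refine ZFSet.rank_le_iff.2 fun z hz => ?_
  obtain ⟨ξ, hξ, rfl⟩ := mem_codeFun.1 hz
  refine rank_zfset_pair_lt (isSuccLimit_bth α) ?_ (rank_bit_lt _ (omega0_le_bth α))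
  rwa [rank_toZFSet]

theorem code_of_ne (h : u.ord ≠ 0) : u.code = ZFSet.pair (codeFun u.fst (bth u.ord))
    (ZFSet.pair (codeFun u.snd (bth u.ord)) (ZFSet.pair (codeFun u.trd (bth u.ord))
      (ZFSet.sep (fun x => ∃ ξ ∈ u.cub, x = ξ.toZFSet) u.ord.toZFSet))) := by
  simp [code, h]

theorem rank_code_lt (hδ : Order.IsSuccLimit δ) (hu : bth u.ord < δ) : u.code.rank < δ := by
  by_cases h0 : u.ord = 0
  · simp only [code, h0, if_true, ZFSet.rank_empty]
    exact hδ.bot_lt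
  · rw [code_of_ne h0]
    refine rank_zfset_pair_lt hδ ((rank_codeFun_le _ _).trans_lt hu) (rank_zfset_pair_lt hδ
      ((rank_codeFun_le _ _).trans_lt hu) (rank_zfset_pair_lt hδ
      ((rank_codeFun_le _ _).trans_lt hu) ?_))
    refine (ZFSet.rank_mono (ZFSet.sep_subset)).trans_lt ?_
    rw [rank_toZFSet]
    exact (le_bth _).trans_lt hu

theorem code_inj (hu : u ∈ Level u.ord) (hv : v ∈ Level v.ord) (h : u.code = v.code) : u = v := by
  have hpair : ∀ x y : ZFSet.{u}, ZFSet.pair x y ≠ ∅ := by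
    intro x y h
    have h1 : ({x} : ZFSet) ∈ ZFSet.pair x y := by simp [ZFSet.pair]
    rw [h] at h1
    exact ZFSet.notMem_empty _ h1
  by_cases hu0 : u.ord = 0 <;> by_cases hv0 : v.ord = 0
  · rw [hu.2.1 hu0, hv.2.1 hv0]
  · rw [code_of_ne hv0] at h
    simp only [code, hu0, if_true] at h
    exact (hpair _ _ h.symm).elim
  · rw [code_of_ne hu0] at h
    simp only [code, hv0, if_true] at h
    exact (hpair _ _ h).elim
  · rw [code_of_ne hu0, code_of_ne hv0] at h
    obtain ⟨h1, h⟩ := ZFSet.pair_inj.1 h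
    obtain ⟨h2, h⟩ := ZFSet.pair_inj.1 h
    obtain ⟨h3, h⟩ := ZFSet.pair_inj.1 h
    obtain ⟨h4, h1⟩ := codeFun_inj h1
    have h2 := (codeFun_inj h2).2
    have h3 := (codeFun_inj h3).2
    have hord : u.ord = v.ord := bth_strictMono.injective h4
    obtain ⟨a, b, c, -, e, -⟩ := hu.2.2 hu0
    obtain ⟨a', b', c', -, e', -⟩ := hv.2.2 hv0
    have key : ∀ {η ν : Ordinal.{u} → Bool}, cutFun η (bth u.ord) = η →
        cutFun ν (bth v.ord) = ν → AgreeBelow η ν (bth u.ord) → η = ν := by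
      intro η ν h1 h2 h3
      funext ξ
      rcases lt_or_ge ξ (bth u.ord) with h | h
      · exact h3 ξ h
      · rw [← h1, ← h2, cutFun_of_le h, cutFun_of_le (hord ▸ h)]
    have hcub : ∀ ξ, ξ < u.ord → (ξ ∈ u.cub ↔ ξ ∈ v.cub) := by
      intro ξ hξ
      have h5 : ∀ {w : TNode.{u}}, ξ < w.ord → (ξ.toZFSet ∈ ZFSet.sep
          (fun x => ∃ ξ ∈ w.cub, x = ξ.toZFSet) w.ord.toZFSet ↔ ξ ∈ w.cub) := by
        intro w hw
        rw [ZFSet.mem_sep, toZFSet_mem_toZFSet_iff]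
        constructor
        · rintro ⟨-, ζ, hζ, h⟩
          rwa [toZFSet_injective h]
        · exact fun h => ⟨hw, ξ, h, rfl⟩
      rw [← h5 hξ, h, h5 (hord ▸ hξ)]
    ext1
    · exact hord
    · exact key a a' h1
    · exact key b b' h2
    · exact key c c' h3
    · ext ξ
      constructor
      · exact fun h => (hcub ξ (e h)).1 h
      · exact fun h => (hcub ξ (hord ▸ e' h)).2 h

end TNode

namespace Construction

variable {K : Construction.{u}} {u v : TNode.{u}} {μ : Cardinal.{u}}

/-- The properties of the cardinals `μ` on which the argument relies: they are regular and closed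
under `ℶ`, and `π` takes each node below `μ` as a value unboundedly often below `μ`. -/
structure IsReflecting (K : Construction.{u}) (μ : Cardinal.{u}) : Prop where
  isRegular : μ.IsRegular
  lam_lt : K.lam < μ
  le : μ.ord ≤ K.κ.ord
  bth_lt : ∀ o < μ.ord, bth o < μ.ord
  π_unbounded : ∀ u ∈ {TNode.root} ∪ K.TLt, u.ord < μ.ord → ∀ β < μ.ord,
    ∃ α ∈ gInds, β < α ∧ α < μ.ord ∧ K.π α = u

theorem isReflecting_self (hK : K.Admissible) : K.IsReflecting K.κ where
  isRegular := hK.inaccessible.isRegular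
  lam_lt := hK.lam_lt
  le := le_rfl
  bth_lt := fun o ho => by
    have h1 : bth K.κ.ord = K.κ.ord := by rw [bth, hK.inaccessible.beth_ord]
    rw [← h1]
    exact bth_lt_bth.2 ho
  π_unbounded := fun u hu _ => hK.π_unbounded u hu

section

open FirstOrder FirstOrder.Language

/-- The formula `β ∈ α ∧ π(α) = u` with the parameters `β` and `u`. -/
def piFormula : clubLang.BoundedFormula (Fin 2) 1 :=
  Relations.boundedFormula₂ (L := clubLang) ClubRel.mem (Term.var (Sum.inl 0)) (&0) ⊓
    Relations.boundedFormula₂ (L := clubLang) ClubRel.pi (&0) (Term.var (Sum.inl 1))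

theorem realize_piFormula (v : Fin 2 → VSet K.κ) (y : VSet K.κ) :
    (letI := K.clubStructure; piFormula.Realize v (fun _ => y)) ↔
      (v 0).1 ∈ y.1 ∧ ∃ α, (α = 0 ∨ α ∈ gInds) ∧ α < K.κ.ord ∧ y.1 = α.toZFSet ∧
        (v 1).1 = (K.π α).code := by
  let := K.clubStructure
  simp only [piFormula, BoundedFormula.realize_inf, BoundedFormula.realize_rel₂]
  exact Iff.rfl

end

/-- For `β < μ` and a node `u` below `μ` the existence of `α > β` with `π(α) = u` reflects from
`V_κ` to `V_μ`. -/
theorem isReflecting_of_mem_D (hK : K.Admissible) (hμ : μ.IsRegular) (hD : μ.ord ∈ K.D) :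
    K.IsReflecting μ := by
  obtain ⟨h1, h2, h3⟩ := hD
  have hR : ∀ v : Fin 2 → VSet K.κ, K.clubStructure.RelMap ClubRel.mem v ↔
      (v 0).1 ∈ (v 1).1 := fun v => Iff.rfl
  have hb : ∀ o < μ.ord, bth o < μ.ord := fun o ho => h3.bth_lt hR hK.inaccessible h1.le ho
  refine ⟨hμ, ord_lt_ord.1 h2, h1.le, hb, fun u hu hord β hβ => ?_⟩
  obtain ⟨α, hα, hβα, hακ, hπ⟩ := hK.π_unbounded u hu β (hβ.trans h1)
  have hcode : u.code.rank < μ.ord :=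
    TNode.rank_code_lt (Cardinal.isSuccLimit_ord hμ.aleph0_le) (hb _ hord)
  obtain ⟨y, hy, hy'⟩ := h3.exists_witness_one piFormula
    ![⟨β.toZFSet, by rw [rank_toZFSet]; exact hβ.trans h1⟩, ⟨u.code, hcode.trans h1⟩]
    (by
      intro i
      fin_cases i
      · simpa using hβ
      · simpa using hcode)
    ⟨α.toZFSet, by rwa [rank_toZFSet]⟩
    ((realize_piFormula _ _).2 ⟨toZFSet_mem_toZFSet_iff.2 hβα, α, Or.inr hα, hακ, rfl, by
      simp [hπ]⟩)
  obtain ⟨h4, α', h5, h6, h7, h8⟩ := (realize_piFormula _ _).1 hy'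
  have h7' : y.1 = α'.toZFSet := h7
  have h8' : u.code = (K.π α').code := h8
  have hβα' : β < α' := by
    have : β.toZFSet ∈ y.1 := h4
    rwa [h7', toZFSet_mem_toZFSet_iff] at this
  rw [h7', rank_toZFSet] at hy
  have hmem : ∀ w ∈ {TNode.root} ∪ K.TLt, w ∈ TNode.Level w.ord := by
    rintro w (rfl | hw)
    · exact TNode.root_mem_level
    · exact (mem_T_iff.1 hw.1).2
  have hπ' : K.π α' ∈ {TNode.root} ∪ K.TLt := by
    rw [← hK.π_surj]
    exact ⟨α', ⟨h6, h5⟩, rfl⟩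
  refine ⟨α', h5.resolve_left ?_, hβα', hy, (TNode.code_inj (hmem _ hu) (hmem _ hπ') h8').symm⟩
  rintro rfl
  exact not_lt_bot hβα'

end Construction

/-- Fewer than `μ` ordinals below a regular cardinal `μ` are bounded below `μ`. -/
theorem exists_bound_of_mk_lt {μ : Cardinal.{u}} (hμ : μ.IsRegular) {A : Set Ordinal.{u}}
    (hA : A ⊆ Set.Iio μ.ord) (hcard : #A < Cardinal.lift.{u + 1} μ) :
    ∃ ρ < μ.ord, ∀ x ∈ A, x ≤ ρ := by
  have hlt : #A < Cardinal.univ.{u, u + 1} := hcard.trans (Cardinal.lift_lt_univ μ)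
  have : Small.{u} A := by
    rw [Cardinal.small_iff_lift_mk_lt_univ]
    simpa using hlt
  have hcard' : #(Shrink.{u} A) < μ := by
    rw [← Cardinal.lift_lt.{u, u + 1}]
    refine lt_of_eq_of_lt ?_ hcard
    have := (Cardinal.lift_mk_eq'.{u, u + 1}).2 ⟨(equivShrink.{u} A).symm⟩
    rw [this, Cardinal.lift_id'.{u, u + 1}]
  refine ⟨⨆ i : Shrink.{u} A, ((equivShrink A).symm i : Ordinal.{u}),
    Ordinal.iSup_lt_of_lt_cof (by rwa [hμ.cof_ord]) fun i => hA ((equivShrink A).symm i).2, ?_⟩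
  intro x hx
  have := Ordinal.le_iSup (fun i : Shrink.{u} A => ((equivShrink A).symm i : Ordinal.{u}))
    (equivShrink A ⟨x, hx⟩)
  simpa using this

/-! ### Extension along a pair of branches -/

namespace Construction

open OrdGraph

/-- The node of level `α` on the branch given by `η` and `ν`, with constant third component and
closed set `C`. -/
def branchNode (η ν : Ordinal.{u} → Bool) (α : Ordinal.{u}) (C : Set Ordinal.{u}) : TNode.{u} :=
  ⟨α, cutFun η (bth α), cutFun ν (bth α), fun _ => false, C⟩

variable {K : Construction.{u}} {μ : Cardinal.{u}} {η ν : Ordinal.{u} → Bool}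
  {u v : TNode.{u}} {α β ξ₀ : Ordinal.{u}} {C : Set Ordinal.{u}}

theorem cutFun_false (δ : Ordinal.{u}) : cutFun (fun _ => false) δ = fun _ => false := by
  funext ξ
  simp [cutFun]

theorem cut_branchNode (hβ : β ≤ α) (h0 : β ≠ 0) :
    (branchNode η ν α C).cut β = branchNode η ν β (C ∩ Set.Iio β) := by
  have hb := bth_le_bth.2 hβ
  rw [TNode.cut_of_ne _ h0]
  simp only [branchNode, cutFun_cutFun _ hb]
  rw [cutFun_false]

/-- The functions `η` and `ν` have their first difference at `ξ₀`, where `η` is smaller. -/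
structure LexLtAt (η ν : Ordinal.{u} → Bool) (ξ₀ : Ordinal.{u}) : Prop where
  agree : AgreeBelow η ν ξ₀
  fst : η ξ₀ = false
  snd : ν ξ₀ = true

theorem branchNode_mem_TLt (hlex : LexLtAt η ν ξ₀) (hα : α < K.κ.ord) (h0 : α ≠ 0)
    (hξ : ξ₀ < bth α) (hC : C ⊆ Set.Iio α)
    (hclosed : ∀ X ⊆ C, X.Nonempty → sSup X < α → sSup X ∈ C) :
    branchNode η ν α C ∈ K.TLt := by
  have hL : (branchNode η ν α C).LexLt := by
    refine ⟨ξ₀, hξ, fun x hx => ?_, ?_, ?_⟩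
    · simp only [branchNode, cutFun_of_lt (hx.trans hξ)]
      exact hlex.agree x hx
    · simp only [branchNode, cutFun_of_lt hξ]
      exact hlex.fst
    · simp only [branchNode, cutFun_of_lt hξ]
      exact hlex.snd
  refine ⟨mem_T_iff.2 ⟨hα, rfl, fun h => (h0 h).elim, fun _ => ⟨?_, ?_, ?_, hL.ne, hC, hclosed⟩⟩,
    hL⟩
  · exact cutFun_cutFun _ le_rfl
  · exact cutFun_cutFun _ le_rfl
  · exact cutFun_false _

/-- The positions of the game: the nodes on the branch given by `η` and `ν` which are below `μ` and
can be prolonged within `U`. The last two conditions make the limits of increasing sequences of such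
nodes satisfy clause (ii) of the definition of `T^G`. -/
structure IsBranch (K : Construction.{u}) (μ : Cardinal.{u}) (η ν : Ordinal.{u} → Bool)
    (u : TNode.{u}) : Prop where
  eq : u = branchNode η ν u.ord u.cub
  mem_U : u ∈ K.U
  mem_TLt : u ∈ K.TLt
  ord_lt : u.ord < μ.ord
  meets_gInds : u.ord ∈ gInds ∨ (u.cub ∩ gInds).Nonempty
  hered : ∀ β ∈ u.cub, u.cut β ∈ K.TH ∨ K.TG (u.cut β)

theorem blockConst_branch (hη : BlockConst μ.ord η) (hν : BlockConst μ.ord ν) (hα : α < μ.ord) :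
    BlockConst α (branchNode η ν α C).fst ∧ BlockConst α (branchNode η ν α C).snd ∧
      BlockConst α (branchNode η ν α C).trd :=
  ⟨hη.cutFun hα.le, hν.cutFun hα.le, fun _ _ => rfl, fun _ _ _ _ _ => rfl⟩

theorem TH.add_one_lt (hK : K.Admissible) (hu : u ∈ K.TH) (h0 : u ≠ TNode.root) (hβ : β < u.ord) :
    β + 1 < u.ord := by
  obtain ⟨s, t, r, hE⟩ := TH.exists_elemInitial hu h0
  exact hE.add_one_lt (R := SigmaRel.mem) (fun v => Iff.rfl) hK.inaccessible
    (mem_T_iff.1 hu.1).1.le hβ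

section Extension

variable (hK : K.Admissible) (hμ : K.IsReflecting μ) (hη : BlockConst μ.ord η)
  (hν : BlockConst μ.ord ν) (hlex : LexLtAt η ν ξ₀)

include hK hμ hη hν hlex

/-- Increasing sequences of limit length `< λ` on the branch have an upper bound in `T^G`. -/
theorem IsBranch.exists_limit {i : Ordinal.{u}} (hi : Order.IsSuccLimit i) (hilam : i < K.lam.ord)
    (f : Ordinal.{u} → TNode.{u}) (hf : ∀ j < i, K.IsBranch μ η ν (f j))
    (hchain : ∀ j k, j < k → k < i → (f j).Below (f k)) :
    ∃ u, K.IsBranch μ η ν u ∧ ∀ j < i, (f j).Below u := by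
  have hlevel : ∀ j < i, f j ∈ TNode.Level (f j).ord := fun j hj =>
    level_of_mem_U hK (hf j hj).mem_U
  have hcubs : ∀ j < i, (f j).cub ⊆ Set.Iio (f j).ord := fun j hj =>
    TNode.level_cub_subset (hlevel j hj)
  have hlt : ∀ j k, j < k → k < i → (f j).ord < (f k).ord := fun j k hjk hk =>
    hcubs k hk (hchain j k hjk hk).2
  set A : Set Ordinal.{u} := (fun j => (f j).ord) '' Set.Iio i with hA
  have hcardA : #A < Cardinal.lift.{u + 1} K.lam := by
    refine Cardinal.mk_image_le.trans_lt ?_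
    rw [Cardinal.mk_Iio_ordinal]
    exact Cardinal.lift_lt.2 (lt_ord.1 hilam)
  have hAμ : A ⊆ Set.Iio μ.ord := by
    rintro _ ⟨j, hj, rfl⟩
    exact (hf j hj).ord_lt
  obtain ⟨ρ, hρ, hAρ⟩ := exists_bound_of_mk_lt hμ.isRegular hAμ
    (hcardA.trans (Cardinal.lift_lt.2 hμ.lam_lt))
  set α := sSup A with hα
  have hαμ : α < μ.ord := (csSup_le' hAρ).trans_lt hρ
  have hsucc : ∀ j < i, j + 1 < i := fun j hj => hi.add_one_lt hj
  have hjα : ∀ j < i, (f j).ord < α := fun j hj =>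
    (hlt j (j + 1) (Order.lt_add_one_iff.2 le_rfl) (hsucc j hj)).trans_le
      (le_csSup ⟨ρ, hAρ⟩ ⟨_, hsucc j hj, rfl⟩)
  have hltα : ∀ x < α, ∃ j < i, x < (f j).ord := by
    intro x hx
    have hne : A.Nonempty := ⟨_, 0, hi.bot_lt, rfl⟩
    obtain ⟨_, ⟨j, hj, rfl⟩, hxj⟩ := exists_lt_of_lt_csSup hne hx
    exact ⟨j, hj, hxj⟩
  set C : Set Ordinal.{u} := {x | ∃ j < i, x ∈ (f j).cub} with hC
  have hordC : ∀ j < i, (f j).ord ∈ C := fun j hj =>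
    ⟨j + 1, hsucc j hj, (hchain j (j + 1) (Order.lt_add_one_iff.2 le_rfl) (hsucc j hj)).2⟩
  have hCα : C ⊆ Set.Iio α := by
    rintro x ⟨j, hj, hx⟩
    exact (hcubs j hj hx).trans (hjα j hj)
  have hCj : ∀ j < i, C ∩ Set.Iio (f j).ord = (f j).cub := by
    intro j hj
    ext x
    constructor
    · rintro ⟨⟨k, hk, hx⟩, hxj⟩
      rcases lt_trichotomy k j with h | h | h
      · have := (hchain k j h hj).1
        rw [this, TNode.cut_cub] at hx
        exact hx.1
      · exact h ▸ hx
      · have := (hchain j k h hk).1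
        rw [this, TNode.cut_cub]
        exact ⟨hx, hxj⟩
    · exact fun hx => ⟨⟨j, hj, hx⟩, hcubs j hj hx⟩
  have hj0 : ∀ j < i, (f j).ord ≠ 0 := fun j hj =>
    ord_ne_zero (hf j hj).mem_TLt.1 (mem_TLt_ne_root (hf j hj).mem_TLt)
  have hclosed : ∀ X ⊆ C, X.Nonempty → sSup X < α → sSup X ∈ C := by
    intro X hX hne hlt
    obtain ⟨j, hj, hXj⟩ := hltα _ hlt
    have hX' : X ⊆ (f j).cub := by
      intro x hx
      rw [← hCj j hj]
      exact ⟨hX hx, (le_csSup ⟨α, fun y hy => (hCα (hX hy)).le⟩ hx).trans_lt hXj⟩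
    exact ⟨j, hj, ((hlevel j hj).2.2 (hj0 j hj)).2.2.2.2.2 X hX' hne hXj⟩
  have h0i : (0 : Ordinal.{u}) < i := hi.bot_lt
  have hα0 : α ≠ 0 := pos_iff_ne_zero.1 (bot_le.trans_lt (hjα 0 h0i))
  set u := branchNode η ν α C with hu
  have hξα : ξ₀ < bth α := by
    -- The levels of the nodes of `T_<` on the branch are above the first difference.
    obtain ⟨ξ, hξ, hag, h1, h2⟩ := (hf 0 h0i).mem_TLt.2
    rw [(hf 0 h0i).eq] at h1 h2
    simp only [branchNode, cutFun_of_lt hξ] at h1 h2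
    refine lt_of_le_of_lt (not_lt.1 fun h => ?_) (hξ.trans (bth_lt_bth.2 (hjα 0 h0i)))
    have := hlex.agree ξ h
    rw [h1, h2] at this
    exact Bool.noConfusion this
  have huT : u ∈ K.TLt :=
    branchNode_mem_TLt hlex (hαμ.trans_le hμ.le) hα0 hξα hCα hclosed
  have hcut : ∀ j < i, u.cut (f j).ord = f j := by
    intro j hj
    rw [cut_branchNode (hjα j hj).le (hj0 j hj), hCj j hj]
    exact (hf j hj).eq.symm
  have hered : ∀ β ∈ u.cub, u.cut β ∈ K.TH ∨ K.TG (u.cut β) := by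
    rintro β ⟨j, hj, hβ⟩
    have : u.cut β = (f j).cut β := by rw [← hcut j hj, TNode.cut_cut _ (hcubs j hj hβ).le]
    rw [this]
    exact (hf j hj).hered β hβ
  have hgInds : (u.cub ∩ gInds).Nonempty := by
    rcases (hf 0 h0i).meets_gInds with h | ⟨β, h, h'⟩
    · exact ⟨_, hordC 0 h0i, h⟩
    · exact ⟨β, ⟨0, h0i, h⟩, h'⟩
  have hsup : sSup C = α := by
    refine le_antisymm (csSup_le' fun x hx => (hCα hx).le) (csSup_le' ?_)
    rintro _ ⟨j, hj, rfl⟩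
    exact le_csSup ⟨α, fun x hx => (hCα hx).le⟩ (hordC j hj)
  have hcof : α.cof < K.lam := by
    let s : Set (Set.Iio α) := Subtype.val ⁻¹' A
    have hs : IsCofinal s := by
      rintro ⟨x, hx⟩
      obtain ⟨j, hj, hxj⟩ := hltα x hx
      exact ⟨⟨(f j).ord, hjα j hj⟩, ⟨j, hj, rfl⟩, hxj.le⟩
    have h1 := Order.cof_le hs
    rw [Ordinal.cof_Iio, ← Ordinal.lift_cof] at h1
    have h2 : #s ≤ #A := Cardinal.mk_preimage_of_injective _ _ Subtype.val_injective
    exact Cardinal.lift_lt.1 ((h1.trans h2).trans_lt hcardA)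
  have huG : K.TG u := by
    refine TG.limit u huT hsup hgInds hcof fun β hβ h => ?_
    exact (hered β hβ).resolve_left h
  have huU : u ∈ K.U := ⟨Or.inr huG, Or.inr (blockConst_branch hη hν hαμ)⟩
  exact ⟨u, ⟨rfl, huU, huT, hαμ, Or.inr hgInds, hered⟩, fun j hj =>
    ⟨(hcut j hj).symm, hordC j hj⟩⟩

variable (hξ₀ : ξ₀ < μ.ord)

include hξ₀

/-- Each node on the branch has successors in `T^G`, on unboundedly many levels. -/
theorem IsBranch.exists_succ (hv : v = TNode.root ∨ K.IsBranch μ η ν v) {ρ : Ordinal.{u}}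
    (hρ : ρ < μ.ord) :
    ∃ u β, K.IsBranch μ η ν u ∧ K.IsSuccOf u v ∧ u ∉ K.TH ∧ u.ord = β + 1 ∧ ρ < β ∧ v.ord < β ∧
      ¬ AgreeBelow u.fst u.snd (bth β) := by
  have hlim := Cardinal.isSuccLimit_ord hμ.isRegular.aleph0_le
  have hvU : v ∈ K.U := hv.elim (fun h => h ▸ root_mem_U) fun h => h.mem_U
  have hvord : v.ord < μ.ord := hv.elim (fun h => h ▸ hlim.bot_lt) fun h => h.ord_lt
  have hvL := level_of_mem_U hK hvU
  have hvcub := TNode.level_cub_subset hvL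
  have hvπ : v ∈ {TNode.root} ∪ K.TLt := hv.imp id fun h => h.mem_TLt
  -- The new node is on a level `γ + 2` with `π(γ + 2) = v`, and `γ + 1` is above `m`.
  set m := max ρ (max v.ord ξ₀) with hm
  have hmμ : m < μ.ord := max_lt hρ (max_lt hvord hξ₀)
  obtain ⟨α, hαg, hmα, hαμ, hπ⟩ := hμ.π_unbounded v hvπ hvord (m + 1) (hlim.add_one_lt hmμ)
  obtain ⟨γ, hγ⟩ := hαg
  have hmγ : m < γ + 1 := by
    rw [hγ] at hmα
    have := Order.lt_add_one_iff.1 hmα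
    exact Order.add_one_le_iff.1 this
  have hγα : γ + 1 < α := by rw [hγ]; exact Order.lt_add_one_iff.2 le_rfl
  have hξγ : ξ₀ < bth (γ + 1) :=
    (((le_max_right _ _).trans (le_max_right _ _)).trans_lt hmγ).trans_le (le_bth _)
  have hvγ : v.ord < γ + 1 := ((le_max_left _ _).trans (le_max_right _ _)).trans_lt hmγ
  have hvα : v.ord < α := hvγ.trans hγα
  have hα0 : α ≠ 0 := (pos_iff_ne_zero.1 (bot_le.trans_lt hvα))
  set C := v.cub ∪ {v.ord} with hC
  have hle : ∀ x ∈ C, x ≤ v.ord := by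
    rintro x (hx | hx)
    · exact (hvcub hx).le
    · exact le_of_eq hx
  have hgr : IsGreatest C v.ord := ⟨Or.inr rfl, hle⟩
  have hCv : C ∩ Set.Iio v.ord = v.cub := by
    ext x
    constructor
    · rintro ⟨hx | hx, hx'⟩
      · exact hx
      · exact (ne_of_lt hx' hx).elim
    · exact fun hx => ⟨Or.inl hx, hvcub hx⟩
  have hclosed : ∀ X ⊆ C, X.Nonempty → sSup X < α → sSup X ∈ C := by
    intro X hX hne _
    have hsup : sSup X ≤ v.ord := csSup_le hne fun x hx => hle x (hX hx)
    rcases hsup.eq_or_lt with h | h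
    · exact Or.inr h
    · left
      have hX' : X ⊆ v.cub := by
        intro x hx
        refine (hX hx).resolve_right fun h' => ?_
        have h' : x = v.ord := h'
        have := le_csSup ⟨v.ord, fun y hy => hle y (hX hy)⟩ hx
        exact absurd h (not_lt.2 (h' ▸ this))
      have hv0 : v.ord ≠ 0 := pos_iff_ne_zero.1 (bot_le.trans_lt h)
      exact (hvL.2.2 hv0).2.2.2.2.2 X hX' hne h
  set u := branchNode η ν α C with hu
  have huT : u ∈ K.TLt := branchNode_mem_TLt hlex (hαμ.trans_le hμ.le) hα0
    (hξγ.trans (bth_lt_bth.2 hγα)) (fun x hx => (hle x hx).trans_lt hvα) hclosed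
  have hcut : u.cut v.ord = v := by
    rcases hv with rfl | hv
    · exact TNode.cut_zero _
    · rw [cut_branchNode hvα.le (ord_ne_zero hv.mem_TLt.1 (mem_TLt_ne_root hv.mem_TLt)), hCv]
      exact hv.eq.symm
  have hsup : sSup C = v.ord := hgr.csSup_eq
  have huG : K.TG u := by
    refine TG.succ u v.ord huT ?_ ⟨γ, hγ⟩ hgr ?_ ?_
    · exact hsup.trans_lt hvα
    · rw [hcut]; exact hπ
    · rw [hcut]; exact fun h => hvU.1.resolve_left h
  have huU : u ∈ K.U := ⟨Or.inr huG, Or.inr (blockConst_branch hη hν hαμ)⟩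
  have hvu : v.Below u := ⟨hcut.symm, Or.inr rfl⟩
  have huord : u.ord = γ + 1 + 1 := hγ
  refine ⟨u, γ + 1, ⟨rfl, huU, huT, hαμ, Or.inl ⟨γ, hγ⟩, ?_⟩, ⟨hvU, hvu, ?_⟩, ?_, huord,
    (le_max_left _ _).trans_lt hmγ, hvγ, ?_⟩
  · rintro β (hβ | hβ)
    · have : u.cut β = v.cut β := by rw [← hcut, TNode.cut_cut _ (hvcub hβ).le]
      rw [this]
      rcases hv with rfl | hv
      · exact (hβ : β ∈ (∅ : Set Ordinal)).elim
      · exact hv.hered β hβ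
    · have hβ : β = v.ord := hβ
      rw [hβ, hcut]
      exact hvU.1
  · rintro ⟨w, hw, hvw, hwu⟩
    exact absurd (ord_lt_of_below hK hw hvw) (hle _ hwu.2).not_gt
  · -- The levels of the nodes of `T^H` other than the root are limit ordinals.
    intro hH
    have := TH.add_one_lt hK hH (mem_TLt_ne_root huT) (β := γ + 1)
      (by rw [huord]; exact Order.lt_add_one_iff.2 le_rfl)
    rw [huord] at this
    exact this.false
  · intro hag
    have := hag ξ₀ hξγ
    simp only [hu, branchNode, cutFun_of_lt (hξγ.trans (bth_lt_bth.2 hγα))] at this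
    rw [hlex.fst, hlex.snd] at this
    exact Bool.noConfusion this

/-- Two successor steps suffice to cover a bounded set both by the domain and by the range. -/
theorem IsBranch.exists_cover (hv : v = TNode.root ∨ K.IsBranch μ η ν v) {ρ : Ordinal.{u}}
    (hρ : ρ < μ.ord) :
    ∃ u, K.IsBranch μ η ν u ∧ v.Below u ∧ Set.Iio ρ ⊆ (K.p u).dom ∧ Set.Iio ρ ⊆ (K.p u).ran := by
  obtain ⟨u₁, β₁, h1, hs1, hH1, hβ1, hρ1, hv1, hag1⟩ :=
    IsBranch.exists_succ hK hμ hη hν hlex hξ₀ hv hρ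
  obtain ⟨u₂, β₂, h2, hs2, hH2, hβ2, hρ2, hv2, hag2⟩ :=
    IsBranch.exists_succ hK hμ hη hν hlex hξ₀ (Or.inr h1) hρ
  have c1 := p_succ_cover hK h1.mem_U h1.mem_TLt hH1 hs1 hβ1
  have c2 := p_succ_cover hK h2.mem_U h2.mem_TLt hH2 hs2 hβ2
  have hmono := p_mono hK h2.mem_U hs2.1 hs2.2.1
  have hI1 : Set.Iio ρ ⊆ Set.Iio (bth β₁) := Set.Iio_subset_Iio (hρ1.le.trans (le_bth _))
  have hI2 : Set.Iio ρ ⊆ Set.Iio (bth β₂) := Set.Iio_subset_Iio (hρ2.le.trans (le_bth _))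
  refine ⟨u₂, h2, hs1.2.1.trans hs2.2.1, ?_⟩
  -- If the range of `p_v` is an ordinal, the first step enlarges the domain and leaves a gap in the
  -- range, so that the second step enlarges the range; otherwise it is the other way round.
  by_cases hran : ∃ o, (K.p v).ran = Set.Iio o
  · obtain ⟨h3, h4⟩ := c1.1 hran
    obtain ⟨h5, -⟩ := c2.2 (h4 hv1 hag1)
    exact ⟨(hI1.trans h3).trans (dom_mono hmono), hI2.trans h5⟩
  · obtain ⟨h3, h4⟩ := c1.2 hran
    obtain ⟨h5, -⟩ := c2.1 h4
    exact ⟨hI2.trans h5, (hI1.trans h3).trans (ran_mono hmono)⟩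

/-- Increasing sequences of length `< λ` on the branch can be extended by a node whose function
covers a given bounded set. -/
theorem IsBranch.exists_extension {i : Ordinal.{u}} (hilam : i < K.lam.ord)
    (f : Ordinal.{u} → TNode.{u}) (hf : ∀ j < i, K.IsBranch μ η ν (f j))
    (hchain : ∀ j k, j < k → k < i → (f j).Below (f k)) {ρ : Ordinal.{u}} (hρ : ρ < μ.ord) :
    ∃ u, K.IsBranch μ η ν u ∧ (∀ j < i, (f j).Below u) ∧
      Set.Iio ρ ⊆ (K.p u).dom ∧ Set.Iio ρ ⊆ (K.p u).ran := by
  obtain ⟨v, hv, hfv⟩ : ∃ v, (v = TNode.root ∨ K.IsBranch μ η ν v) ∧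
      ∀ j < i, f j = v ∨ (f j).Below v := by
    rcases zero_or_succ_or_isSuccLimit i with rfl | ⟨k, rfl⟩ | hi
    · exact ⟨TNode.root, Or.inl rfl, fun j hj => (not_lt_bot hj).elim⟩
    · have hk : k < Order.succ k := Order.lt_succ k
      refine ⟨f k, Or.inr (hf k hk), fun j hj => ?_⟩
      rcases (Order.lt_succ_iff.1 hj).eq_or_lt with h | h
      · exact Or.inl (h ▸ rfl)
      · exact Or.inr (hchain j k h hk)
    · obtain ⟨u, hu, hfu⟩ := IsBranch.exists_limit hK hμ hη hν hlex hi hilam f hf hchain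
      exact ⟨u, Or.inr hu, fun j hj => Or.inr (hfu j hj)⟩
  obtain ⟨u, hu, hvu, h1, h2⟩ := IsBranch.exists_cover hK hμ hη hν hlex hξ₀ hv hρ
  refine ⟨u, hu, fun j hj => ?_, h1, h2⟩
  rcases hfv j hj with h | h
  · rw [h]; exact hvu
  · exact h.trans hvu

end Extension

end Construction

/-! ### Systems of partial isomorphisms, games and infinitary equivalence -/

section Game

variable {V : InfVoc.{a, b}} {M N : InfModel.{a, b, c} V} {μ lam : Cardinal.{u}}

/-- A system of partial isomorphisms `g u`, `u ∈ I`, with a relation `R` of extension, in which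
sequences of length `< λ` can be extended so as to answer any move of player `∀`. -/
structure IsChainSystem (μ lam : Cardinal.{u}) {I : Type w} (R : I → I → Prop)
    (g : I → Set (M.carrier × N.carrier)) : Prop where
  isPartialIso : ∀ u, IsPartialIso M N (g u)
  mono : ∀ u v, R u v → g u ⊆ g v
  extend : ∀ i < lam.ord, ∀ f : Ordinal.{u} → I, (∀ j k, j < k → k < i → R (f j) (f k)) →
    ∀ m : EFMove M N, m.Legal μ → ∃ u, (∀ j < i, R (f j) u) ∧ m.Covers (g u)

section Strategy

variable {I : Type w} [Nonempty I] (R : I → I → Prop) (g : I → Set (M.carrier × N.carrier))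

/-- The position after round `i`, if player `∃` answers the moves `m` by means of a system. -/
def gameState (m : Ordinal.{u} → EFMove M N) : Ordinal.{u} → I :=
  WellFoundedLT.fix fun i ih =>
    open Classical in
    Classical.epsilon fun u => (∀ j, ∀ h : j < i, R (ih j h) u) ∧ (m i).Covers (g u)

theorem gameState_eq (m : Ordinal.{u} → EFMove M N) (i : Ordinal.{u}) :
    gameState R g m i = Classical.epsilon fun u =>
      (∀ j < i, R (gameState R g m j) u) ∧ (m i).Covers (g u) := by
  rw [gameState, WellFoundedLT.fix_eq]

/-- The position depends only on the moves made so far. -/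
theorem gameState_congr {m m' : Ordinal.{u} → EFMove M N} {i : Ordinal.{u}}
    (h : ∀ j ≤ i, m j = m' j) : gameState R g m i = gameState R g m' i := by
  induction i using WellFoundedLT.induction with
  | ind i ih =>
    rw [gameState_eq, gameState_eq]
    congr 1
    funext u
    rw [h i le_rfl]
    congr 1
    refine propext (forall₂_congr fun j hj => ?_)
    rw [ih j hj fun k hk => h k (hk.trans hj.le)]

variable {R g}

theorem gameState_spec (hS : IsChainSystem μ lam R g) {m : Ordinal.{u} → EFMove M N}
    (hm : ∀ i < lam.ord, (m i).Legal μ) {i : Ordinal.{u}} (hi : i < lam.ord) :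
    (∀ j < i, R (gameState R g m j) (gameState R g m i)) ∧
      (m i).Covers (g (gameState R g m i)) := by
  induction i using WellFoundedLT.induction with
  | ind i ih =>
    have := hS.extend i hi (gameState R g m)
      (fun j k hjk hk => (ih k hk (hk.trans hi)).1 j hjk) (m i) (hm i hi)
    rw [gameState_eq R g m i]
    exact Classical.epsilon_spec this

end Strategy

/-- A chain system provides a winning strategy. -/
theorem IsChainSystem.efEquiv {I : Type w} [Nonempty I] {R : I → I → Prop}
    {g : I → Set (M.carrier × N.carrier)} (hS : IsChainSystem μ lam R g) : EFEquiv μ lam M N := by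
  refine ⟨fun i m => g (gameState R g
    (fun j => open Classical in
      if h : j ≤ i.1 then m ⟨⟨j, h.trans_lt i.2⟩, h⟩ else .inl ∅) i.1), ?_⟩
  intro m hm
  let m' : Ordinal.{u} → EFMove M N := fun j =>
    open Classical in if h : j < lam.ord then m ⟨j, h⟩ else .inl ∅
  have hm' : ∀ i < lam.ord, (m' i).Legal μ := by
    intro i hi
    simp only [m', hi, dif_pos]
    exact hm _
  have hσ : ∀ i : Set.Iio lam.ord, gameState R g
      (fun j => open Classical in if h : j ≤ i.1 then m ⟨j, h.trans_lt i.2⟩ else .inl ∅) i.1 =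
      gameState R g m' i.1 := by
    intro i
    refine gameState_congr R g fun j hj => ?_
    simp only [m', hj, hj.trans_lt i.2, dif_pos]
  intro i
  have hspec := gameState_spec hS hm' i.2
  simp only [hσ]
  refine ⟨hS.isPartialIso _, ?_, ?_⟩
  · refine Set.iUnion_subset fun j => ?_
    exact hS.mono _ _ (hspec.1 j.1.1 j.2)
  · have : m' i.1 = m i := dif_pos i.2
    rw [← this]
    exact hspec.2

/-- A chain system with extensions of one-element sequences is a back-and-forth system, so related
tuples satisfy the same formulas. -/
theorem IsChainSystem.lEquiv {I : Type w} [Nonempty I] {R : I → I → Prop}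
    {g : I → Set (M.carrier × N.carrier)} (hS : IsChainSystem μ lam R g) (hlam : 1 < lam) :
    LEquiv μ M N := by
  have hone : (1 : Ordinal.{u}) < lam.ord := by
    rw [← ord_one]; exact ord_lt_ord.2 hlam
  have hext : ∀ (u : I) (m : EFMove M N), m.Legal μ → ∃ v, g u ⊆ g v ∧ m.Covers (g v) := by
    intro u m hm
    obtain ⟨v, h1, h2⟩ := hS.extend 1 hone (fun _ => u) (fun j k hjk hk => by
      have h0 := Order.lt_one_iff.1 hk
      rw [h0] at hjk
      exact (not_lt_bot hjk).elim) m hm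
    exact ⟨v, hS.mono _ _ (h1 0 zero_lt_one), h2⟩
  have key : ∀ {α : Type u} (f : InfFormula V μ α) (u : I) (x : α → M.carrier) (y : α → N.carrier),
      (∀ i, (x i, y i) ∈ g u) → (f.Realize M x ↔ f.Realize N y) := by
    intro α f
    induction f with
    | rel R z =>
      intro u x y hxy
      exact (hS.isPartialIso u).rel_iff R _ _ fun i => hxy _
    | eq s t =>
      intro u x y hxy
      have hs := hxy s
      have ht := hxy t
      constructor
      · intro h
        have h : x s = x t := h
        rw [h] at hs
        exact (hS.isPartialIso u).functional _ _ _ hs ht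
      · intro h
        have h : y s = y t := h
        rw [h] at hs
        exact (hS.isPartialIso u).injective _ _ _ hs ht
    | neg f ih =>
      intro u x y hxy
      exact not_congr (ih u x y hxy)
    | conj f ih =>
      intro u x y hxy
      exact forall_congr' fun i => ih i u x y hxy
    | ex β hβ f ih =>
      intro u x y hxy
      constructor
      · rintro ⟨z, hz⟩
        obtain ⟨v, huv, hv⟩ := hext u (.inl (Set.range z)) <|
          (Cardinal.mk_range_le_lift (f := z)).trans_lt (Cardinal.lift_lt.2 hβ)
        have hv' : ∀ i, ∃ t, (z i, t) ∈ g v := by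
          intro i
          obtain ⟨⟨s, t⟩, hst, h⟩ := hv ⟨i, rfl⟩
          have h : s = z i := h
          exact ⟨t, h ▸ hst⟩
        choose t ht using hv'
        refine ⟨t, (ih v (Sum.elim x z) (Sum.elim y t) ?_).1 hz⟩
        rintro (i | i)
        · exact huv (hxy i)
        · exact ht i
      · rintro ⟨z, hz⟩
        obtain ⟨v, huv, hv⟩ := hext u (.inr (Set.range z)) <|
          (Cardinal.mk_range_le_lift (f := z)).trans_lt (Cardinal.lift_lt.2 hβ)
        have hv' : ∀ i, ∃ t, (t, z i) ∈ g v := by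
          intro i
          obtain ⟨⟨s, t⟩, hst, h⟩ := hv ⟨i, rfl⟩
          have h : t = z i := h
          exact ⟨s, h ▸ hst⟩
        choose t ht using hv'
        refine ⟨t, (ih v (Sum.elim x t) (Sum.elim y z) ?_).2 hz⟩
        rintro (i | i)
        · exact huv (hxy i)
        · exact ht i
  intro f
  exact key f (Classical.arbitrary I) _ _ fun i => i.elim

end Game

/-! ### Back-and-forth between the models -/

namespace Construction

open OrdGraph

variable {K : Construction.{u}} {μ : Cardinal.{u}} {η ν : Ordinal.{u} → Bool} {u : TNode.{u}}
  {ξ₀ : Ordinal.{u}}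

theorem model_rel_of_agree (hK : K.Admissible) (h : AgreeBelow η ν μ.ord) (a : BSeq μ)
    (x : Set.Iio a.len → Set.Iio μ.ord) (hx : (K.model μ η).rel a x) : (K.model μ ν).rel a x := by
  rcases hx with ⟨h1, h2⟩ | ⟨us, h1, h2⟩
  · exact Or.inl ⟨h1, h2.trans (h.mono a.bounded.le)⟩
  · refine Or.inr ⟨us, ⟨h1.isSeq, h1.isMinimal, h1.ord_lt, h1.beg, fun v hv => ?_⟩, h2⟩
    refine (h1.fin v hv).trans (h.mono (pSup_le ?_))
    rintro y ⟨_, ⟨i, rfl⟩, hy⟩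
    rw [List.take_length] at hy
    rw [comp_functional hK (fun v hv => (h1.isSeq.mem v hv).1) hy (h2 i)]
    exact (x i).2

theorem isChainSystem_diagonal (hK : K.Admissible) (h : AgreeBelow η ν μ.ord) :
    IsChainSystem (M := K.model μ η) (N := K.model μ ν) μ K.lam
      (fun _ _ : PUnit.{u + 2} => True) (fun _ => {x | x.1 = x.2}) where
  isPartialIso := fun _ =>
    { functional := fun x y y' (h1 : x = y) (h2 : x = y') => h1.symm.trans h2
      injective := fun x x' y (h1 : x = y) (h2 : x' = y) => h1.trans h2.symm
      rel_iff := fun a x y hxy => by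
        obtain rfl : x = y := funext hxy
        exact ⟨model_rel_of_agree hK h a x, model_rel_of_agree hK h.symm a x⟩ }
  mono := fun _ _ _ => subset_rfl
  extend := fun _ _ _ _ m _ => ⟨PUnit.unit, fun _ _ => trivial, match m with
    | .inl _ => fun x _ => ⟨(x, x), rfl, rfl⟩
    | .inr _ => fun x _ => ⟨(x, x), rfl, rfl⟩⟩

/-- The sets played in the game are bounded, so a function covers them as soon as its domain and
range contain a sufficiently large initial segment. -/
theorem covers_of_legal (hμ : μ.IsRegular) (m : EFMove (K.model μ η) (K.model μ ν))
    (hm : m.Legal μ) :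
    ∃ ρ < μ.ord, ∀ q : OrdGraph.{u}, (∀ x y, (x, y) ∈ q → x < μ.ord ∧ y < μ.ord) →
      Set.Iio ρ ⊆ q.dom → Set.Iio ρ ⊆ q.ran →
      m.Covers {x : Set.Iio μ.ord × Set.Iio μ.ord |
        ((x.1 : Ordinal.{u}), (x.2 : Ordinal.{u})) ∈ q} := by
  have hlim := Cardinal.isSuccLimit_ord hμ.aleph0_le
  have key : ∀ A : Set (Set.Iio μ.ord), Cardinal.lift.{u} #A < Cardinal.lift.{u + 1} μ →
      ∃ ρ < μ.ord, ∀ x ∈ A, x.1 < ρ := by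
    intro A hA
    rw [Cardinal.lift_id'.{u, u + 1}] at hA
    obtain ⟨ρ, hρ, h⟩ := exists_bound_of_mk_lt hμ (A := Subtype.val '' A)
      (by rintro _ ⟨x, -, rfl⟩; exact x.2) (Cardinal.mk_image_le.trans_lt hA)
    exact ⟨ρ + 1, hlim.add_one_lt hρ, fun x hx => Order.lt_add_one_iff.2 (h _ ⟨x, hx, rfl⟩)⟩
  rcases m with A | A
  · obtain ⟨ρ, hρ, h⟩ := key A hm
    refine ⟨ρ, hρ, fun q hq hd _ x hx => ?_⟩
    obtain ⟨y, hy⟩ := mem_dom.1 (hd (h x hx))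
    exact ⟨(x, ⟨y, (hq _ _ hy).2⟩), hy, rfl⟩
  · obtain ⟨ρ, hρ, h⟩ := key A hm
    refine ⟨ρ, hρ, fun q hq _ hr y hy => ?_⟩
    obtain ⟨x, hx⟩ := mem_ran.1 (hr (h y hy))
    exact ⟨(⟨x, (hq _ _ hx).1⟩, y), hx, rfl⟩

theorem IsBranch.agree (h : K.IsBranch μ η ν u) :
    AgreeBelow u.fst η (bth u.ord) ∧ AgreeBelow u.snd ν (bth u.ord) := by
  rw [h.eq]
  exact ⟨agreeBelow_cutFun _ _, agreeBelow_cutFun _ _⟩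

theorem IsBranch.p_lt (hK : K.Admissible) (hμ : K.IsReflecting μ) (h : K.IsBranch μ η ν u) :
    ∀ x y, (x, y) ∈ K.p u → x < μ.ord ∧ y < μ.ord := fun _ _ hxy =>
  have h1 := (p_good hK h.mem_U).bddBy _ _ hxy
  have h2 := hμ.bth_lt _ h.ord_lt
  ⟨h1.1.trans h2, h1.2.trans h2⟩

theorem isChainSystem_branch (hK : K.Admissible) (hμ : K.IsReflecting μ) (hη : BlockConst μ.ord η)
    (hν : BlockConst μ.ord ν) (hlex : LexLtAt η ν ξ₀) (hξ₀ : ξ₀ < μ.ord) :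
    IsChainSystem (M := K.model μ η) (N := K.model μ ν) μ K.lam
      (fun u v : {u // K.IsBranch μ η ν u} => u.1.Below v.1) (fun u => K.nodeGraph μ u.1) where
  isPartialIso := fun u =>
    isPartialIso_nodeGraph hK u.2.mem_U u.2.ord_lt u.2.agree.1 u.2.agree.2
  mono := fun u v huv _ hx => p_mono hK v.2.mem_U u.2.mem_U huv hx
  extend := fun i hi f hf m hm => by
    obtain ⟨ρ, hρ, hcov⟩ := covers_of_legal hμ.isRegular m hm
    obtain ⟨u, hu, hfu, h1, h2⟩ := IsBranch.exists_extension hK hμ hη hν hlex hξ₀ hi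
      (fun j => (f j).1) (fun j _ => (f j).2) hf hρ
    exact ⟨⟨u, hu⟩, hfu, hcov _ (hu.p_lt hK hμ) h1 h2⟩

theorem isChainSystem_branch_inv (hK : K.Admissible) (hμ : K.IsReflecting μ)
    (hη : BlockConst μ.ord η) (hν : BlockConst μ.ord ν) (hlex : LexLtAt ν η ξ₀)
    (hξ₀ : ξ₀ < μ.ord) :
    IsChainSystem (M := K.model μ η) (N := K.model μ ν) μ K.lam
      (fun u v : {u // K.IsBranch μ ν η u} => u.1.Below v.1)
      (fun u => K.nodeGraph μ u.1.inv) where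
  isPartialIso := fun u =>
    isPartialIso_nodeGraph hK (mem_U_inv hK u.2.mem_U) u.2.ord_lt u.2.agree.2 u.2.agree.1
  mono := fun u v huv _ hx => by
    have hsub : K.p u.1.inv ⊆ K.p v.1.inv := by
      rw [p_inv hK u.2.mem_U, p_inv hK v.2.mem_U]
      exact fun _ h => p_mono hK v.2.mem_U u.2.mem_U huv h
    exact hsub hx
  extend := fun i hi f hf m hm => by
    obtain ⟨ρ, hρ, hcov⟩ := covers_of_legal hμ.isRegular m hm
    obtain ⟨u, hu, hfu, h1, h2⟩ := IsBranch.exists_extension hK hμ hν hη hlex hξ₀ hi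
      (fun j => (f j).1) (fun j _ => (f j).2) hf hρ
    refine ⟨⟨u, hu⟩, hfu, hcov (K.p u.inv) ?_ ?_ ?_⟩
    · rw [p_inv hK hu.mem_U]
      exact fun x y hxy => (hu.p_lt hK hμ y x hxy).symm
    · rwa [p_inv hK hu.mem_U, dom_inv]
    · rwa [p_inv hK hu.mem_U, ran_inv]

theorem nonempty_branch (hK : K.Admissible) (hμ : K.IsReflecting μ) (hη : BlockConst μ.ord η)
    (hν : BlockConst μ.ord ν) (hlex : LexLtAt η ν ξ₀) (hξ₀ : ξ₀ < μ.ord) :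
    Nonempty {u // K.IsBranch μ η ν u} := by
  have h0 : (0 : Ordinal.{u}) < K.lam.ord :=
    (Cardinal.isSuccLimit_ord hK.lam_regular.aleph0_le).bot_lt
  obtain ⟨u, hu, -⟩ := IsBranch.exists_extension hK hμ hη hν hlex hξ₀ h0 (fun _ => TNode.root)
    (fun j hj => (not_lt_bot hj).elim) (fun j k _ hk => (not_lt_bot hk).elim) hξ₀
  exact ⟨⟨u, hu⟩⟩

/-- Between the models given by block-constant functions there is a chain system: the diagonal if
the functions are equal, and otherwise the functions `p_u` for the nodes `u` on the branch given by
the two functions, taken in lexicographic order. -/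
theorem exists_isChainSystem (hK : K.Admissible) (hμ : K.IsReflecting μ)
    (hη : BlockConst μ.ord η) (hν : BlockConst μ.ord ν) :
    ∃ (I : Type (u + 1)) (_ : Nonempty I) (R : I → I → Prop)
      (g : I → Set ((K.model μ η).carrier × (K.model μ ν).carrier)),
      IsChainSystem μ K.lam R g := by
  by_cases h : AgreeBelow η ν μ.ord
  · exact ⟨PUnit, inferInstance, _, _, isChainSystem_diagonal hK h⟩
  obtain ⟨ξ₀, hξ₀, hag, hne⟩ := exists_least_ne h
  cases h1 : η ξ₀ with
  | false =>
    have h2 : ν ξ₀ = true := by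
      rw [h1] at hne
      exact (Bool.eq_false_or_eq_true _).resolve_right fun h => hne h.symm
    have hlex : LexLtAt η ν ξ₀ := ⟨hag, h1, h2⟩
    exact ⟨_, nonempty_branch hK hμ hη hν hlex hξ₀, _, _,
      isChainSystem_branch hK hμ hη hν hlex hξ₀⟩
  | true =>
    have h2 : ν ξ₀ = false := by
      rw [h1] at hne
      exact (Bool.eq_false_or_eq_true _).resolve_left fun h => hne h.symm
    have hlex : LexLtAt ν η ξ₀ := ⟨hag.symm, h2, h1⟩
    exact ⟨_, nonempty_branch hK hμ hν hη hlex hξ₀, _, _,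
      isChainSystem_branch_inv hK hμ hη hν hlex hξ₀⟩

end Construction

end

theorem mainTheorem7 (K : Construction.{u}) (hK : K.Admissible) :
    (∀ μ : Cardinal.{u}, (μ.IsRegular ∧ μ.ord ∈ K.D) ∨ μ = K.κ →
      ∀ η ν : Ordinal.{u} → Bool, BlockConst μ.ord η → BlockConst μ.ord ν →
        EFEquiv μ K.lam (K.model μ η) (K.model μ ν)) ∧
    (∀ s t : Ordinal.{u} → Bool, BlockConst K.κ.ord s → BlockConst K.κ.ord t →
      LEquiv K.κ (K.model K.κ s) (K.model K.κ t)) := by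
  constructor
  · intro μ h η ν hη hν
    have hμ : K.IsReflecting μ := by
      rcases h with ⟨h1, h2⟩ | rfl
      · exact Construction.isReflecting_of_mem_D hK h1 h2
      · exact Construction.isReflecting_self hK
    obtain ⟨I, _, R, g, hS⟩ := Construction.exists_isChainSystem hK hμ hη hν
    exact hS.efEquiv
  · intro s t hs ht
    obtain ⟨I, _, R, g, hS⟩ :=
      Construction.exists_isChainSystem hK (Construction.isReflecting_self hK) hs ht
    exact hS.lEquiv (Cardinal.one_lt_aleph0.trans_le hK.lam_regular.aleph0_le)
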